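/- For $s\in\mathbb{C}$ and $x>0$ let $$J_s(x)=\sum_{n=0}^{\infty}\frac{(-1)^n}{\Gamma(n+1)\Gamma(n+1+s)}\left(\frac{x}{2}\right)^{s+2n}$$ be the Bessel function of the first kind, and for $x>0$, $v\in\mathbb{C}$ let $$k^{+}(x,v)=\frac{1}{2\cos(\pi v)}\bigl(J_{2v-1}(x)-J_{1-2v}(x)\bigr),$$ where at the (removable) singularities $\cos(\pi v)=0$ the value is the limit in $v$. Let $k\ge 1$ be an integer, $t\in\mathbb{R}$ and $0<z<1$. Then the (conditionally convergent) improper integral $$I(z)=\int_{0}^{\infty}J_{2k-1}(y)\,k^{+}\bigl(y\sqrt z,\tfrac12+it\bigr)\,dy=\lim_{R\to\infty}\int_0^R J_{2k-1}(y)\,k^{+}\bigl(y\sqrt z,\tfrac12+it\bigr)\,dy$$ converges, and $$I(z)=\frac{2}{\pi}\bigl(Q_0(z)+(-1)^kQ_1(z)\bigr),$$ where $$Q_0(z)=\int_{1}^{1/\sqrt z}\frac{\cos\bigl(2t\log(y+\sqrt{y^2-1})\bigr)}{\sqrt{1-zy^2}\,\sqrt{y^2-1}}\cos\bigl[(2k-1)\arcsin(y\sqrt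 z)\bigr]\,dy,$$ $$Q_1(z)=\int_{1/\sqrt z}^{\infty}\frac{\cos\bigl(2t\log(y+\sqrt{y^2-1})\bigr)}{\sqrt{y^2z-1}\,\sqrt{y^2-1}}\,\frac{dy}{\bigl(y\sqrt z+\sqrt{y^2z-1}\bigr)^{2k-1}},$$ both integrals being absolutely convergent. Moreover, there is an absolute constant $C>0$ such that for all integers $k\ge1$, all $t\in\mathbb{R}$ and all $0<z<1$ $$|I(z)|\le C\left(1+|\log z|+\frac{1}{(2k-1)\sqrt{1-z}}\right).$$ -/

import Mathlib

open MeasureTheory Filter Topology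

noncomputable section

namespace BesselDecomp

/-- The Bessel function of the first kind of complex order `s` at a real argument `x > 0`,
by its power series. Since `Complex.Gamma` is `0` at the poles of the Gamma function and
`a / 0 = 0`, the terms in which `Γ(n + 1 + s)` has a pole vanish, as they should. -/
def besselJ (s : ℂ) (x : ℝ) : ℂ :=
  ∑' n : ℕ, (-1 : ℂ) ^ n / (Complex.Gamma ((n : ℂ) + 1) * Complex.Gamma ((n : ℂ) + 1 + s)) *
    ((x : ℂ) / 2) ^ (s + 2 * (n : ℂ))

/-- The quotient `(J_{2v-1}(x) - J_{1-2v}(x)) / (2 cos (π v))`. -/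
def kPlusQuot (x : ℝ) (v : ℂ) : ℂ :=
  1 / (2 * Complex.cos (Real.pi * v)) * (besselJ (2 * v - 1) x - besselJ (1 - 2 * v) x)

open Classical in
/-- The kernel `k⁺(x, v)`. At the zeros of `cos (π v)`, which are removable singularities of the
quotient in `v`, it takes the limiting value. -/
def kPlus (x : ℝ) (v : ℂ) : ℂ :=
  if Complex.cos (Real.pi * v) = 0 then limUnder (𝓝[≠] v) (kPlusQuot x) else kPlusQuot x v

/-- The integrand `J_{2k-1}(y) k⁺(y √z, 1/2 + it)` of `I(z)`. -/
def integrandI (k : ℕ) (t z y : ℝ) : ℂ :=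
  besselJ (2 * (k : ℂ) - 1) y * kPlus (y * √z) (1 / 2 + t * Complex.I)

/-- The integral of `f` over `(0, ∞)` converges, possibly only conditionally at infinity,
with value `L`. -/
def HasImproperIntegral (f : ℝ → ℂ) (L : ℂ) : Prop :=
  (∀ R : ℝ, 0 < R → IntervalIntegrable f volume 0 R) ∧
    Tendsto (fun R : ℝ => ∫ y in (0 : ℝ)..R, f y) atTop (𝓝 L)

/-- `I(z) = ∫₀^∞ J_{2k-1}(y) k⁺(y √z, 1/2 + it) dy` as an improper integral at infinity
(it does not converge absolutely). -/
def integralI (k : ℕ) (t z : ℝ) : ℂ :=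
  limUnder atTop (fun R : ℝ => ∫ y in (0 : ℝ)..R, integrandI k t z y)

def integrandQ₀ (k : ℕ) (t z y : ℝ) : ℝ :=
  Real.cos (2 * t * Real.log (y + √(y ^ 2 - 1))) / (√(1 - z * y ^ 2) * √(y ^ 2 - 1)) *
    Real.cos ((2 * (k : ℝ) - 1) * Real.arcsin (y * √z))

def Q₀ (k : ℕ) (t z : ℝ) : ℝ :=
  ∫ y in (1 : ℝ)..(1 / √z), integrandQ₀ k t z y

def integrandQ₁ (k : ℕ) (t z y : ℝ) : ℝ :=
  Real.cos (2 * t * Real.log (y + √(y ^ 2 - 1))) / (√(y ^ 2 * z - 1) * √(y ^ 2 - 1)) *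
    (1 / (y * √z + √(y ^ 2 * z - 1)) ^ (2 * k - 1))

def Q₁ (k : ℕ) (t z : ℝ) : ℝ :=
  ∫ y in Set.Ioi (1 / √z), integrandQ₁ k t z y

end BesselDecomp

end

noncomputable section

namespace BesselDecomp

/-! For `v = 1/2 + it` the kernel has the Mehler–Sonine representation `k⁺(x, v) = (2/π) ∫₀^∞ cos(x
cosh ξ) cos(2tξ) dξ`. Inserting it and exchanging the integrations leaves, for each ξ, the cosine
transform of `J_{2k-1}` at `a = √z cosh ξ`. This is Weber's discontinuous integral, with one closed
form for `a < 1` and another for `a > 1` (`cosTransform_tendsto_cosLimit`). Under `y = cosh ξ` the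
break `a = 1` becomes `y = 1/√z`, and the two ranges give `Q₀` and `Q₁` (`integral_cosLimit`).

Neither the Mehler–Sonine integral nor `I(z)` converges absolutely, so the exchange is made with
both integrals truncated. Cutting ξ at `T` changes the kernel by at most `C/(x sinh T)`
(`abs_kernelReal_sub_kernelTrunc_le`). The factor `1/x` is absorbed by `|J_n(x)| ≤ x`, so `T → ∞` is
harmless for fixed `R` (`integral_besselInt_mul_kernelReal`). For `R → ∞`, the truncated transforms
are bounded by `C/√|1 - a|` uniformly in `R` (`abs_cosTransform_le`), which is integrable in ξ, so
dominated convergence applies. The pointwise limit exists by integration by parts against Bessel's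
equation; its value comes from Abel summation and the Laplace transform of `J_n`.

To connect the power series with these integrals, Hankel's formula for `1/Γ` (`hankel_eq`) is summed
termwise to Schläfli's representation (`besselJ_eq`). In the difference `J_w - J_{-w}` it exhibits
the factor that cancels `cos(πv)`.

For the final estimate the cosines are bounded by 1. An explicit majorant gives `7 + 2 log b` for
`Q₀`, with `b = 1/√z`. The decaying weight in `Q₁` is an exact derivative and yields
`1/((2k-1)√(1-z))`. -/

/-! ### Hankel's integral for the reciprocal Gamma function -/

open Complex in
lemma hasSum_pow_div_factorial_cexp (z : ℂ) :
    HasSum (fun m : ℕ => z ^ m / (m.factorial : ℂ)) (cexp z) := by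
  rw [Complex.exp_eq_exp_ℂ]
  exact NormedSpace.expSeries_div_hasSum_exp z

lemma hasSum_pow_div_factorial_exp (x : ℝ) :
    HasSum (fun m : ℕ => x ^ m / (m.factorial : ℝ)) (Real.exp x) := by
  rw [Real.exp_eq_exp_ℝ]
  exact NormedSpace.expSeries_div_hasSum_exp x

-- Termwise integration of the series of `exp(r e^{iθ})`; the factors `e^{imθ}` have modulus 1, so
-- `e^{|r|}` controls all partial sums.
open Complex in
lemma hasSum_integral_exp_circle (r : ℝ) (a : ℂ) :
    HasSum (fun m : ℕ => (r : ℂ) ^ m / (m.factorial : ℂ) *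
        ∫ θ in (-Real.pi)..Real.pi, cexp (I * (m + a) * θ))
      (∫ θ in (-Real.pi)..Real.pi, cexp (r * cexp (I * θ)) * cexp (I * a * θ)) := by
  have key := intervalIntegral.hasSum_integral_of_dominated_convergence (μ := volume)
    (a := -Real.pi) (b := Real.pi)
    (F := fun (m : ℕ) (θ : ℝ) => (r : ℂ) ^ m / (m.factorial : ℂ) * cexp (I * (m + a) * θ))
    (f := fun θ : ℝ => cexp (r * cexp (I * θ)) * cexp (I * a * θ))
    (fun m θ => |r| ^ m / (m.factorial : ℝ) * ‖cexp (I * a * θ)‖) ?_ ?_ ?_ ?_ ?_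
  · simpa only [intervalIntegral.integral_const_mul] using key
  · intro m
    exact (by fun_prop : Continuous _).aestronglyMeasurable
  · intro m
    refine ae_of_all _ fun θ _ => ?_
    have : cexp (I * (m + a) * θ) = cexp (((m : ℝ) * θ : ℝ) * I) * cexp (I * a * θ) := by
      rw [← Complex.exp_add]; congr 1; push_cast; ring
    rw [this, norm_mul, norm_mul, Complex.norm_exp_ofReal_mul_I]
    simp
  · refine ae_of_all _ fun θ _ => ?_
    exact (hasSum_pow_div_factorial_exp |r|).summable.mul_right _
  · have : (fun θ : ℝ => ∑' m : ℕ, |r| ^ m / (m.factorial : ℝ) * ‖cexp (I * a * θ)‖)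
        = fun θ : ℝ => Real.exp |r| * ‖cexp (I * a * θ)‖ := by
      ext θ
      rw [tsum_mul_right, (hasSum_pow_div_factorial_exp |r|).tsum_eq]
    rw [this]
    exact (by fun_prop : Continuous _).intervalIntegrable _ _
  · refine ae_of_all _ fun θ _ => ?_
    have := (hasSum_pow_div_factorial_cexp (r * cexp (I * θ))).mul_right (cexp (I * a * θ))
    refine this.congr_fun ?_
    intro m
    rw [mul_pow, ← Complex.exp_nat_mul]
    rw [show I * (m + a) * θ = m * (I * θ) + I * a * θ by ring, Complex.exp_add]
    ring

/-- A double-exponential decay bound. -/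
lemma exp_neg_mul_exp_le {r : ℝ} (hr : 0 < r) (A : ℝ) {ξ : ℝ} (hξ : 0 ≤ ξ) :
    Real.exp (-(r * Real.exp ξ)) * Real.exp (A * ξ) ≤
      Real.exp ((A + 1) ^ 2 / (2 * r)) * Real.exp (-ξ) := by
  rw [← Real.exp_add, ← Real.exp_add]
  apply Real.exp_le_exp.mpr
  have h1 : ξ ^ 2 / 2 ≤ Real.exp ξ := by
    have := Real.quadratic_le_exp_of_nonneg hξ
    linarith
  have h2 : (A + 1) * ξ - r * (ξ ^ 2 / 2) ≤ (A + 1) ^ 2 / (2 * r) := by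
    rw [le_div_iff₀ (by positivity)]
    nlinarith [sq_nonneg (A + 1 - r * ξ)]
  nlinarith [mul_le_mul_of_nonneg_left h1 hr.le]

lemma integrableOn_exp_neg_Ioi_zero : IntegrableOn (fun ξ : ℝ => Real.exp (-ξ)) (Set.Ioi 0) := by
  simpa using integrableOn_exp_neg_Ioi 0

open Complex in
lemma integrableOn_cexp_neg_mul_exp {r : ℝ} (hr : 0 < r) (a : ℂ) :
    IntegrableOn (fun ξ : ℝ => cexp (-(r * cexp ξ)) * cexp (a * ξ)) (Set.Ioi 0) := by
  refine Integrable.mono' (integrableOn_exp_neg_Ioi_zero.const_mul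
    (Real.exp ((a.re + 1) ^ 2 / (2 * r)))) ?_ ?_
  · exact (by fun_prop : Continuous _).aestronglyMeasurable
  · refine (ae_restrict_mem measurableSet_Ioi).mono fun ξ hξ => ?_
    rw [norm_mul, Complex.norm_exp, Complex.norm_exp]
    convert exp_neg_mul_exp_le hr a.re (le_of_lt hξ) using 3
    · rw [← ofReal_exp, ← ofReal_mul, ← ofReal_neg, ofReal_re]
    · simp

open Complex in
lemma integral_cexp_neg_mul_exp_eq {r : ℝ} (a : ℂ) :
    ∫ ξ in Set.Ioi (0 : ℝ), cexp (-(r * cexp ξ)) * cexp (a * ξ) =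
      ∫ t in Set.Ioi (1 : ℝ), (t : ℂ) ^ (a - 1) * cexp (-(r * t)) := by
  have him : Real.exp '' Set.Ioi (0 : ℝ) = Set.Ioi 1 := by
    ext y
    constructor
    · rintro ⟨x, hx, rfl⟩
      exact Real.one_lt_exp_iff.mpr hx
    · intro hy
      have hy' : (1 : ℝ) < y := hy
      exact ⟨Real.log y, Real.log_pos hy', Real.exp_log (by linarith)⟩
  rw [← him, integral_image_eq_integral_abs_deriv_smul measurableSet_Ioi
    (fun x _ => (Real.hasDerivAt_exp x).hasDerivWithinAt) Real.exp_injective.injOn]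
  refine setIntegral_congr_fun measurableSet_Ioi fun ξ _ => ?_
  have h0 : (Real.exp ξ : ℂ) ≠ 0 := by
    exact_mod_cast (Real.exp_pos ξ).ne'
  simp only [abs_of_pos (Real.exp_pos ξ), real_smul]
  rw [Complex.cpow_def_of_ne_zero h0, ← ofReal_log (Real.exp_pos ξ).le, Real.log_exp, ofReal_exp]
  simp only [← Complex.exp_add]
  congr 1
  ring

-- This lower incomplete Gamma integral has the coefficients `1/(m + a)`, as has the circular part
-- of Hankel's contour: the integral of `e^{i(m+a)θ}` over the circle is `2(-1)^m sin(πa)/(m + a)`.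
open Complex in
lemma hasSum_integral_cpow_mul_exp (r : ℝ) {a : ℂ} (ha : 0 < a.re) :
    HasSum (fun m : ℕ => (-r : ℂ) ^ m / (m.factorial : ℂ) * (1 / (m + a)))
      (∫ t in (0 : ℝ)..1, (t : ℂ) ^ (a - 1) * cexp (-(r * t))) := by
  have key := intervalIntegral.hasSum_integral_of_dominated_convergence (μ := volume)
    (a := 0) (b := 1)
    (F := fun (m : ℕ) (t : ℝ) => (-r : ℂ) ^ m / (m.factorial : ℂ) * (t : ℂ) ^ (m + a - 1))
    (f := fun t : ℝ => (t : ℂ) ^ (a - 1) * cexp (-(r * t)))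
    (fun m t => |r| ^ m / (m.factorial : ℝ) * ‖(t : ℂ) ^ (a - 1)‖) ?_ ?_ ?_ ?_ ?_
  · refine key.congr_fun ?_
    intro m
    rw [intervalIntegral.integral_const_mul, integral_cpow]
    · have hne : (m + a : ℂ) ≠ 0 := by
        intro h
        have := congrArg re h
        simp at this
        have : (0 : ℝ) ≤ m := m.cast_nonneg
        linarith
      have : (m + a - 1 + 1 : ℂ) = m + a := by ring
      rw [this]
      simp [hne]
    · left
      simp
      have : (0 : ℝ) ≤ m := m.cast_nonneg
      linarith
  · intro m
    refine (Measurable.aestronglyMeasurable ?_)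
    fun_prop
  · intro m
    refine ae_of_all _ fun t ht => ?_
    rw [Set.uIoc_of_le zero_le_one] at ht
    have ht0 : (t : ℂ) ≠ 0 := by exact_mod_cast ht.1.ne'
    rw [show (m + a - 1 : ℂ) = m + (a - 1) by ring, cpow_add _ _ ht0, norm_mul, norm_mul,
      cpow_natCast, norm_pow]
    have : ‖(t : ℂ)‖ ^ m ≤ 1 := by
      apply pow_le_one₀ (norm_nonneg _)
      simp [abs_of_pos ht.1, ht.2]
    simp only [norm_div, norm_pow, norm_neg, norm_real, Real.norm_eq_abs, norm_natCast] at this ⊢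
    gcongr
    exact mul_le_of_le_one_left (norm_nonneg _) this
  · refine ae_of_all _ fun θ _ => ?_
    exact (hasSum_pow_div_factorial_exp |r|).summable.mul_right _
  · have : (fun t : ℝ => ∑' m : ℕ, |r| ^ m / (m.factorial : ℝ) * ‖(t : ℂ) ^ (a - 1)‖)
        = fun t : ℝ => Real.exp |r| * ‖(t : ℂ) ^ (a - 1)‖ := by
      ext t
      rw [tsum_mul_right, (hasSum_pow_div_factorial_exp |r|).tsum_eq]
    rw [this]
    refine IntervalIntegrable.const_mul (IntervalIntegrable.norm ?_) _
    exact intervalIntegral.intervalIntegrable_cpow' (by simp; linarith)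
  · refine ae_of_all _ fun t ht => ?_
    rw [Set.uIoc_of_le zero_le_one] at ht
    have ht0 : (t : ℂ) ≠ 0 := by exact_mod_cast ht.1.ne'
    have := (hasSum_pow_div_factorial_cexp (-(r * t))).mul_left ((t : ℂ) ^ (a - 1))
    refine this.congr_fun ?_
    intro m
    rw [show (m + a - 1 : ℂ) = m + (a - 1) by ring, cpow_add _ _ ht0, cpow_natCast,
      show (-(r * t) : ℂ) = (-r) * t by ring, mul_pow]
    ring

open Complex in
lemma integral_cexp_I_mul {c : ℂ} (hc : c ≠ 0) :
    ∫ θ in (-Real.pi)..Real.pi, cexp (I * c * θ) = 2 * sin (Real.pi * c) / c := by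
  rw [integral_exp_mul_complex (mul_ne_zero I_ne_zero hc), Complex.sin]
  push_cast
  rw [show I * c * (Real.pi : ℂ) = Real.pi * c * I by ring,
    show I * c * (-Real.pi : ℂ) = -(Real.pi * c) * I by ring]
  field_simp
  linear_combination (cexp (Real.pi * c * I) - cexp (-(Real.pi * c * I))) * I_sq

open Complex in
lemma inv_Gamma_one_sub {a : ℂ} (ha : 0 < a.re) :
    (Gamma (1 - a))⁻¹ = Gamma a * sin (Real.pi * a) / Real.pi := by
  have h := Complex.Gamma_mul_Gamma_one_sub a
  have hG : Gamma a ≠ 0 := Complex.Gamma_ne_zero_of_re_pos ha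
  have hpi : (Real.pi : ℂ) ≠ 0 := by exact_mod_cast Real.pi_ne_zero
  -- Where the sine vanishes, `1 - a` is a pole of Gamma; there Gamma takes the value 0 and its
  -- inverse is 0, as the entire function `1/Γ` requires.
  by_cases hs : sin (Real.pi * a) = 0
  · rw [hs, div_zero] at h
    have : Gamma (1 - a) = 0 := by simpa [hG] using h
    simp [this, hs]
  · have : Gamma (1 - a) = Real.pi / (Gamma a * sin (Real.pi * a)) := by
      field_simp
      field_simp at h
      linear_combination h
    rw [this, inv_div]

/-- Hankel's contour integral for `r ^ (-a) / Γ (1 - a)` over the keyhole contour of radius `r`,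
with its circular and its radial part written out. -/
def hankel (r : ℝ) (a : ℂ) : ℂ :=
  1 / (2 * Real.pi) * (∫ θ in (-Real.pi)..Real.pi,
      Complex.exp (r * Complex.exp (Complex.I * θ)) * Complex.exp (Complex.I * a * θ)) +
    Complex.sin (Real.pi * a) / Real.pi *
      ∫ ξ in Set.Ioi (0 : ℝ), Complex.exp (-(r * Complex.exp ξ)) * Complex.exp (a * ξ)

-- The circular part equals `2 sin(πa)` times the integral over `(0, 1)`, which completes the radial
-- part over `(1, ∞)` to `Γ(a)`. The reflection formula then gives `1/Γ(1 - a)`.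
open Complex in
lemma hankel_eq_of_re_pos {r : ℝ} (hr : 0 < r) {a : ℂ} (ha : 0 < a.re) :
    hankel r a = (r : ℂ) ^ (-a) * (Gamma (1 - a))⁻¹ := by
  have hpi : (Real.pi : ℂ) ≠ 0 := by exact_mod_cast Real.pi_ne_zero
  set S := ∫ t in (0 : ℝ)..1, (t : ℂ) ^ (a - 1) * cexp (-(r * t)) with hS
  have h1 : (∫ θ in (-Real.pi)..Real.pi, cexp (r * cexp (I * θ)) * cexp (I * a * θ)) =
      2 * sin (Real.pi * a) * S := by
    refine (hasSum_integral_exp_circle r a).unique ?_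
    refine ((hasSum_integral_cpow_mul_exp r ha).mul_left (2 * sin (Real.pi * a))).congr_fun ?_
    intro m
    have hne : (m + a : ℂ) ≠ 0 := by
      intro h
      have := congrArg re h
      simp at this
      have : (0 : ℝ) ≤ m := m.cast_nonneg
      linarith
    have hs : sin (Real.pi * (m + a)) = (-1) ^ m * sin (Real.pi * a) := by
      rw [show (Real.pi * (m + a) : ℂ) = Real.pi * a + m * Real.pi by ring,
        Complex.sin_antiperiodic.add_nat_mul_eq]
    rw [integral_cexp_I_mul hne, hs, neg_pow]
    ring
  -- A non-integrable function would have integral 0 by convention, whereas Euler's integral has a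
  -- non-zero value.
  have hint : IntegrableOn (fun t : ℝ => (t : ℂ) ^ (a - 1) * cexp (-(r * t))) (Set.Ioi 0) := by
    by_contra hcon
    have h := Complex.integral_cpow_mul_exp_neg_mul_Ioi ha hr
    rw [integral_undef hcon] at h
    have h1 : (1 / (r : ℂ)) ^ a ≠ 0 := by
      rw [Ne, Complex.cpow_eq_zero_iff]
      simp [hr.ne']
    exact mul_ne_zero h1 (Complex.Gamma_ne_zero_of_re_pos ha) h.symm
  have h2 : S + ∫ t in Set.Ioi (1 : ℝ), (t : ℂ) ^ (a - 1) * cexp (-(r * t)) =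
      (1 / (r : ℂ)) ^ a * Gamma a := by
    rw [← Complex.integral_cpow_mul_exp_neg_mul_Ioi ha hr, hS,
      intervalIntegral.integral_of_le zero_le_one, ← setIntegral_union _ measurableSet_Ioi,
      Set.Ioc_union_Ioi_eq_Ioi zero_le_one]
    · exact hint.mono_set Set.Ioc_subset_Ioi_self
    · exact hint.mono_set (Set.Ioi_subset_Ioi zero_le_one)
    · exact Set.Ioc_disjoint_Ioi le_rfl
  have h3 : (1 / (r : ℂ)) ^ a = (r : ℂ) ^ (-a) := by
    rw [one_div, Complex.inv_cpow _ _ (by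
      rw [Complex.arg_ofReal_of_nonneg hr.le]; exact Real.pi_pos.ne), Complex.cpow_neg]
  rw [hankel, h1, integral_cexp_neg_mul_exp_eq, eq_sub_of_add_eq' h2, h3, inv_Gamma_one_sub ha]
  field_simp
  ring

-- Integration by parts on both pieces of the contour. The boundary terms at `θ = ±π` and at `ξ = 0`
-- are multiples of `e^{-r} sin(πa)` and cancel, because `sin(πa)` changes sign under `a ↦ a + 1`.
open Complex in
lemma hankel_add_one {r : ℝ} (hr : 0 < r) (a : ℂ) :
    r * hankel r (a + 1) = -a * hankel r a := by
  have hpi : (Real.pi : ℂ) ≠ 0 := by exact_mod_cast Real.pi_ne_zero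
  set A : ℂ → ℂ := fun a => ∫ θ in (-Real.pi)..Real.pi, cexp (r * cexp (I * θ)) * cexp (I * a * θ)
    with hA
  set B : ℂ → ℂ := fun a => ∫ ξ in Set.Ioi (0 : ℝ), cexp (-(r * cexp ξ)) * cexp (a * ξ) with hB
  have hAr : r * A (a + 1) + a * A a = 2 * cexp (-r) * sin (Real.pi * a) := by
    have hd : ∀ θ ∈ Set.uIcc (-Real.pi) Real.pi, HasDerivAt
        (fun θ : ℝ => cexp (r * cexp (I * θ)) * cexp (I * a * θ))
        (I * (r * (cexp (r * cexp (I * θ)) * cexp (I * (a + 1) * θ))) +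
          I * (a * (cexp (r * cexp (I * θ)) * cexp (I * a * θ)))) θ := by
      intro θ _
      have e0 : HasDerivAt (fun θ : ℝ => (θ : ℂ)) 1 θ := ofRealCLM.hasDerivAt
      have e1 := (((e0.const_mul I).cexp.const_mul (r : ℂ)).cexp).mul
        ((e0.const_mul (I * a)).cexp)
      refine e1.congr_deriv ?_
      rw [show I * (a + 1) * (θ : ℂ) = I * θ + I * a * θ by ring, Complex.exp_add]
      ring
    have h := intervalIntegral.integral_eq_sub_of_hasDerivAt hd
      ((by fun_prop : Continuous _).intervalIntegrable _ _)
    rw [intervalIntegral.integral_add ((by fun_prop : Continuous _).intervalIntegrable _ _)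
      ((by fun_prop : Continuous _).intervalIntegrable _ _)] at h
    simp only [intervalIntegral.integral_const_mul] at h
    have e1 : cexp (I * Real.pi) = -1 := by rw [mul_comm]; exact Complex.exp_pi_mul_I
    have e2 : cexp (I * ((-Real.pi : ℝ) : ℂ)) = -1 := by
      rw [ofReal_neg, mul_neg, Complex.exp_neg, e1]; norm_num
    rw [e1, e2] at h
    have hs : 2 * I * sin (Real.pi * a) = cexp (I * a * Real.pi) - cexp (I * a * ((-Real.pi : ℝ) : ℂ)) := by
      rw [Complex.sin]
      push_cast
      rw [show I * a * (Real.pi : ℂ) = Real.pi * a * I by ring,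
        show I * a * (-Real.pi : ℂ) = -(Real.pi * a) * I by ring]
      linear_combination (cexp (-(Real.pi * a) * I) - cexp (Real.pi * a * I)) * I_sq
    have h' : I * (r * A (a + 1) + a * A a) = I * (2 * cexp (-r) * sin (Real.pi * a)) := by
      simp only [hA]
      rw [show (r : ℂ) * -1 = -r by ring] at h
      linear_combination h - cexp (-r) * hs
    exact mul_left_cancel₀ I_ne_zero h'
  have hBr : r * B (a + 1) - a * B a = cexp (-r) := by
    have hd : ∀ ξ ∈ Set.Ioi (0 : ℝ), HasDerivAt
        (fun ξ : ℝ => cexp (-(r * cexp ξ)) * cexp (a * ξ))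
        (a * (cexp (-(r * cexp ξ)) * cexp (a * ξ)) -
          r * (cexp (-(r * cexp ξ)) * cexp ((a + 1) * ξ))) ξ := by
      intro ξ _
      have e0 : HasDerivAt (fun θ : ℝ => (θ : ℂ)) 1 ξ := ofRealCLM.hasDerivAt
      have e1 := ((e0.cexp.const_mul (r : ℂ)).neg.cexp).mul ((e0.const_mul a).cexp)
      refine e1.congr_deriv ?_
      rw [show (a + 1) * (ξ : ℂ) = ξ + a * ξ by ring, Complex.exp_add]
      simp only [Pi.neg_apply]
      ring
    have i1 := (integrableOn_cexp_neg_mul_exp hr a).const_mul a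
    have i2 := (integrableOn_cexp_neg_mul_exp hr (a + 1)).const_mul (r : ℂ)
    have hlim : Tendsto (fun ξ : ℝ => cexp (-(r * cexp ξ)) * cexp (a * ξ)) atTop (𝓝 0) := by
      have hb : Tendsto (fun ξ : ℝ => Real.exp ((a.re + 1) ^ 2 / (2 * r)) * Real.exp (-ξ))
          atTop (𝓝 0) := by
        simpa using (Real.tendsto_exp_neg_atTop_nhds_zero.const_mul _)
      refine squeeze_zero_norm' ?_ hb
      filter_upwards [eventually_ge_atTop 0] with ξ hξ
      rw [norm_mul, Complex.norm_exp, Complex.norm_exp]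
      convert exp_neg_mul_exp_le hr a.re hξ using 3
      · rw [← ofReal_exp, ← ofReal_mul, ← ofReal_neg, ofReal_re]
      · simp
    have h := integral_Ioi_of_hasDerivAt_of_tendsto
      (by fun_prop : Continuous (fun ξ : ℝ => cexp (-(r * cexp ξ)) * cexp (a * ξ))).continuousWithinAt
      hd (i1.sub i2) hlim
    rw [integral_sub i1 i2, integral_const_mul, integral_const_mul] at h
    simp at h
    simp only [hB]
    linear_combination -h
  have hs : sin (Real.pi * (a + 1)) = - sin (Real.pi * a) := by
    rw [mul_add, mul_one, Complex.sin_add_pi]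
  simp only [hankel, hs]
  change r * (1 / (2 * Real.pi) * A (a + 1) + -sin (Real.pi * a) / Real.pi * B (a + 1)) =
    -a * (1 / (2 * Real.pi) * A a + sin (Real.pi * a) / Real.pi * B a)
  field_simp
  linear_combination hAr - 2 * sin (Real.pi * a) * hBr

-- At `a = 0` the recursion carries the factor 0 and gives no information, so this value is computed
-- directly.
open Complex in
lemma hankel_zero (r : ℝ) : hankel r 0 = 1 := by
  have hpi : (Real.pi : ℂ) ≠ 0 := by exact_mod_cast Real.pi_ne_zero
  have h : (∫ θ in (-Real.pi)..Real.pi, cexp (r * cexp (I * θ)) * cexp (I * 0 * θ)) =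
      2 * Real.pi := by
    refine (hasSum_integral_exp_circle r 0).unique ?_
    convert hasSum_single (0 : ℕ) ?_ using 1
    · simp; ring
    · intro m hm
      have hm' : (m : ℂ) + 0 ≠ 0 := by simpa using hm
      rw [integral_cexp_I_mul hm', add_zero, mul_comm (Real.pi : ℂ), Complex.sin_nat_mul_pi]
      simp
  rw [hankel, h]
  simp
  field_simp

open Complex in
theorem hankel_eq {r : ℝ} (hr : 0 < r) (a : ℂ) :
    hankel r a = (r : ℂ) ^ (-a) * (Gamma (1 - a))⁻¹ := by
  have hr0 : (r : ℂ) ≠ 0 := by exact_mod_cast hr.ne'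
  -- In place of analytic continuation, the recursion extends the identity from `Re a > 0`
  -- leftwards, one unit strip at a time.
  suffices H : ∀ (N : ℕ) (a : ℂ), 0 < a.re + N →
      hankel r a = (r : ℂ) ^ (-a) * (Gamma (1 - a))⁻¹ by
    obtain ⟨N, hN⟩ := exists_nat_gt (-a.re)
    exact H N a (by linarith)
  intro N
  induction N with
  | zero => intro a ha; exact hankel_eq_of_re_pos hr (by simpa using ha)
  | succ N ih =>
    intro a ha
    by_cases h0 : a = 0
    · subst h0
      simp [hankel_zero]
    have h1 := ih (a + 1) (by push_cast at ha; simp; linarith)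
    have h2 := hankel_add_one hr a
    have h3 := Complex.one_div_Gamma_eq_self_mul_one_div_Gamma_add_one (-a)
    rw [show 1 - (a + 1) = -a by ring, h3, show -(a + 1) = -a - 1 by ring,
      Complex.cpow_sub _ _ hr0, cpow_one, show -a + 1 = 1 - a by ring] at h1
    rw [h1] at h2
    have h4 : -a * hankel r a = -a * ((r : ℂ) ^ (-a) * (Gamma (1 - a))⁻¹) := by
      rw [← h2]
      field_simp
    exact mul_left_cancel₀ (neg_ne_zero.mpr h0) h4

/-! ### Schläfli's integral from the power series -/

-- Summing over `n` rebuilds `exp(-r e^{-iθ})`, and `r(e^{iθ} - e^{-iθ}) = 2ir sin θ`; here `x =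
-- 2r`.
open Complex in
lemma hasSum_circle_part (r : ℝ) (ν : ℂ) :
    HasSum (fun n : ℕ => (-r : ℂ) ^ n / (n.factorial : ℂ) *
        ∫ θ in (-Real.pi)..Real.pi, cexp (r * cexp (I * θ)) * cexp (I * (-(n + ν)) * θ))
      (∫ θ in (-Real.pi)..Real.pi, cexp (I * ((2 * r : ℝ) * sin θ - ν * θ))) := by
  have key := intervalIntegral.hasSum_integral_of_dominated_convergence (μ := volume)
    (a := -Real.pi) (b := Real.pi)
    (F := fun (n : ℕ) (θ : ℝ) => (-r : ℂ) ^ n / (n.factorial : ℂ) *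
      (cexp (r * cexp (I * θ)) * cexp (I * (-(n + ν)) * θ)))
    (f := fun θ : ℝ => cexp (I * ((2 * r : ℝ) * sin θ - ν * θ)))
    (fun n θ => |r| ^ n / (n.factorial : ℝ) * ‖cexp (r * cexp (I * θ)) * cexp (-I * ν * θ)‖)
    ?_ ?_ ?_ ?_ ?_
  · simpa only [intervalIntegral.integral_const_mul] using key
  · intro m
    exact (by fun_prop : Continuous _).aestronglyMeasurable
  · intro m
    refine ae_of_all _ fun θ _ => le_of_eq ?_
    have : cexp (I * (-(m + ν)) * θ) = cexp ((-(m : ℝ) * θ : ℝ) * I) * cexp (-I * ν * θ) := by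
      rw [← Complex.exp_add]; congr 1; push_cast; ring
    rw [this, norm_mul, norm_mul, norm_mul, norm_mul, Complex.norm_exp_ofReal_mul_I]
    simp
  · refine ae_of_all _ fun θ _ => ?_
    exact (hasSum_pow_div_factorial_exp |r|).summable.mul_right _
  · simp only [tsum_mul_right, (hasSum_pow_div_factorial_exp |r|).tsum_eq]
    exact (by fun_prop : Continuous _).intervalIntegrable _ _
  · refine ae_of_all _ fun θ _ => ?_
    have := (hasSum_pow_div_factorial_cexp (-r * cexp (-(I * θ)))).mul_left
      (cexp (r * cexp (I * θ)) * cexp (-I * ν * θ))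
    have hlim : cexp (I * ((2 * r : ℝ) * sin θ - ν * θ)) =
        cexp (r * cexp (I * θ)) * cexp (-I * ν * θ) * cexp (-r * cexp (-(I * θ))) := by
      rw [← Complex.exp_add, ← Complex.exp_add]
      congr 1
      rw [Complex.sin, show (-(θ : ℂ)) * I = -(I * θ) by ring, mul_comm (θ : ℂ) I]
      push_cast
      linear_combination -r * (cexp (I * θ) - cexp (-(I * θ))) * I_sq
    rw [hlim]
    refine this.congr_fun fun n => ?_
    rw [mul_pow, ← Complex.exp_nat_mul,
        show I * (-(n + ν)) * θ = n * (-(I * θ)) + -I * ν * θ by ring, Complex.exp_add]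
    ring

-- The radial analogue: the sum is `exp(r e^{-ξ})`, and `r(e^ξ - e^{-ξ}) = 2r sinh ξ`. Domination
-- uses `e^{-nξ} ≤ 1`.
open Complex in
lemma hasSum_radial_part {r : ℝ} (hr : 0 < r) (ν : ℂ) :
    HasSum (fun n : ℕ => (r : ℂ) ^ n / (n.factorial : ℂ) *
        ∫ ξ in Set.Ioi (0 : ℝ), cexp (-(r * cexp ξ)) * cexp (-(n + ν) * ξ))
      (∫ ξ in Set.Ioi (0 : ℝ), cexp (-((2 * r : ℝ) * sinh ξ)) * cexp (-ν * ξ)) := by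
  have key := MeasureTheory.hasSum_integral_of_dominated_convergence
    (μ := volume.restrict (Set.Ioi (0 : ℝ)))
    (F := fun (n : ℕ) (ξ : ℝ) => (r : ℂ) ^ n / (n.factorial : ℂ) *
      (cexp (-(r * cexp ξ)) * cexp (-(n + ν) * ξ)))
    (f := fun ξ : ℝ => cexp (-((2 * r : ℝ) * sinh ξ)) * cexp (-ν * ξ))
    (fun n ξ => |r| ^ n / (n.factorial : ℝ) * ‖cexp (-(r * cexp ξ)) * cexp (-ν * ξ)‖)
    ?_ ?_ ?_ ?_ ?_
  · simpa only [integral_const_mul] using key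
  · intro m
    exact (by fun_prop : Continuous _).aestronglyMeasurable
  · intro m
    refine (ae_restrict_mem measurableSet_Ioi).mono fun ξ hξ => ?_
    have hξ' : (0 : ℝ) < ξ := hξ
    have : cexp (-(m + ν) * ξ) = cexp (-(m * ξ : ℝ)) * cexp (-ν * ξ) := by
      rw [← Complex.exp_add]; congr 1; push_cast; ring
    have h1 : ‖cexp (-(m * ξ : ℝ))‖ ≤ 1 := by
      rw [Complex.norm_exp]
      apply Real.exp_le_one_iff.mpr
      rw [← ofReal_neg, ofReal_re]
      have : 0 ≤ (m : ℝ) * ξ := by positivity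
      linarith
    rw [this, norm_mul, norm_mul, norm_mul, norm_mul]
    simp only [norm_div, norm_pow, norm_real, Real.norm_eq_abs, norm_natCast]
    gcongr
    exact mul_le_of_le_one_left (norm_nonneg _) h1
  · refine ae_of_all _ fun θ => ?_
    exact (hasSum_pow_div_factorial_exp |r|).summable.mul_right _
  · simp only [tsum_mul_right, (hasSum_pow_div_factorial_exp |r|).tsum_eq]
    exact ((integrableOn_cexp_neg_mul_exp hr (-ν)).norm).const_mul _
  · refine ae_of_all _ fun ξ => ?_
    have := (hasSum_pow_div_factorial_cexp (r * cexp (-ξ))).mul_left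
      (cexp (-(r * cexp ξ)) * cexp (-ν * ξ))
    have hlim : cexp (-((2 * r : ℝ) * sinh ξ)) * cexp (-ν * ξ) =
        cexp (-(r * cexp ξ)) * cexp (-ν * ξ) * cexp (r * cexp (-ξ)) := by
      rw [← Complex.exp_add, ← Complex.exp_add, ← Complex.exp_add]
      congr 1
      rw [Complex.sinh]
      push_cast
      ring
    rw [hlim]
    refine this.congr_fun fun n => ?_
    rw [mul_pow, ← Complex.exp_nat_mul,
        show -(n + ν) * (ξ : ℂ) = n * (-ξ) + -ν * ξ by ring, Complex.exp_add]
    ring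

open Complex in
/-- Schläfli's integral representation of the Bessel function. -/
theorem besselJ_eq {x : ℝ} (hx : 0 < x) (ν : ℂ) :
    besselJ ν x = 1 / (2 * Real.pi) *
        (∫ θ in (-Real.pi)..Real.pi, cexp (I * (x * sin θ - ν * θ))) -
      sin (Real.pi * ν) / Real.pi *
        ∫ ξ in Set.Ioi (0 : ℝ), cexp (-(x * sinh ξ)) * cexp (-ν * ξ) := by
  obtain ⟨r, rfl⟩ : ∃ r, x = 2 * r := ⟨x / 2, by ring⟩
  have hr : 0 < r := by linarith
  have hr0 : (r : ℂ) ≠ 0 := by exact_mod_cast hr.ne'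
  rw [besselJ]
  refine HasSum.tsum_eq ?_
  have h1 := (hasSum_circle_part r ν).mul_left (1 / (2 * Real.pi : ℂ))
  have h2 := (hasSum_radial_part hr ν).mul_left (sin (Real.pi * ν) / Real.pi)
  refine (h1.sub h2).congr_fun ?_
  intro n
  have hs : sin (Real.pi * (-(n + ν))) = -((-1) ^ n * sin (Real.pi * ν)) := by
    rw [show (Real.pi * (-(n + ν)) : ℂ) = -(Real.pi * ν + n * Real.pi) by ring,
      Complex.sin_neg, Complex.sin_antiperiodic.add_nat_mul_eq]
  have h3 := hankel_eq hr (-(n + ν))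
  rw [hankel, hs, neg_neg, show (1 - -((n : ℂ) + ν)) = n + 1 + ν by ring] at h3
  have h4 : (((2 * r : ℝ) : ℂ) / 2) ^ (ν + 2 * n) = (r : ℂ) ^ n * (r : ℂ) ^ (n + ν) := by
    rw [show (((2 * r : ℝ) : ℂ) / 2) = r by push_cast; ring,
      show ν + 2 * n = (n : ℂ) + (n + ν) by ring, Complex.cpow_add _ _ hr0, cpow_natCast]
  rw [h4, Complex.Gamma_nat_eq_factorial]
  have h5 : (-1 : ℂ) ^ n / (n.factorial * Gamma (n + 1 + ν)) * (r ^ n * (r : ℂ) ^ (n + ν)) =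
      (-r) ^ n / n.factorial * ((r : ℂ) ^ (n + ν) * (Gamma (n + 1 + ν))⁻¹) := by
    rw [neg_pow (r : ℂ) n, div_eq_mul_inv, mul_inv]
    ring
  rw [h5, ← h3, neg_pow (r : ℂ) n]
  have h6 : (-1 : ℂ) ^ n * (-1) ^ n = 1 := by rw [← mul_pow]; simp
  linear_combination -(r : ℂ) ^ n / n.factorial * (sin (Real.pi * ν) / Real.pi) *
    (∫ ξ in Set.Ioi (0 : ℝ), cexp (-(r * cexp ξ)) * cexp (-(n + ν) * ξ)) * h6

/-! ### The kernel `k⁺` and its removable singularities -/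

lemma exp_neg_mul_sinh_le {x : ℝ} (hx : 0 < x) (A : ℝ) {ξ : ℝ} (hξ : 0 ≤ ξ) :
    Real.exp (-(x * Real.sinh ξ)) * Real.exp (A * ξ) ≤
      Real.exp (x / 2) * Real.exp ((A + 1) ^ 2 / x) * Real.exp (-ξ) := by
  have h := exp_neg_mul_exp_le (half_pos hx) A hξ
  have h1 : Real.exp (-(x * Real.sinh ξ)) ≤
      Real.exp (x / 2) * Real.exp (-(x / 2 * Real.exp ξ)) := by
    rw [← Real.exp_add]
    apply Real.exp_le_exp.mpr
    rw [Real.sinh_eq]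
    have : Real.exp (-ξ) ≤ 1 := Real.exp_le_one_iff.mpr (by linarith)
    nlinarith
  calc _ ≤ (Real.exp (x / 2) * Real.exp (-(x / 2 * Real.exp ξ))) * Real.exp (A * ξ) := by gcongr
    _ = Real.exp (x / 2) * (Real.exp (-(x / 2 * Real.exp ξ)) * Real.exp (A * ξ)) := by ring
    _ ≤ Real.exp (x / 2) * (Real.exp ((A + 1) ^ 2 / (2 * (x / 2))) * Real.exp (-ξ)) := by gcongr
    _ = _ := by rw [show 2 * (x / 2) = x by ring]; ring

lemma integrableOn_exp_neg_mul_sinh {x : ℝ} (hx : 0 < x) (A : ℝ) :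
    IntegrableOn (fun ξ : ℝ => Real.exp (-(x * Real.sinh ξ)) * Real.exp (A * ξ)) (Set.Ioi 0) := by
  refine Integrable.mono' (integrableOn_exp_neg_Ioi_zero.const_mul
    (Real.exp (x / 2) * Real.exp ((A + 1) ^ 2 / x))) ?_ ?_
  · exact (by fun_prop : Continuous _).aestronglyMeasurable
  · refine (ae_restrict_mem measurableSet_Ioi).mono fun ξ hξ => ?_
    rw [Real.norm_of_nonneg (by positivity)]
    exact exp_neg_mul_sinh_le hx A (le_of_lt hξ)

lemma integral_sub_add_eq {f : ℝ → ℂ} (hf : Continuous f) (c h : ℝ) :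
    ∫ θ in (c - h)..(c + h), f θ = ∫ φ in (0 : ℝ)..h, (f (c - φ) + f (c + φ)) := by
  rw [intervalIntegral.integral_add
    ((by fun_prop : Continuous fun φ => f (c - φ)).intervalIntegrable _ _)
    ((by fun_prop : Continuous fun φ => f (c + φ)).intervalIntegrable _ _),
    intervalIntegral.integral_comp_sub_left, intervalIntegral.integral_comp_add_left]
  simp only [sub_zero, add_zero]
  rw [intervalIntegral.integral_add_adjacent_intervals (hf.intervalIntegrable _ _)
    (hf.intervalIntegrable _ _)]

/-- The kernel `k⁺` in the order `w = 2 v - 1`, without removable singularities. -/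
def kernel (x : ℝ) (w : ℂ) : ℂ :=
  2 / Real.pi * (Complex.cos (Real.pi * w / 2) *
      (∫ ξ in Set.Ioi (0 : ℝ), Complex.exp (-(x * Complex.sinh ξ)) * Complex.cosh (w * ξ)) -
    ∫ φ in (0 : ℝ)..(Real.pi / 2), Complex.cos (w * φ) * Complex.sin (x * Complex.cos φ))

lemma norm_cosh_le (z : ℂ) : ‖Complex.cosh z‖ ≤ Real.exp ‖z‖ := by
  rw [Complex.cosh, norm_div]
  have h1 := Complex.norm_exp_le_exp_norm z
  have h2 := Complex.norm_exp_le_exp_norm (-z)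
  rw [norm_neg] at h2
  have h3 := norm_add_le (Complex.exp z) (Complex.exp (-z))
  simp only [Complex.norm_ofNat]
  linarith

open Complex in
lemma norm_cexp_neg_mul_sinh (x ξ : ℝ) :
    ‖cexp (-(x * sinh ξ))‖ = Real.exp (-(x * Real.sinh ξ)) := by
  rw [Complex.norm_exp]
  congr 1
  rw [← ofReal_sinh, ← ofReal_mul, ← ofReal_neg, ofReal_re]

open Complex in
lemma continuous_kernel {x : ℝ} (hx : 0 < x) : Continuous (kernel x) := by
  have h1 : Continuous fun w : ℂ =>
      ∫ ξ in Set.Ioi (0 : ℝ), cexp (-(x * sinh ξ)) * cosh (w * ξ) := by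
    rw [continuous_iff_continuousAt]
    intro w₀
    refine continuousAt_of_dominated (bound := fun ξ : ℝ =>
      Real.exp (-(x * Real.sinh ξ)) * Real.exp ((‖w₀‖ + 1) * ξ)) ?_ ?_ ?_ ?_
    · exact Eventually.of_forall fun w => (by fun_prop : Continuous _).aestronglyMeasurable
    · filter_upwards [Metric.ball_mem_nhds w₀ one_pos] with w hw
      refine (ae_restrict_mem measurableSet_Ioi).mono fun ξ hξ => ?_
      have hξ' : (0 : ℝ) < ξ := hξ
      rw [norm_mul, norm_cexp_neg_mul_sinh]
      gcongr
      refine (norm_cosh_le _).trans (Real.exp_le_exp.mpr ?_)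
      rw [norm_mul, norm_real, Real.norm_of_nonneg hξ'.le]
      gcongr
      rw [mem_ball_iff_norm] at hw
      have := norm_le_norm_add_norm_sub w₀ w
      rw [norm_sub_rev] at this
      linarith
    · exact integrableOn_exp_neg_mul_sinh hx _
    · exact ae_of_all _ fun ξ => (by fun_prop : Continuous _).continuousAt
  have h2 : Continuous fun w : ℂ =>
      ∫ φ in (0 : ℝ)..(Real.pi / 2), cos (w * φ) * sin (x * cos φ) := by
    refine intervalIntegral.continuous_parametric_intervalIntegral_of_continuous' ?_ _ _
    fun_prop
  unfold kernel
  fun_prop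

-- Both parts of Schläfli's formula contain `sin(πw/2)`: the circular part after folding the circle
-- about 0 and then about `π/2`, the radial part through `sin(πw) = 2 sin(πw/2) cos(πw/2)`. With `w
-- = 2v - 1` this factor is `-cos(πv)`, so the quotient has no singularity left.
open Complex in
lemma besselJ_sub_besselJ_neg {x : ℝ} (hx : 0 < x) (w : ℂ) :
    besselJ w x - besselJ (-w) x = -2 * sin (Real.pi * w / 2) * kernel x w := by
  have hpi : (Real.pi : ℂ) ≠ 0 := by exact_mod_cast Real.pi_ne_zero
  have hcirc : (∫ θ in (-Real.pi)..Real.pi, cexp (I * (x * sin θ - w * θ))) -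
      (∫ θ in (-Real.pi)..Real.pi, cexp (I * (x * sin θ - -w * θ))) =
      8 * sin (Real.pi * w / 2) *
        ∫ φ in (0 : ℝ)..(Real.pi / 2), cos (w * φ) * sin (x * cos φ) := by
    have hc : Continuous fun θ : ℝ => sin (w * θ) * sin (x * sin θ) := by fun_prop
    rw [← intervalIntegral.integral_sub ((by fun_prop : Continuous _).intervalIntegrable _ _)
      ((by fun_prop : Continuous _).intervalIntegrable _ _)]
    have h1 := integral_sub_add_eq (f := fun θ : ℝ => cexp (I * (x * sin θ - w * θ)) -
      cexp (I * (x * sin θ - -w * θ))) (by fun_prop) 0 Real.pi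
    have h2 := integral_sub_add_eq (f := fun θ : ℝ => sin (w * θ) * sin (x * sin θ)) hc
      (Real.pi / 2) (Real.pi / 2)
    rw [sub_self, add_halves] at h2
    rw [zero_sub, zero_add] at h1
    rw [h1]
    have h3 : ∀ φ : ℝ, (cexp (I * (x * sin (0 - φ : ℝ) - w * (0 - φ : ℝ))) -
        cexp (I * (x * sin (0 - φ : ℝ) - -w * (0 - φ : ℝ)))) +
        (cexp (I * (x * sin (0 + φ : ℝ) - w * (0 + φ : ℝ))) -
        cexp (I * (x * sin (0 + φ : ℝ) - -w * (0 + φ : ℝ)))) = 4 * (sin (w * φ) * sin (x * sin φ)) := by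
      intro φ
      simp only [zero_sub, zero_add, ofReal_neg, Complex.sin_neg]
      have es : ∀ z : ℂ, sin z = (cexp (-z * I) - cexp (z * I)) * I / 2 := fun _ => rfl
      rw [es (w * φ), es (x * sin φ)]
      rw [show I * (x * -sin φ - w * -φ) = w * φ * I + -(x * sin φ) * I by ring,
        show I * (x * -sin φ - -w * -φ) = -(w * φ) * I + -(x * sin φ) * I by ring,
        show I * (x * sin φ - w * φ) = -(w * φ) * I + (x * sin φ) * I by ring,
        show I * (x * sin φ - -w * φ) = w * φ * I + (x * sin φ) * I by ring]
      simp only [Complex.exp_add]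
      linear_combination -(cexp (-(w * φ) * I) - cexp (w * φ * I)) *
        (cexp (-(x * sin φ) * I) - cexp ((x * sin φ) * I)) * I_sq
    simp only [h3]
    rw [intervalIntegral.integral_const_mul, h2]
    have h4 : ∀ φ : ℝ, sin (w * (Real.pi / 2 - φ : ℝ)) * sin (x * sin (Real.pi / 2 - φ : ℝ)) +
        sin (w * (Real.pi / 2 + φ : ℝ)) * sin (x * sin (Real.pi / 2 + φ : ℝ)) =
        2 * sin (Real.pi * w / 2) * (cos (w * φ) * sin (x * cos φ)) := by
      intro φ
      push_cast
      rw [Complex.sin_pi_div_two_sub, add_comm (Real.pi / 2 : ℂ) φ, Complex.sin_add_pi_div_two,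
        mul_sub, mul_add, Complex.sin_sub, Complex.sin_add,
        show w * (Real.pi / 2 : ℂ) = Real.pi * w / 2 by ring]
      ring
    simp only [h4]
    rw [intervalIntegral.integral_const_mul]
    ring
  have hint : ∀ a : ℂ,
      IntegrableOn (fun ξ : ℝ => cexp (-(x * sinh ξ)) * cexp (a * ξ)) (Set.Ioi 0) := by
    intro a
    refine (integrableOn_exp_neg_mul_sinh hx a.re).mono'
      (by fun_prop : Continuous _).aestronglyMeasurable ?_
    refine ae_of_all _ fun ξ => ?_
    rw [norm_mul, norm_cexp_neg_mul_sinh, Complex.norm_exp]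
    simp
  have htail : (∫ ξ in Set.Ioi (0 : ℝ), cexp (-(x * sinh ξ)) * cexp (-w * ξ)) +
      (∫ ξ in Set.Ioi (0 : ℝ), cexp (-(x * sinh ξ)) * cexp (- -w * ξ)) =
      2 * ∫ ξ in Set.Ioi (0 : ℝ), cexp (-(x * sinh ξ)) * cosh (w * ξ) := by
    rw [← integral_add (hint _) (hint _), ← integral_const_mul]
    congr 1
    ext ξ
    rw [Complex.cosh, neg_neg, neg_mul]
    ring
  have hs : sin (Real.pi * w) = 2 * sin (Real.pi * w / 2) * cos (Real.pi * w / 2) := by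
    rw [← Complex.sin_two_mul]; congr 1; ring
  rw [besselJ_eq hx, besselJ_eq hx, kernel, mul_neg, Complex.sin_neg, hs]
  linear_combination 1 / (2 * Real.pi) * hcirc -
    2 * sin (Real.pi * w / 2) * cos (Real.pi * w / 2) / Real.pi * htail

open Complex in
theorem kPlus_eq_kernel {x : ℝ} (hx : 0 < x) (v : ℂ) : kPlus x v = kernel x (2 * v - 1) := by
  have hcos : ∀ v : ℂ, cos (Real.pi * v) = - sin (Real.pi * (2 * v - 1) / 2) := by
    intro v
    rw [show (Real.pi * (2 * v - 1) / 2 : ℂ) = Real.pi * v - Real.pi / 2 by ring,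
      Complex.sin_sub_pi_div_two, neg_neg]
  have hq : ∀ v : ℂ, cos (Real.pi * v) ≠ 0 → kPlusQuot x v = kernel x (2 * v - 1) := by
    intro v hv
    rw [kPlusQuot, show 1 - 2 * v = -(2 * v - 1) by ring, besselJ_sub_besselJ_neg hx]
    rw [hcos] at hv ⊢
    have hv' := neg_ne_zero.mp hv
    generalize sin (Real.pi * (2 * v - 1) / 2) = S at *
    field_simp
  rw [kPlus]
  split_ifs with h
  · have hsin : sin (Real.pi * v) ≠ 0 := by
      intro h0
      have := Complex.sin_sq_add_cos_sq (Real.pi * v)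
      rw [h0, h] at this
      norm_num at this
    have hd : HasDerivAt (fun v : ℂ => cos (Real.pi * v)) (-sin (Real.pi * v) * (Real.pi * 1)) v :=
      ((hasDerivAt_id v).const_mul (Real.pi : ℂ)).ccos
    -- The derivative of `cos(πv)` does not vanish at a zero, so zeros are isolated and the quotient
    -- equals the kernel on a punctured neighbourhood; continuity of the kernel gives the limit.
    have hne := hd.eventually_ne (c := 0) (by simp [hsin, Real.pi_ne_zero])
    refine Tendsto.limUnder_eq ?_
    have hk : Tendsto (fun v => kernel x (2 * v - 1)) (𝓝[≠] v) (𝓝 (kernel x (2 * v - 1))) :=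
      (((continuous_kernel hx).comp (by fun_prop : Continuous fun v : ℂ => 2 * v - 1)).tendsto v).mono_left
        nhdsWithin_le_nhds
    refine hk.congr' ?_
    filter_upwards [hne] with v' hv'
    exact (hq v' hv').symm
  · exact hq v h

/-! ### The truncated Mehler–Sonine integral -/

/-- The real value of `k⁺(x, 1/2 + it)`. -/
def kernelReal (t x : ℝ) : ℝ :=
  2 / Real.pi * (Real.cosh (Real.pi * t) *
      (∫ ξ in Set.Ioi (0 : ℝ), Real.exp (-(x * Real.sinh ξ)) * Real.cos (2 * t * ξ)) -
    ∫ φ in (0 : ℝ)..(Real.pi / 2), Real.cosh (2 * t * φ) * Real.sin (x * Real.cos φ))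

/-- The truncation at height `T` of the Mehler–Sonine integral for `k⁺(x, 1/2 + it)`. -/
def kernelTrunc (t T x : ℝ) : ℝ :=
  2 / Real.pi * ∫ ξ in (0 : ℝ)..T, Real.cos (x * Real.cosh ξ) * Real.cos (2 * t * ξ)

open Complex in
lemma kPlus_eq_kernelReal {x : ℝ} (hx : 0 < x) (t : ℝ) :
    kPlus x (1 / 2 + t * I) = (kernelReal t x : ℂ) := by
  rw [kPlus_eq_kernel hx, show 2 * (1 / 2 + t * I) - 1 = 2 * t * I by ring, kernel, kernelReal]
  push_cast
  rw [← integral_complex_ofReal, ← intervalIntegral.integral_ofReal]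
  have h1 : ∀ ξ : ℝ, cexp (-(x * sinh ξ)) * cosh (2 * t * I * ξ) =
      ((Real.exp (-(x * Real.sinh ξ)) * Real.cos (2 * t * ξ) : ℝ) : ℂ) := by
    intro ξ
    push_cast
    rw [show 2 * t * I * (ξ : ℂ) = 2 * t * ξ * I by ring, Complex.cosh_mul_I]
  have h2 : ∀ φ : ℝ, cos (2 * t * I * φ) * sin (x * cos φ) =
      ((Real.cosh (2 * t * φ) * Real.sin (x * Real.cos φ) : ℝ) : ℂ) := by
    intro φ
    push_cast
    rw [show 2 * t * I * (φ : ℂ) = 2 * t * φ * I by ring, Complex.cos_mul_I]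
  simp only [h1, h2]
  rw [show (Real.pi * (2 * t * I) / 2 : ℂ) = Real.pi * t * I by ring, Complex.cos_mul_I]

lemma norm_cosh_le_exp_abs_re (z : ℂ) : ‖Complex.cosh z‖ ≤ Real.exp |z.re| := by
  rw [Complex.cosh, norm_div]
  have h3 := norm_add_le (Complex.exp z) (Complex.exp (-z))
  rw [Complex.norm_exp, Complex.norm_exp] at h3
  have h1 : Real.exp z.re ≤ Real.exp |z.re| := Real.exp_le_exp.mpr (le_abs_self _)
  have h2 : Real.exp (-z).re ≤ Real.exp |z.re| := Real.exp_le_exp.mpr (neg_le_abs _)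
  simp only [Complex.norm_ofNat]
  linarith

lemma integral_exp_neg_mul_le {c : ℝ} (hc : 0 < c) (b : ℝ) :
    ∫ y in (0 : ℝ)..b, Real.exp (-(c * y)) ≤ 1 / c := by
  have hd : ∀ y ∈ Set.uIcc (0 : ℝ) b,
      HasDerivAt (fun y => -(Real.exp (-(c * y)) / c)) (Real.exp (-(c * y))) y := by
    intro y _
    have := ((((hasDerivAt_id y).const_mul c).neg.exp).div_const c).neg
    refine this.congr_deriv ?_
    simp only [id, Pi.neg_apply]
    field_simp
  rw [intervalIntegral.integral_eq_sub_of_hasDerivAt hd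
    ((by fun_prop : Continuous _).intervalIntegrable _ _)]
  have : 0 < Real.exp (-(c * b)) / c := by positivity
  simp
  exact this.le

-- On the edge `Re ζ = T` the exponential has modulus `exp(-x sinh T sin y)`; Jordan's inequality
-- `sin y ≥ 2y/π` makes its integral `O(1/(x sinh T))`.
open Complex in
lemma norm_edge_le {x T : ℝ} (hx : 0 < x) (hT : 0 < T) (t : ℝ) :
    ‖∫ y in (0 : ℝ)..(Real.pi / 2),
        cexp (I * (x * cosh (T + y * I))) * cosh (2 * t * I * (T + y * I))‖ ≤
      Real.exp (Real.pi * |t|) * (Real.pi / 2) / (x * Real.sinh T) := by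
  have hs : 0 < Real.sinh T := Real.sinh_pos_iff.mpr hT
  have hpi := Real.pi_pos
  set c := x * Real.sinh T * (2 / Real.pi) with hc
  have hc0 : 0 < c := by positivity
  have hb : ‖∫ y in (0 : ℝ)..(Real.pi / 2),
        cexp (I * (x * cosh (T + y * I))) * cosh (2 * t * I * (T + y * I))‖ ≤
      ∫ y in (0 : ℝ)..(Real.pi / 2), Real.exp (Real.pi * |t|) * Real.exp (-(c * y)) := by
    refine intervalIntegral.norm_integral_le_of_norm_le (by positivity) ?_
      ((by fun_prop : Continuous _).intervalIntegrable _ _)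
    refine ae_of_all _ fun y hy => ?_
    rw [norm_mul, mul_comm]
    gcongr
    · refine (norm_cosh_le_exp_abs_re _).trans (Real.exp_le_exp.mpr ?_)
      have : (2 * t * I * (T + y * I)).re = -(2 * t * y) := by simp
      rw [this, abs_neg, abs_mul, abs_mul, abs_of_pos hy.1, abs_two]
      nlinarith [abs_nonneg t, hy.2]
    · rw [Complex.norm_exp]
      apply Real.exp_le_exp.mpr
      have h1 : (I * (x * cosh (T + y * I))).re = -(x * (Real.sinh T * Real.sin y)) := by
        rw [Complex.cosh_add, Complex.cosh_mul_I, Complex.sinh_mul_I, ← ofReal_cosh, ← ofReal_sinh,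
          ← ofReal_cos, ← ofReal_sin]
        simp [-ofReal_cosh, -ofReal_sinh, -ofReal_cos, -ofReal_sin]
      rw [h1, hc]
      have h2 := Real.mul_le_sin hy.1.le hy.2
      have h3 : x * Real.sinh T * (2 / Real.pi * y) ≤ x * Real.sinh T * Real.sin y := by gcongr
      linarith
  refine hb.trans ?_
  rw [intervalIntegral.integral_const_mul]
  have := integral_exp_neg_mul_le hc0 (Real.pi / 2)
  calc _ ≤ Real.exp (Real.pi * |t|) * (1 / c) := by gcongr
    _ = _ := by rw [hc]; field_simp

-- Cauchy's theorem for `e^{ix cosh ζ} cosh(2itζ)` on the rectangle with corners `0` and `T + iπ/2`,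
-- in real parts. On the top edge `cosh(ξ + iπ/2) = i sinh ξ` turns oscillation into decay, the left
-- edge gives the sine integral, and the right edge is the error.
open Complex in
lemma abs_truncated_sub_le {x T : ℝ} (hx : 0 < x) (hT : 0 < T) (t : ℝ) :
    |(∫ ξ in (0 : ℝ)..T, Real.cos (x * Real.cosh ξ) * Real.cos (2 * t * ξ)) -
      (Real.cosh (Real.pi * t) *
        (∫ ξ in (0 : ℝ)..T, Real.exp (-(x * Real.sinh ξ)) * Real.cos (2 * t * ξ)) -
      ∫ φ in (0 : ℝ)..(Real.pi / 2), Real.cosh (2 * t * φ) * Real.sin (x * Real.cos φ))| ≤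
      Real.exp (Real.pi * |t|) * (Real.pi / 2) / (x * Real.sinh T) := by
  set f : ℂ → ℂ := fun ζ => cexp (I * (x * cosh ζ)) * cosh (2 * t * I * ζ) with hf
  have hfc : Continuous f := by fun_prop
  have hrect := Complex.integral_boundary_rect_eq_zero_of_differentiableOn f 0
    (T + (Real.pi / 2 : ℝ) * I) (by
      refine Differentiable.differentiableOn ?_
      rw [hf]
      fun_prop)
  simp only [zero_re, zero_im, ofReal_zero, zero_mul, add_zero, add_re, ofReal_re, mul_re, I_re,
    mul_zero, ofReal_im, I_im, mul_one, sub_self, add_im, mul_im, zero_add, smul_eq_mul] at hrect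
  have hre := congrArg re hrect
  have i1 : (∫ ξ in (0 : ℝ)..T, f ξ).re =
      ∫ ξ in (0 : ℝ)..T, Real.cos (x * Real.cosh ξ) * Real.cos (2 * t * ξ) := by
    have := Complex.reCLM.intervalIntegral_comp_comm (μ := volume) (a := 0) (b := T)
      (f := fun ξ : ℝ => f ξ) ((by fun_prop : Continuous _).intervalIntegrable _ _)
    simp only [reCLM_apply] at this
    rw [← this]
    congr 1
    ext ξ
    rw [hf]
    simp only
    rw [show 2 * t * I * (ξ : ℂ) = (2 * t * ξ : ℝ) * I by push_cast; ring, Complex.cosh_mul_I,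
      ← ofReal_cosh, ← ofReal_mul, mul_comm I, ← ofReal_cos, re_mul_ofReal,
      Complex.exp_ofReal_mul_I_re]
  have i2 : (∫ ξ in (0 : ℝ)..T, f (ξ + (Real.pi / 2 : ℝ) * I)).re =
      Real.cosh (Real.pi * t) *
        ∫ ξ in (0 : ℝ)..T, Real.exp (-(x * Real.sinh ξ)) * Real.cos (2 * t * ξ) := by
    have := Complex.reCLM.intervalIntegral_comp_comm (μ := volume) (a := 0) (b := T)
      (f := fun ξ : ℝ => f (ξ + (Real.pi / 2 : ℝ) * I))
      ((by fun_prop : Continuous _).intervalIntegrable _ _)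
    simp only [reCLM_apply] at this
    rw [← this, ← intervalIntegral.integral_const_mul]
    congr 1
    ext ξ
    rw [hf]
    simp only
    have e1 : cosh (ξ + (Real.pi / 2 : ℝ) * I) = I * (Real.sinh ξ : ℝ) := by
      rw [Complex.cosh_add, Complex.cosh_mul_I, Complex.sinh_mul_I, ← ofReal_cos, ← ofReal_sin,
        Real.cos_pi_div_two, Real.sin_pi_div_two]
      push_cast
      ring
    have e2 : I * (x * (I * (Real.sinh ξ : ℝ))) = ((-(x * Real.sinh ξ) : ℝ) : ℂ) := by
      push_cast
      linear_combination x * sinh ξ * I_sq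
    have e3 : 2 * t * I * (ξ + (Real.pi / 2 : ℝ) * I) =
        (-(Real.pi * t) : ℝ) + (2 * t * ξ : ℝ) * I := by
      push_cast
      linear_combination Real.pi * t * I_sq
    rw [e1, e2, e3, Complex.cosh_add, Complex.cosh_mul_I, Complex.sinh_mul_I, ← ofReal_exp,
      re_ofReal_mul, ← ofReal_cosh, ← ofReal_sinh, ← ofReal_cos, ← ofReal_sin]
    simp [-ofReal_cosh, -ofReal_sinh, -ofReal_cos, -ofReal_sin]
    ring
  have i3 : (I * ∫ y in (0 : ℝ)..(Real.pi / 2), f (y * I)).re =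
      -∫ φ in (0 : ℝ)..(Real.pi / 2), Real.cosh (2 * t * φ) * Real.sin (x * Real.cos φ) := by
    have := Complex.imCLM.intervalIntegral_comp_comm (μ := volume) (a := 0) (b := Real.pi / 2)
      (f := fun y : ℝ => f (y * I))
      ((by fun_prop : Continuous _).intervalIntegrable _ _)
    simp only [imCLM_apply] at this
    rw [I_mul_re, ← this]
    congr 2
    ext φ
    rw [hf]
    simp only
    rw [Complex.cosh_mul_I, ← ofReal_cos, ← ofReal_mul, mul_comm I,
      show 2 * t * I * (φ * I) = ((-(2 * t * φ) : ℝ) : ℂ) by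
        push_cast; linear_combination 2 * t * φ * I_sq, ← ofReal_cosh, im_mul_ofReal,
      Complex.exp_ofReal_mul_I_im, Real.cosh_neg, mul_comm]
  have i4 := norm_edge_le hx hT t
  change ‖∫ y in (0 : ℝ)..(Real.pi / 2), f (T + y * I)‖ ≤ _ at i4
  simp only [sub_re, add_re, zero_re] at hre
  rw [i1, i2, i3] at hre
  have i5 := Complex.abs_re_le_norm (I * ∫ y in (0 : ℝ)..(Real.pi / 2), f (T + y * I))
  rw [norm_mul, norm_I, one_mul] at i5
  refine le_trans (le_of_eq ?_) (i5.trans i4)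
  rw [← abs_neg]
  congr 1
  linarith

lemma abs_integral_tail_le {x T : ℝ} (hx : 0 < x) (hT : 0 < T) (t : ℝ) :
    |∫ ξ in Set.Ioi T, Real.exp (-(x * Real.sinh ξ)) * Real.cos (2 * t * ξ)| ≤
      1 / (x * Real.sinh T) := by
  have hs : 0 < Real.sinh T := Real.sinh_pos_iff.mpr hT
  have h : ‖∫ ξ in Set.Ioi T, Real.exp (-(x * Real.sinh ξ)) * Real.cos (2 * t * ξ)‖ ≤
      ∫ ξ in Set.Ioi T, Real.exp T / (x * Real.sinh T) * Real.exp (-ξ) := by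
    refine norm_integral_le_of_norm_le ((integrableOn_exp_neg_Ioi T).const_mul _) ?_
    refine (ae_restrict_mem measurableSet_Ioi).mono fun ξ hξ => ?_
    have hξ' : T < ξ := hξ
    rw [norm_mul, Real.norm_of_nonneg (Real.exp_pos _).le]
    -- The growth of `sinh` beyond `T`, combined with `e^{-u} ≤ 1/u`, reduces the tail to an
    -- explicit exponential integral.
    have h1 : Real.sinh T * Real.exp (ξ - T) ≤ Real.sinh ξ := by
      have : Real.sinh ξ = Real.sinh T * Real.cosh (ξ - T) + Real.cosh T * Real.sinh (ξ - T) := by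
        rw [← Real.sinh_add]; congr 1; ring
      rw [this, ← Real.cosh_add_sinh, mul_add]
      have h2 : 0 ≤ Real.sinh (ξ - T) := Real.sinh_nonneg_iff.mpr (by linarith)
      have h3 : Real.sinh T ≤ Real.cosh T := (Real.sinh_lt_cosh T).le
      nlinarith
    have h2 : Real.exp (-(x * Real.sinh ξ)) ≤ 1 / (x * (Real.sinh T * Real.exp (ξ - T))) := by
      have h5 : x * (Real.sinh T * Real.exp (ξ - T)) ≤ Real.exp (x * Real.sinh ξ) := by
        have := Real.add_one_le_exp (x * Real.sinh ξ)
        nlinarith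
      rw [Real.exp_neg, one_div]
      exact inv_anti₀ (by positivity) h5
    calc _ ≤ 1 / (x * (Real.sinh T * Real.exp (ξ - T))) * 1 := by
          gcongr
          exact Real.abs_cos_le_one _
      _ = _ := by
          rw [Real.exp_sub, Real.exp_neg]
          field_simp
  rw [integral_const_mul, integral_exp_neg_Ioi, Real.exp_neg] at h
  refine h.trans (le_of_eq ?_)
  field_simp

/-- The shape of the error matters: its singularity `1/x` is weak enough to be compensated by a
Bessel function vanishing at 0, and it tends to 0 with `T`. The constant may depend on `t`, since it
disappears in the limit. -/
theorem abs_kernelReal_sub_kernelTrunc_le (t : ℝ) :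
    ∃ C : ℝ, 0 ≤ C ∧ ∀ x T : ℝ, 0 < x → 0 < T →
      |kernelReal t x - kernelTrunc t T x| ≤ C / (x * Real.sinh T) := by
  refine ⟨2 / Real.pi * (Real.cosh (Real.pi * t) + Real.exp (Real.pi * |t|) * (Real.pi / 2)),
    by positivity, fun x T hx hT => ?_⟩
  have hs : 0 < Real.sinh T := Real.sinh_pos_iff.mpr hT
  have h1 := abs_truncated_sub_le hx hT t
  have h2 := abs_integral_tail_le hx hT t
  have hint : IntegrableOn (fun ξ : ℝ => Real.exp (-(x * Real.sinh ξ)) * Real.cos (2 * t * ξ))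
      (Set.Ioi 0) := by
    refine (integrableOn_exp_neg_mul_sinh hx 0).mono'
      (by fun_prop : Continuous _).aestronglyMeasurable (ae_of_all _ fun ξ => ?_)
    rw [norm_mul, Real.norm_of_nonneg (Real.exp_pos _).le]
    simp only [zero_mul, Real.exp_zero]
    gcongr
    exact Real.abs_cos_le_one _
  have h3 := intervalIntegral.integral_interval_add_Ioi hint
    (hint.mono_set (Set.Ioi_subset_Ioi hT.le))
  rw [kernelReal, kernelTrunc, ← h3, ← mul_sub, abs_mul, abs_of_pos (by positivity), mul_div_assoc]
  gcongr
  set A := ∫ ξ in (0 : ℝ)..T, Real.exp (-(x * Real.sinh ξ)) * Real.cos (2 * t * ξ)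
  set B := ∫ ξ in Set.Ioi T, Real.exp (-(x * Real.sinh ξ)) * Real.cos (2 * t * ξ)
  set M := ∫ φ in (0 : ℝ)..(Real.pi / 2), Real.cosh (2 * t * φ) * Real.sin (x * Real.cos φ)
  set D := ∫ ξ in (0 : ℝ)..T, Real.cos (x * Real.cosh ξ) * Real.cos (2 * t * ξ)
  have hch := Real.cosh_pos (Real.pi * t)
  calc |Real.cosh (Real.pi * t) * (A + B) - M - D|
      = |Real.cosh (Real.pi * t) * B - (D - (Real.cosh (Real.pi * t) * A - M))| := by
        congr 1; ring
    _ ≤ |Real.cosh (Real.pi * t) * B| + |D - (Real.cosh (Real.pi * t) * A - M)| := abs_sub _ _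
    _ ≤ Real.cosh (Real.pi * t) * (1 / (x * Real.sinh T)) +
        Real.exp (Real.pi * |t|) * (Real.pi / 2) / (x * Real.sinh T) := by
        rw [abs_mul, abs_of_pos hch]
        gcongr
    _ = _ := by ring

/-! ### Bessel functions of integer order: differential equation and decay -/

/-- The Bessel integral for the Bessel function of integer order `n`. -/
def besselInt (n : ℕ) (x : ℝ) : ℝ :=
  1 / (2 * Real.pi) * ∫ θ in (-Real.pi)..Real.pi, Real.cos (x * Real.sin θ - n * θ)

/-- The derivative of `besselInt n`. -/
def besselIntDeriv (n : ℕ) (x : ℝ) : ℝ :=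
  1 / (2 * Real.pi) * ∫ θ in (-Real.pi)..Real.pi,
    -(Real.sin θ * Real.sin (x * Real.sin θ - n * θ))

/-- The second derivative of `besselInt n`. -/
def besselIntDerivTwo (n : ℕ) (x : ℝ) : ℝ :=
  1 / (2 * Real.pi) * ∫ θ in (-Real.pi)..Real.pi,
    -(Real.sin θ ^ 2 * Real.cos (x * Real.sin θ - n * θ))

open Complex in
lemma besselInt_eq_cexp (n : ℕ) (x : ℝ) :
    (besselInt n x : ℂ) =
      1 / (2 * Real.pi) * ∫ θ in (-Real.pi)..Real.pi, cexp (I * (x * sin θ - n * θ)) := by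
  rw [besselInt]
  push_cast
  rw [← intervalIntegral.integral_ofReal]
  have h1 := integral_sub_add_eq (f := fun θ : ℝ => cexp (I * (x * sin θ - n * θ)))
    (by fun_prop) 0 Real.pi
  have h2 := integral_sub_add_eq
    (f := fun θ : ℝ => ((Real.cos (x * Real.sin θ - n * θ) : ℝ) : ℂ)) (by fun_prop) 0 Real.pi
  rw [zero_sub, zero_add] at h1 h2
  rw [h1, h2]
  congr 2
  ext φ
  simp only [zero_sub, zero_add, Real.sin_neg]
  push_cast
  rw [Complex.sin_neg, show I * (x * -sin φ - n * -φ) = -(x * sin φ - n * φ) * I by ring,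
    show I * (x * sin φ - n * φ) = (x * sin φ - n * φ) * I by ring,
    show (x * -sin φ - n * -φ : ℂ) = -(x * sin φ - n * φ) by ring, Complex.cos_neg, Complex.cos]
  ring

lemma besselJ_natCast {x : ℝ} (hx : 0 < x) (n : ℕ) : besselJ n x = (besselInt n x : ℂ) := by
  rw [besselJ_eq hx, mul_comm (Real.pi : ℂ), Complex.sin_nat_mul_pi, besselInt_eq_cexp, zero_div,
    zero_mul, sub_zero]

lemma hasDerivAt_besselInt (n : ℕ) (x : ℝ) :
    HasDerivAt (besselInt n) (besselIntDeriv n x) x := by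
  refine HasDerivAt.const_mul _ ?_
  refine (intervalIntegral.hasDerivAt_integral_of_dominated_loc_of_deriv_le (s := Set.univ)
    (bound := fun _ => 1) (F := fun x θ => Real.cos (x * Real.sin θ - n * θ))
    (F' := fun x θ => -(Real.sin θ * Real.sin (x * Real.sin θ - n * θ)))
    univ_mem ?_ ?_ ?_ ?_ ?_ ?_).2
  · exact Eventually.of_forall fun x => (by fun_prop : Continuous _).aestronglyMeasurable
  · exact (by fun_prop : Continuous _).intervalIntegrable _ _
  · exact (by fun_prop : Continuous _).aestronglyMeasurable
  · refine ae_of_all _ fun θ _ x _ => ?_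
    rw [norm_neg, norm_mul]
    exact mul_le_one₀ (Real.abs_sin_le_one _) (norm_nonneg _) (Real.abs_sin_le_one _)
  · exact intervalIntegrable_const
  · refine ae_of_all _ fun θ _ x _ => ?_
    refine (((hasDerivAt_id x).mul_const (Real.sin θ)).sub_const (n * θ)).cos.congr_deriv ?_
    simp only [id]
    ring

lemma hasDerivAt_besselIntDeriv (n : ℕ) (x : ℝ) :
    HasDerivAt (besselIntDeriv n) (besselIntDerivTwo n x) x := by
  refine HasDerivAt.const_mul _ ?_
  refine (intervalIntegral.hasDerivAt_integral_of_dominated_loc_of_deriv_le (s := Set.univ)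
    (bound := fun _ => 1) (F := fun x θ => -(Real.sin θ * Real.sin (x * Real.sin θ - n * θ)))
    (F' := fun x θ => -(Real.sin θ ^ 2 * Real.cos (x * Real.sin θ - n * θ)))
    univ_mem ?_ ?_ ?_ ?_ ?_ ?_).2
  · exact Eventually.of_forall fun x => (by fun_prop : Continuous _).aestronglyMeasurable
  · exact (by fun_prop : Continuous _).intervalIntegrable _ _
  · exact (by fun_prop : Continuous _).aestronglyMeasurable
  · refine ae_of_all _ fun θ _ x _ => ?_
    rw [norm_neg, norm_mul, norm_pow]
    exact mul_le_one₀ (pow_le_one₀ (norm_nonneg _) (Real.abs_sin_le_one _)) (norm_nonneg _)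
      (Real.abs_cos_le_one _)
  · exact intervalIntegrable_const
  · refine ae_of_all _ fun θ _ x _ => ?_
    refine ((((hasDerivAt_id x).mul_const (Real.sin θ)).sub_const
      (n * θ)).sin.const_mul (Real.sin θ)).neg.congr_deriv ?_
    simp only [id]
    ring

lemma continuous_besselInt (n : ℕ) : Continuous (besselInt n) :=
  continuous_iff_continuousAt.mpr fun x => (hasDerivAt_besselInt n x).continuousAt

lemma continuous_besselIntDeriv (n : ℕ) : Continuous (besselIntDeriv n) :=
  continuous_iff_continuousAt.mpr fun x => (hasDerivAt_besselIntDeriv n x).continuousAt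

lemma abs_average_le_one {f : ℝ → ℝ} (hf : ∀ θ, |f θ| ≤ 1) :
    |1 / (2 * Real.pi) * ∫ θ in (-Real.pi)..Real.pi, f θ| ≤ 1 := by
  have hpi := Real.pi_pos
  have h := intervalIntegral.norm_integral_le_of_norm_le_const (a := -Real.pi) (b := Real.pi)
    (f := f) (C := 1) (fun θ _ => hf θ)
  rw [show Real.pi - -Real.pi = 2 * Real.pi by ring, abs_of_pos (by positivity), one_mul,
    Real.norm_eq_abs] at h
  rw [abs_mul, abs_of_pos (by positivity), one_div, inv_mul_le_iff₀ (by positivity), mul_one]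
  exact h

lemma abs_besselInt_le_one (n : ℕ) (x : ℝ) : |besselInt n x| ≤ 1 :=
  abs_average_le_one fun _ => Real.abs_cos_le_one _

lemma abs_besselIntDeriv_le_one (n : ℕ) (x : ℝ) : |besselIntDeriv n x| ≤ 1 := by
  refine abs_average_le_one fun θ => ?_
  rw [abs_neg, abs_mul]
  exact mul_le_one₀ (Real.abs_sin_le_one _) (abs_nonneg _) (Real.abs_sin_le_one _)

lemma besselInt_zero {n : ℕ} (hn : n ≠ 0) : besselInt n 0 = 0 := by
  have hn' : (n : ℝ) ≠ 0 := by exact_mod_cast hn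
  have hd : ∀ θ ∈ Set.uIcc (-Real.pi) Real.pi,
      HasDerivAt (fun θ : ℝ => Real.sin (n * θ) / n) (Real.cos (0 * Real.sin θ - n * θ)) θ := by
    intro θ _
    refine (((hasDerivAt_id θ).const_mul (n : ℝ)).sin.div_const (n : ℝ)).congr_deriv ?_
    simp only [id, zero_mul, zero_sub, Real.cos_neg]
    field_simp
  rw [besselInt, intervalIntegral.integral_eq_sub_of_hasDerivAt hd
    ((by fun_prop : Continuous _).intervalIntegrable _ _)]
  simp [Real.sin_nat_mul_pi]

/-- Mean value inequality from the zero at the origin. This linear vanishing absorbs the `1/x` in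
the truncation error of the kernel. -/
lemma abs_besselInt_le {n : ℕ} (hn : n ≠ 0) {x : ℝ} (hx : 0 ≤ x) : |besselInt n x| ≤ x := by
  have h := (convex_univ (𝕜 := ℝ) (E := ℝ)).norm_image_sub_le_of_norm_hasDerivWithin_le
    (f := besselInt n) (C := 1)
    (fun x _ => (hasDerivAt_besselInt n x).hasDerivWithinAt)
    (fun x _ => abs_besselIntDeriv_le_one n x) (Set.mem_univ 0) (Set.mem_univ x)
  rw [besselInt_zero hn, sub_zero, sub_zero, one_mul, Real.norm_eq_abs, Real.norm_of_nonneg hx] at h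
  exact h

/-- Bessel's differential equation. -/
lemma besselInt_ode (n : ℕ) (x : ℝ) :
    x ^ 2 * besselIntDerivTwo n x + x * besselIntDeriv n x +
      (x ^ 2 - n ^ 2) * besselInt n x = 0 := by
  -- Under the integral sign the left side of the equation is an exact θ-derivative, of a function
  -- that vanishes at `±π`.
  have hd : ∀ θ ∈ Set.uIcc (-Real.pi) Real.pi,
      HasDerivAt (fun θ : ℝ => (n + x * Real.cos θ) * Real.sin (x * Real.sin θ - n * θ))
        (x ^ 2 * -(Real.sin θ ^ 2 * Real.cos (x * Real.sin θ - n * θ)) +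
          x * -(Real.sin θ * Real.sin (x * Real.sin θ - n * θ)) +
          (x ^ 2 - n ^ 2) * Real.cos (x * Real.sin θ - n * θ)) θ := by
    intro θ _
    have e1 := ((Real.hasDerivAt_cos θ).const_mul x).const_add (n : ℝ)
    have e2 := (((Real.hasDerivAt_sin θ).const_mul x).sub
      ((hasDerivAt_id θ).const_mul (n : ℝ))).sin
    refine (e1.mul e2).congr_deriv ?_
    simp only [id, Pi.sub_apply]
    linear_combination x ^ 2 * Real.cos (x * Real.sin θ - n * θ) * Real.sin_sq_add_cos_sq θ
  have h := intervalIntegral.integral_eq_sub_of_hasDerivAt hd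
    ((by fun_prop : Continuous _).intervalIntegrable _ _)
  rw [intervalIntegral.integral_add ((by fun_prop : Continuous _).intervalIntegrable _ _)
      ((by fun_prop : Continuous _).intervalIntegrable _ _),
    intervalIntegral.integral_add ((by fun_prop : Continuous _).intervalIntegrable _ _)
      ((by fun_prop : Continuous _).intervalIntegrable _ _)] at h
  simp only [intervalIntegral.integral_const_mul, Real.sin_pi, Real.sin_neg, mul_zero, neg_zero,
    zero_sub, mul_neg, sub_neg_eq_add, zero_add, Real.sin_nat_mul_pi, Real.sin_neg, sub_self] at h
  simp only [besselInt, besselIntDeriv, besselIntDerivTwo, intervalIntegral.integral_neg,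
    intervalIntegral.integral_const_mul] at h ⊢
  linear_combination 1 / (2 * Real.pi) * h

lemma sq_add_sq_le_energy {x j d : ℝ} (hx : 1 ≤ x) :
    x / 2 * (j ^ 2 + d ^ 2) ≤ x * d ^ 2 + x * j ^ 2 + j * d := by
  nlinarith [sq_nonneg (j + d), mul_nonneg (sub_nonneg.mpr hx) (add_nonneg (sq_nonneg j) (sq_nonneg d))]

/-- An energy argument. In `E = x J'² + x J² + J J'` the cross term cancels the part `J² - J'²` of
the derivative, so that `E' ≤ cE/x²`. Hence `E e^{c/x}` decreases on `[1, ∞)` and `E` stays bounded,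
while `E ≥ x(J² + J'²)/2`. -/
lemma besselInt_sq_add_sq_le (n : ℕ) : ∃ C : ℝ, 1 ≤ C ∧ ∀ x : ℝ, 1 ≤ x →
    besselInt n x ^ 2 + besselIntDeriv n x ^ 2 ≤ C / x := by
  set c : ℝ := 2 * (2 * n ^ 2 + 1) with hc
  have hc0 : 0 < c := by positivity
  set E : ℝ → ℝ := fun x => x * besselIntDeriv n x ^ 2 + x * besselInt n x ^ 2 +
    besselInt n x * besselIntDeriv n x with hE
  set E' : ℝ → ℝ := fun x => (2 * n ^ 2 - 1) * (besselInt n x * besselIntDeriv n x) / x +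
    n ^ 2 * besselInt n x ^ 2 / x ^ 2 with hE'
  have hEd : ∀ x : ℝ, 0 < x → HasDerivAt E (E' x) x := by
    intro x hx
    have h0 := hasDerivAt_id x
    have h1 := hasDerivAt_besselInt n x
    have h2 := hasDerivAt_besselIntDeriv n x
    have h3 := ((h0.mul (h2.pow 2)).add (h0.mul (h1.pow 2))).add (h1.mul h2)
    refine h3.congr_deriv ?_
    have hode := besselInt_ode n x
    have hdd : besselIntDerivTwo n x = -(besselIntDeriv n x / x) -
        (1 - n ^ 2 / x ^ 2) * besselInt n x := by
      field_simp
      linear_combination hode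
    rw [hdd, hE']
    simp only [id]
    field_simp
    simp
    ring
  have hanti : AntitoneOn (fun x => E x * Real.exp (c / x)) (Set.Ici 1) := by
    have hder : ∀ x : ℝ, 0 < x → HasDerivAt (fun x => E x * Real.exp (c / x))
        ((E' x - c * E x / x ^ 2) * Real.exp (c / x)) x := by
      intro x hx
      have h1 : HasDerivAt (fun x : ℝ => c / x) (-c / x ^ 2) x := by
        refine ((hasDerivAt_const x c).div (hasDerivAt_id x) hx.ne').congr_deriv ?_
        simp
      refine ((hEd x hx).mul h1.exp).congr_deriv ?_
      ring
    refine antitoneOn_of_deriv_nonpos (convex_Ici 1) ?_ ?_ ?_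
    · intro x hx
      exact (hder x (lt_of_lt_of_le one_pos hx)).continuousAt.continuousWithinAt
    · intro x hx
      rw [interior_Ici] at hx
      exact (hder x (lt_trans one_pos hx)).differentiableAt.differentiableWithinAt
    · intro x hx
      rw [interior_Ici] at hx
      have hx1 : (1 : ℝ) < x := hx
      have hx0 : 0 < x := lt_trans one_pos hx1
      rw [(hder x hx0).deriv]
      refine mul_nonpos_of_nonpos_of_nonneg ?_ (Real.exp_pos _).le
      have h1 := sq_add_sq_le_energy (j := besselInt n x) (d := besselIntDeriv n x) hx1.le
      simp only [hE', hE] at h1 ⊢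
      generalize besselInt n x = j at *
      generalize besselIntDeriv n x = d at *
      have h2 : (2 * (n : ℝ) ^ 2 - 1) * (j * d) / x + n ^ 2 * j ^ 2 / x ^ 2 ≤
          (2 * n ^ 2 + 1) * (j ^ 2 + d ^ 2) / x := by
        have h3 : (n : ℝ) ^ 2 * j ^ 2 / x ^ 2 ≤ n ^ 2 * j ^ 2 / x := by
          gcongr
          nlinarith
        have h4 : (2 * (n : ℝ) ^ 2 - 1) * (j * d) ≤ (n ^ 2 + 1) * (j ^ 2 + d ^ 2) := by
          nlinarith [mul_nonneg (sq_nonneg (n : ℝ)) (sq_nonneg (j - d)), sq_nonneg (j + d),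
            sq_nonneg j, sq_nonneg d]
        calc _ ≤ (n ^ 2 + 1) * (j ^ 2 + d ^ 2) / x + n ^ 2 * j ^ 2 / x := by gcongr
          _ = ((n ^ 2 + 1) * (j ^ 2 + d ^ 2) + n ^ 2 * j ^ 2) / x := by ring
          _ ≤ _ := by
            gcongr
            nlinarith [mul_nonneg (sq_nonneg (n : ℝ)) (sq_nonneg d)]
      have h5 : (2 * (n : ℝ) ^ 2 + 1) * (j ^ 2 + d ^ 2) / x =
          c * (x / 2 * (j ^ 2 + d ^ 2)) / x ^ 2 := by
        rw [hc]; field_simp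
      have h6 : c * (x / 2 * (j ^ 2 + d ^ 2)) / x ^ 2 ≤
          c * (x * d ^ 2 + x * j ^ 2 + j * d) / x ^ 2 := by gcongr
      linarith
  refine ⟨6 * Real.exp c, ?_, fun x hx => ?_⟩
  · nlinarith [Real.one_le_exp hc0.le]
  · have hx0 : 0 < x := lt_of_lt_of_le one_pos hx
    have h1 := sq_add_sq_le_energy (j := besselInt n x) (d := besselIntDeriv n x) hx
    have h2 := hanti (Set.mem_Ici.mpr le_rfl) (Set.mem_Ici.mpr hx) hx
    simp only [div_one] at h2
    have h3 : E 1 ≤ 3 := by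
      have a1 := abs_le.mp (abs_besselInt_le_one n 1)
      have a2 := abs_le.mp (abs_besselIntDeriv_le_one n 1)
      simp only [hE]
      nlinarith
    have h4 : 0 ≤ E x := le_trans (by positivity) h1
    have h5 : 1 ≤ Real.exp (c / x) := Real.one_le_exp (by positivity)
    have h6 : E x ≤ 3 * Real.exp c := by
      calc E x ≤ E x * Real.exp (c / x) := le_mul_of_one_le_right h4 h5
        _ ≤ E 1 * Real.exp c := h2
        _ ≤ 3 * Real.exp c := by gcongr
    rw [le_div_iff₀ hx0]
    have h7 : x / 2 * (besselInt n x ^ 2 + besselIntDeriv n x ^ 2) ≤ 3 * Real.exp c := h1.trans h6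
    linarith

lemma besselInt_decay (n : ℕ) : ∃ D : ℝ, 0 < D ∧ ∀ x : ℝ, 0 < x →
    |besselInt n x| ≤ D / √x ∧ |besselIntDeriv n x| ≤ D / √x := by
  obtain ⟨C, hC, h⟩ := besselInt_sq_add_sq_le n
  have hD : 1 ≤ √C := Real.one_le_sqrt.mpr hC
  refine ⟨√C, by linarith, fun x hx => ?_⟩
  have hsx := Real.sqrt_pos.mpr hx
  rcases le_total 1 x with h1 | h1
  · have h2 := h x h1
    rw [← Real.sqrt_div' _ hx.le]
    constructor
    · apply Real.abs_le_sqrt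
      nlinarith [sq_nonneg (besselIntDeriv n x)]
    · apply Real.abs_le_sqrt
      nlinarith [sq_nonneg (besselInt n x)]
  · have h3 : 1 ≤ √C / √x := by
      rw [le_div_iff₀ hsx, one_mul]
      exact (Real.sqrt_le_one.mpr h1).trans hD
    exact ⟨(abs_besselInt_le_one n x).trans h3, (abs_besselIntDeriv_le_one n x).trans h3⟩

/-! ### Truncated cosine transforms, uniformly in the truncation -/

/-- The truncated cosine transform of `besselInt n`. -/
def cosTransform (n : ℕ) (R a : ℝ) : ℝ :=
  ∫ x in (0 : ℝ)..R, besselInt n x * Real.cos (a * x)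

lemma intervalIntegrable_besselInt_mul_cos (n : ℕ) (a X R : ℝ) :
    IntervalIntegrable (fun x => besselInt n x * Real.cos (a * x)) volume X R := by
  have := continuous_besselInt n
  exact (by fun_prop : Continuous _).intervalIntegrable _ _

lemma continuousOn_inv_mul_sqrt {X R : ℝ} (hX : 0 < X) (hXR : X ≤ R) :
    ContinuousOn (fun x : ℝ => 1 / (x * √x)) (Set.uIcc X R) := by
  rw [Set.uIcc_of_le hXR]
  refine ContinuousOn.div continuousOn_const (by fun_prop) fun x hx => ?_
  have : 0 < x := lt_of_lt_of_le hX hx.1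
  positivity

lemma integral_inv_mul_sqrt_le {X R : ℝ} (hX : 0 < X) (hXR : X ≤ R) :
    ∫ x in X..R, 1 / (x * √x) ≤ 2 / √X := by
  have hd : ∀ x ∈ Set.uIcc X R, HasDerivAt (fun x : ℝ => -(2 / √x)) (1 / (x * √x)) x := by
    intro x hx
    rw [Set.uIcc_of_le hXR] at hx
    have hx0 : 0 < x := lt_of_lt_of_le hX hx.1
    have hs := Real.sqrt_pos.mpr hx0
    have := ((hasDerivAt_const x (2 : ℝ)).div (Real.hasDerivAt_sqrt hx0.ne') hs.ne').neg
    refine this.congr_deriv ?_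
    have h2 := Real.sq_sqrt hx0.le
    field_simp
    linear_combination -h2
  rw [intervalIntegral.integral_eq_sub_of_hasDerivAt hd
    (continuousOn_inv_mul_sqrt hX hXR).intervalIntegrable]
  have : 0 ≤ 2 / √R := by positivity
  linarith

/-- Integration by parts against Bessel's equation. -/
lemma abs_integral_besselInt_mul_cos_le {n : ℕ} {D : ℝ}
    (hD : ∀ x : ℝ, 0 < x → |besselInt n x| ≤ D / √x ∧ |besselIntDeriv n x| ≤ D / √x)
    {a X R : ℝ} (ha : 0 ≤ a) (hX : 0 < X) (hXR : X ≤ R) :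
    |1 - a ^ 2| * |∫ x in X..R, besselInt n x * Real.cos (a * x)| ≤
      2 * D / √X * (2 + a + n ^ 2 / X) := by
  have hsX := Real.sqrt_pos.mpr hX
  have hD0 : 0 ≤ D := by
    have := (abs_nonneg _).trans (hD X hX).1
    by_contra hneg
    have := div_neg_of_neg_of_pos (not_le.mp hneg) hsX
    linarith
  have cj := continuous_besselInt n
  have cd := continuous_besselIntDeriv n
  -- By Bessel's equation `H' = g - (1 - a²) J cos(ax)`, where `g` is smaller by a factor `1/x` and
  -- hence absolutely integrable at infinity.
  set H : ℝ → ℝ := fun x => besselIntDeriv n x * Real.cos (a * x) +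
    a * (besselInt n x * Real.sin (a * x)) with hH
  set g : ℝ → ℝ := fun x => -(besselIntDeriv n x * Real.cos (a * x) / x) +
    n ^ 2 * (besselInt n x * Real.cos (a * x)) / x ^ 2 with hg
  have hne : ∀ x ∈ Set.uIcc X R, x ≠ 0 := by
    intro x hx
    rw [Set.uIcc_of_le hXR] at hx
    exact (lt_of_lt_of_le hX hx.1).ne'
  have hgi : IntervalIntegrable g volume X R := by
    refine ContinuousOn.intervalIntegrable ?_
    refine ContinuousOn.add (ContinuousOn.neg (ContinuousOn.div (by fun_prop) (by fun_prop) hne))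
      (ContinuousOn.div (by fun_prop) (by fun_prop) fun x hx => pow_ne_zero 2 (hne x hx))
  have hd : ∀ x ∈ Set.uIcc X R,
      HasDerivAt H (g x - (1 - a ^ 2) * (besselInt n x * Real.cos (a * x))) x := by
    intro x hx
    have hx0 := hne x hx
    have e0 := (hasDerivAt_id x).const_mul a
    have h1 := hasDerivAt_besselInt n x
    have h2 := hasDerivAt_besselIntDeriv n x
    refine ((h2.mul e0.cos).add ((h1.mul e0.sin).const_mul a)).congr_deriv ?_
    have hode := besselInt_ode n x
    have hdd : besselIntDerivTwo n x = -(besselIntDeriv n x / x) -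
        (1 - n ^ 2 / x ^ 2) * besselInt n x := by
      field_simp
      linear_combination hode
    rw [hdd, hg]
    simp only [id]
    field_simp
    ring
  have hint := intervalIntegral.integral_eq_sub_of_hasDerivAt hd
    (hgi.sub ((intervalIntegrable_besselInt_mul_cos n a X R).const_mul _))
  rw [intervalIntegral.integral_sub hgi
    ((intervalIntegrable_besselInt_mul_cos n a X R).const_mul _),
    intervalIntegral.integral_const_mul] at hint
  have hHb : ∀ x : ℝ, X ≤ x → |H x| ≤ (1 + a) * (D / √X) := by
    intro x hx
    have hx0 : 0 < x := lt_of_lt_of_le hX hx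
    obtain ⟨h1, h2⟩ := hD x hx0
    have h3 : D / √x ≤ D / √X := by gcongr
    have hDX : 0 ≤ D / √X := by positivity
    calc |H x| ≤ |besselIntDeriv n x * Real.cos (a * x)| +
          |a * (besselInt n x * Real.sin (a * x))| := abs_add_le _ _
      _ = |besselIntDeriv n x| * |Real.cos (a * x)| +
          a * (|besselInt n x| * |Real.sin (a * x)|) := by
          rw [abs_mul, abs_mul, abs_mul, abs_of_nonneg ha]
      _ ≤ D / √X * 1 + a * (D / √X * 1) := by
          gcongr
          · exact h2.trans h3
          · exact Real.abs_cos_le_one _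
          · exact h1.trans h3
          · exact Real.abs_sin_le_one _
      _ = _ := by ring
  have hgb : |∫ x in X..R, g x| ≤ D * (1 + n ^ 2 / X) * (2 / √X) := by
    have : ‖∫ x in X..R, g x‖ ≤ ∫ x in X..R, D * (1 + n ^ 2 / X) * (1 / (x * √x)) := by
      refine intervalIntegral.norm_integral_le_of_norm_le hXR (ae_of_all _ fun x hx => ?_)
        ((continuousOn_inv_mul_sqrt hX hXR).intervalIntegrable.const_mul _)
      have hx0 : 0 < x := lt_trans hX hx.1
      have hsx := Real.sqrt_pos.mpr hx0
      obtain ⟨h1, h2⟩ := hD x hx0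
      calc ‖g x‖ ≤ |-(besselIntDeriv n x * Real.cos (a * x) / x)| +
            |n ^ 2 * (besselInt n x * Real.cos (a * x)) / x ^ 2| := abs_add_le _ _
        _ = |besselIntDeriv n x| * |Real.cos (a * x)| / x +
            n ^ 2 * (|besselInt n x| * |Real.cos (a * x)|) / x ^ 2 := by
            rw [abs_neg, abs_div, abs_div, abs_mul, abs_mul, abs_mul, abs_of_pos hx0,
              abs_of_nonneg (sq_nonneg (n : ℝ)), abs_of_nonneg (sq_nonneg x)]
        _ ≤ D / √x * 1 / x + n ^ 2 * (D / √x * 1) / (x * X) := by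
            gcongr
            · exact Real.abs_cos_le_one _
            · exact Real.abs_cos_le_one _
            · rw [sq]
              have := hx.1.le
              gcongr
        _ = _ := by field_simp
    rw [intervalIntegral.integral_const_mul] at this
    refine this.trans ?_
    have := integral_inv_mul_sqrt_le hX hXR
    gcongr
  rw [← abs_mul]
  calc |(1 - a ^ 2) * ∫ x in X..R, besselInt n x * Real.cos (a * x)|
      = |(∫ x in X..R, g x) + (H X - H R)| := by congr 1; linarith
    _ ≤ |∫ x in X..R, g x| + (|H X| + |H R|) := (abs_add_le _ _).trans (by gcongr; exact abs_sub _ _)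
    _ ≤ D * (1 + n ^ 2 / X) * (2 / √X) + ((1 + a) * (D / √X) + (1 + a) * (D / √X)) := by
        gcongr
        · exact hHb X le_rfl
        · exact hHb R hXR
    _ = _ := by ring

lemma cosTransform_tendsto (n : ℕ) {a : ℝ} (ha : 0 ≤ a) (ha1 : a ≠ 1) :
    ∃ L : ℝ, Tendsto (fun R => cosTransform n R a) atTop (𝓝 L) := by
  obtain ⟨D, hD0, hD⟩ := besselInt_decay n
  have hpos : 0 < |1 - a ^ 2| := by
    rw [abs_pos]
    intro h
    have : (1 - a) * (1 + a) = 0 := by linear_combination h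
    rcases mul_eq_zero.mp this with h | h
    · exact ha1 (by linarith)
    · linarith
  refine cauchySeq_tendsto_of_complete ?_
  rw [Metric.cauchySeq_iff']
  intro ε hε
  have hlim : Tendsto (fun X : ℝ => 2 * D / √X * (2 + a + n ^ 2 / X)) atTop (𝓝 (0 * (2 + a + 0))) :=
    (Tendsto.div_atTop tendsto_const_nhds Real.tendsto_sqrt_atTop).mul
      (tendsto_const_nhds.add (Tendsto.div_atTop tendsto_const_nhds tendsto_id))
  rw [zero_mul] at hlim
  have hev := (hlim.eventually (gt_mem_nhds (mul_pos hpos hε))).and (eventually_gt_atTop 0)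
  obtain ⟨N, hN, hN0⟩ := hev.exists
  refine ⟨N, fun R hR => ?_⟩
  have h1 := abs_integral_besselInt_mul_cos_le hD ha hN0 hR
  rw [Real.dist_eq, cosTransform, cosTransform, intervalIntegral.integral_interval_sub_left
    (intervalIntegrable_besselInt_mul_cos n a _ _) (intervalIntegrable_besselInt_mul_cos n a _ _)]
  exact lt_of_mul_lt_mul_left (h1.trans_lt hN) hpos.le

lemma integral_inv_sqrt {R : ℝ} (hR : 0 ≤ R) :
    IntervalIntegrable (fun x : ℝ => 1 / √x) volume 0 R ∧ ∫ x in (0 : ℝ)..R, 1 / √x = 2 * √R := by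
  have h : IntegrableOn (fun x : ℝ => 1 / √x) (Set.Ioc 0 R) := by
    refine intervalIntegral.integrableOn_deriv_of_nonneg (g := fun x => 2 * √x) (by fun_prop) ?_ ?_
    · intro x hx
      refine ((Real.hasDerivAt_sqrt hx.1.ne').const_mul 2).congr_deriv ?_
      field_simp
    · intro x _
      positivity
  have hi : IntervalIntegrable (fun x : ℝ => 1 / √x) volume 0 R :=
    (intervalIntegrable_iff_integrableOn_Ioc_of_le hR).mpr h
  refine ⟨hi, ?_⟩
  rw [intervalIntegral.integral_eq_sub_of_hasDerivAt_of_le hR (f := fun x => 2 * √x) (by fun_prop) _ hi]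
  · simp
  · intro x hx
    refine ((Real.hasDerivAt_sqrt hx.1.ne').const_mul 2).congr_deriv ?_
    field_simp

/-- Split at `X = 1/|1 - a|`. Below it `J = O(x^{-1/2})` gives `O(√X)`; above it integration by
parts gives `O(1/(|1 - a| √X))`, of the same size. The bound is free of `R` and has an integrable
singularity at `a = 1`, so it can serve as a majorant. -/
lemma abs_cosTransform_le (n : ℕ) : ∃ C : ℝ, 0 < C ∧ ∀ R a : ℝ, 0 ≤ R → 0 ≤ a → a ≠ 1 →
    |cosTransform n R a| ≤ C / √|1 - a| := by
  obtain ⟨D, hD0, hD⟩ := besselInt_decay n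
  refine ⟨2 * D * (3 + n ^ 2), by positivity, fun R a hR ha ha1 => ?_⟩
  set u := |1 - a| with hu
  have hu0 : 0 < u := by
    rw [hu, abs_pos]
    intro h
    exact ha1 (by linarith)
  have hsu := Real.sqrt_pos.mpr hu0
  have hsmall : ∀ R : ℝ, 0 ≤ R → |∫ x in (0 : ℝ)..R, besselInt n x * Real.cos (a * x)| ≤
      2 * D * √R := by
    intro R hR
    obtain ⟨h1, h2⟩ := integral_inv_sqrt hR
    have : ‖∫ x in (0 : ℝ)..R, besselInt n x * Real.cos (a * x)‖ ≤
        ∫ x in (0 : ℝ)..R, D * (1 / √x) := by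
      refine intervalIntegral.norm_integral_le_of_norm_le hR (ae_of_all _ fun x hx => ?_)
        (h1.const_mul D)
      rw [norm_mul, mul_one_div, ← mul_one (D / √x)]
      gcongr
      · exact (hD x hx.1).1
      · exact Real.abs_cos_le_one _
    rw [intervalIntegral.integral_const_mul, h2] at this
    refine this.trans (le_of_eq (by ring))
  have hX : √(1 / u) = 1 / √u := by rw [Real.sqrt_div' _ hu0.le, Real.sqrt_one]
  rw [cosTransform]
  rcases le_total R (1 / u) with hRX | hRX
  · refine (hsmall R hR).trans ?_
    have h1 : √R ≤ 1 / √u := by rw [← hX]; exact Real.sqrt_le_sqrt hRX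
    calc 2 * D * √R ≤ 2 * D * (1 / √u) := by gcongr
      _ = 2 * D * 1 / √u := by ring
      _ ≤ 2 * D * (3 + n ^ 2) / √u := by
        gcongr
        nlinarith [sq_nonneg (n : ℝ)]
  · have hX0 : 0 < 1 / u := by positivity
    have h1 := hsmall (1 / u) hX0.le
    have h2 := abs_integral_besselInt_mul_cos_le hD ha hX0 hRX
    rw [hX] at h1 h2
    have h3 : |1 - a ^ 2| = u * (1 + a) := by
      rw [show 1 - a ^ 2 = (1 - a) * (1 + a) by ring, abs_mul, ← hu, abs_of_pos (by linarith : 0 < 1 + a)]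
    have h4 : u ≤ 1 + a := by
      rw [hu, abs_le]
      constructor <;> linarith
    have hua : 0 < u * (1 + a) := by positivity
    have h5 : |∫ x in (1 / u)..R, besselInt n x * Real.cos (a * x)| ≤ 2 * D * (2 + n ^ 2) / √u := by
      rw [h3] at h2
      have h6 : 2 * D / (1 / √u) * (2 + a + n ^ 2 / (1 / u)) ≤
          u * (1 + a) * (2 * D * (2 + n ^ 2) / √u) := by
        have e1 : u * (1 + a) * (2 * D * (2 + n ^ 2) / √u) =
            2 * D * √u * ((1 + a) * (2 + n ^ 2)) := by
          have := Real.mul_self_sqrt hu0.le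
          rw [mul_div_assoc', div_eq_iff hsu.ne']
          linear_combination -2 * D * (1 + a) * (2 + (n : ℝ) ^ 2) * this
        rw [e1]
        have e2 : 2 * D / (1 / √u) * (2 + a + n ^ 2 / (1 / u)) =
            2 * D * √u * (2 + a + n ^ 2 * u) := by field_simp
        rw [e2]
        gcongr
        nlinarith [mul_le_mul_of_nonneg_left h4 (sq_nonneg (n : ℝ))]
      exact le_of_mul_le_mul_left (h2.trans h6) hua
    rw [← intervalIntegral.integral_add_adjacent_intervals
      (intervalIntegrable_besselInt_mul_cos n a 0 (1 / u))
      (intervalIntegrable_besselInt_mul_cos n a (1 / u) R)]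
    refine (abs_add_le _ _).trans ((add_le_add h1 h5).trans (le_of_eq ?_))
    ring

/-! ### Abel summation and the Laplace transform -/

/-- Abel's theorem for improper integrals. -/
lemma tendsto_laplace_of_tendsto_integral {f : ℝ → ℝ} (hf : Continuous f) (hf1 : ∀ x, |f x| ≤ 1)
    {M L : ℝ} (hM : ∀ R : ℝ, 0 ≤ R → |∫ x in (0 : ℝ)..R, f x| ≤ M)
    (hL : Tendsto (fun R : ℝ => ∫ x in (0 : ℝ)..R, f x) atTop (𝓝 L)) :
    Tendsto (fun ε : ℝ => ∫ x in Set.Ioi (0 : ℝ), Real.exp (-(ε * x)) * f x) (𝓝[>] 0) (𝓝 L) := by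
  set G : ℝ → ℝ := fun R => ∫ x in (0 : ℝ)..R, f x with hG
  have hGd : ∀ x, HasDerivAt G (f x) x := fun x =>
    intervalIntegral.integral_hasDerivAt_right (hf.intervalIntegrable _ _)
      hf.stronglyMeasurable.stronglyMeasurableAtFilter hf.continuousAt
  have hGc : Continuous G := continuous_iff_continuousAt.mpr fun x => (hGd x).continuousAt
  have hexp : ∀ ε : ℝ, 0 < ε → IntegrableOn (fun x : ℝ => Real.exp (-(ε * x))) (Set.Ioi 0) := by
    intro ε hε
    simpa only [neg_mul] using exp_neg_integrableOn_Ioi 0 hε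
  -- Integration by parts passes to the bounded primitive `G`, and the scaling `u = εx` fixes the
  -- weight `e^{-u}`; then `M e^{-u}` dominates for every ε.
  have key : ∀ ε : ℝ, 0 < ε → ∫ x in Set.Ioi (0 : ℝ), Real.exp (-(ε * x)) * f x =
      ∫ u in Set.Ioi (0 : ℝ), Real.exp (-u) * G (ε⁻¹ * u) := by
    intro ε hε
    have i1 : IntegrableOn (fun x => Real.exp (-(ε * x)) * f x) (Set.Ioi 0) := by
      refine (hexp ε hε).mono' (by fun_prop : Continuous _).aestronglyMeasurable
        (ae_of_all _ fun x => ?_)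
      rw [norm_mul, Real.norm_of_nonneg (Real.exp_pos _).le]
      exact mul_le_of_le_one_right (Real.exp_pos _).le (hf1 x)
    have i2 : IntegrableOn (fun x => ε * (Real.exp (-(ε * x)) * G x)) (Set.Ioi 0) := by
      refine Integrable.const_mul ?_ _
      refine ((hexp ε hε).mul_const M).mono' (by fun_prop : Continuous _).aestronglyMeasurable
        ((ae_restrict_mem measurableSet_Ioi).mono fun x hx => ?_)
      rw [norm_mul, Real.norm_of_nonneg (Real.exp_pos _).le]
      gcongr
      exact hM x (le_of_lt hx)
    have hd : ∀ x ∈ Set.Ioi (0 : ℝ), HasDerivAt (fun x => Real.exp (-(ε * x)) * G x)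
        (Real.exp (-(ε * x)) * f x - ε * (Real.exp (-(ε * x)) * G x)) x := by
      intro x _
      refine ((((hasDerivAt_id x).const_mul ε).neg.exp).mul (hGd x)).congr_deriv ?_
      simp only [id, Pi.neg_apply]
      ring
    have hlim : Tendsto (fun x => Real.exp (-(ε * x)) * G x) atTop (𝓝 (0 * L)) := by
      refine Tendsto.mul ?_ hL
      exact Real.tendsto_exp_neg_atTop_nhds_zero.comp (tendsto_id.const_mul_atTop hε)
    have h := integral_Ioi_of_hasDerivAt_of_tendsto
      (by fun_prop : Continuous fun x => Real.exp (-(ε * x)) * G x).continuousWithinAt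
      hd (i1.sub i2) hlim
    rw [integral_sub i1 i2] at h
    have hG0 : G 0 = 0 := by simp [hG]
    rw [hG0, mul_zero, zero_mul, sub_zero, sub_eq_zero, integral_const_mul] at h
    have hsub := integral_comp_mul_left_Ioi (fun u => Real.exp (-u) * G (ε⁻¹ * u)) 0 hε
    rw [mul_zero] at hsub
    simp only [inv_mul_cancel_left₀ hε.ne', smul_eq_mul] at hsub
    rw [h, hsub, mul_inv_cancel_left₀ hε.ne']
  have hdct : Tendsto (fun ε : ℝ => ∫ u in Set.Ioi (0 : ℝ), Real.exp (-u) * G (ε⁻¹ * u)) (𝓝[>] 0)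
      (𝓝 (∫ u in Set.Ioi (0 : ℝ), Real.exp (-u) * L)) := by
    refine tendsto_integral_filter_of_dominated_convergence (fun u => Real.exp (-u) * M) ?_ ?_ ?_ ?_
    · exact Eventually.of_forall fun ε => (by fun_prop : Continuous _).aestronglyMeasurable
    · filter_upwards [self_mem_nhdsWithin] with ε hε
      have hε' : (0 : ℝ) < ε := hε
      refine (ae_restrict_mem measurableSet_Ioi).mono fun u hu => ?_
      have hu' : (0 : ℝ) < u := hu
      rw [norm_mul, Real.norm_of_nonneg (Real.exp_pos _).le]
      gcongr
      exact hM _ (by positivity)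
    · exact integrableOn_exp_neg_Ioi_zero.mul_const M
    · refine (ae_restrict_mem measurableSet_Ioi).mono fun u hu => ?_
      refine Tendsto.const_mul _ (hL.comp ?_)
      exact tendsto_inv_nhdsGT_zero.atTop_mul_const hu
  rw [integral_mul_const, integral_exp_neg_Ioi_zero, one_mul] at hdct
  refine hdct.congr' ?_
  filter_upwards [self_mem_nhdsWithin] with ε hε
  exact (key ε hε).symm

open Complex in
lemma integral_cexp_int (c : ℤ) :
    ∫ θ in (-Real.pi)..Real.pi, cexp (I * c * θ) = if c = 0 then (2 * Real.pi : ℂ) else 0 := by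
  split_ifs with h
  · subst h
    simp
    ring
  · rw [integral_cexp_I_mul (by exact_mod_cast h), mul_comm (Real.pi : ℂ), Complex.sin_int_mul_pi]
    simp

open Complex in
lemma hasSum_integral_geometric {q : ℂ} (hq : ‖q‖ < 1) (c : ℕ → ℤ) {f : ℝ → ℂ}
    (hf : ∀ θ : ℝ, HasSum (fun m : ℕ => q ^ m * cexp (I * c m * θ)) (f θ)) :
    HasSum (fun m : ℕ => q ^ m * if c m = 0 then (2 * Real.pi : ℂ) else 0)
      (∫ θ in (-Real.pi)..Real.pi, f θ) := by
  have key := intervalIntegral.hasSum_integral_of_dominated_convergence (μ := volume)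
    (a := -Real.pi) (b := Real.pi)
    (F := fun (m : ℕ) (θ : ℝ) => q ^ m * cexp (I * c m * θ)) (f := f)
    (fun m _ => ‖q‖ ^ m) ?_ ?_ ?_ ?_ ?_
  · simpa only [intervalIntegral.integral_const_mul, integral_cexp_int] using key
  · intro m
    exact (by fun_prop : Continuous _).aestronglyMeasurable
  · intro m
    refine ae_of_all _ fun θ _ => le_of_eq ?_
    rw [norm_mul, norm_pow, show I * c m * (θ : ℂ) = ((c m * θ : ℝ) : ℂ) * I by push_cast; ring,
      Complex.norm_exp_ofReal_mul_I, mul_one]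
  · exact ae_of_all _ fun θ _ => summable_geometric_of_lt_one (norm_nonneg _) hq
  · exact intervalIntegrable_const
  · exact ae_of_all _ fun θ _ => hf θ

open Complex in
-- With `q² + 2pq = 1` the denominator factors as `(1 + q e^{-iθ})(1 - q e^{iθ})/(2q)`. Partial
-- fractions give two geometric series: against `e^{-inθ}` the first contains only negative
-- frequencies, and the second has frequency 0 only at `m = n`.
lemma integral_poisson {n : ℕ} (hn : n ≠ 0) {p q : ℂ} (hq : ‖q‖ < 1) (hpq : q * (q + 2 * p) = 1) :
    ∫ θ in (-Real.pi)..Real.pi, cexp (-(I * n * θ)) * (p - I * sin θ)⁻¹ =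
      2 * q / (1 + q ^ 2) * (2 * Real.pi * q ^ n) := by
  have hq0 : q ≠ 0 := by
    rintro rfl
    simp at hpq
  have hq2 : 1 + q ^ 2 ≠ 0 := by
    intro h
    have h1 : ‖q ^ 2‖ = 1 := by rw [eq_neg_of_add_eq_zero_right h]; simp
    rw [norm_pow] at h1
    nlinarith [norm_nonneg q]
  have hnorm : ∀ θ : ℝ, ‖cexp (I * θ)‖ = 1 := fun θ => by
    rw [mul_comm]; exact Complex.norm_exp_ofReal_mul_I θ
  have hnorm' : ∀ θ : ℝ, ‖cexp (-(I * θ))‖ = 1 := fun θ => by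
    rw [Complex.exp_neg, norm_inv, hnorm, inv_one]
  have n1 : ∀ θ : ℝ, 1 - -q * cexp (-(I * θ)) ≠ 0 := fun θ h => by
    have := congrArg norm (sub_eq_zero.mp h)
    rw [norm_mul, norm_neg, hnorm', mul_one, norm_one] at this
    linarith
  have n2 : ∀ θ : ℝ, 1 - q * cexp (I * θ) ≠ 0 := fun θ h => by
    have := congrArg norm (sub_eq_zero.mp h)
    rw [norm_mul, hnorm, mul_one, norm_one] at this
    linarith
  have s1 : ∫ θ in (-Real.pi)..Real.pi, cexp (-(I * n * θ)) * (1 - -q * cexp (-(I * θ)))⁻¹ = 0 := by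
    refine (hasSum_integral_geometric (q := -q) (by rwa [norm_neg]) (fun m => -((m : ℤ) + n))
      fun θ => ?_).unique ?_
    · have := (hasSum_geometric_of_norm_lt_one (ξ := -q * cexp (-(I * θ)))
        (by rwa [norm_mul, norm_neg, hnorm', mul_one])).mul_left (cexp (-(I * n * θ)))
      refine this.congr_fun fun m => ?_
      rw [mul_pow, ← Complex.exp_nat_mul, mul_left_comm, ← Complex.exp_add]
      congr 2
      push_cast
      ring
    · convert hasSum_zero with m
      have : -((m : ℤ) + n) ≠ 0 := by omega
      rw [if_neg this, mul_zero]
  have s2 : ∫ θ in (-Real.pi)..Real.pi, cexp (-(I * n * θ)) * (1 - q * cexp (I * θ))⁻¹ =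
      2 * Real.pi * q ^ n := by
    refine (hasSum_integral_geometric hq (fun m => (m : ℤ) - n)
      fun θ => ?_).unique ?_
    · have := (hasSum_geometric_of_norm_lt_one (ξ := q * cexp (I * θ))
        (by rwa [norm_mul, hnorm, mul_one])).mul_left (cexp (-(I * n * θ)))
      refine this.congr_fun fun m => ?_
      rw [mul_pow, ← Complex.exp_nat_mul, mul_left_comm, ← Complex.exp_add]
      congr 2
      push_cast
      ring
    · have := hasSum_single (f := fun m : ℕ => q ^ m * if (m : ℤ) - n = 0 then (2 * Real.pi : ℂ) else 0)
        n (fun m hm => by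
          have : (m : ℤ) - n ≠ 0 := by omega
          rw [if_neg this, mul_zero])
      simp only [sub_self, if_true] at this
      rwa [mul_comm (q ^ n)] at this
  have s3 : ∫ θ in (-Real.pi)..Real.pi, cexp (-(I * n * θ)) = 0 := by
    have := integral_cexp_int (-n)
    rw [if_neg (by omega)] at this
    rw [← this]
    congr 1
    ext θ
    push_cast
    congr 1
    ring
  have hpt : ∀ θ : ℝ, cexp (-(I * n * θ)) * (p - I * sin θ)⁻¹ = 2 * q / (1 + q ^ 2) *
      (cexp (-(I * n * θ)) * (1 - -q * cexp (-(I * θ)))⁻¹ +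
        cexp (-(I * n * θ)) * (1 - q * cexp (I * θ))⁻¹ - cexp (-(I * n * θ))) := by
    intro θ
    have m1 := n1 θ
    have m2 := n2 θ
    have hw : cexp (I * θ) * cexp (-(I * θ)) = 1 := by rw [← Complex.exp_add]; simp
    have hs : I * sin θ = (cexp (I * θ) - cexp (-(I * θ))) / 2 := by
      rw [Complex.sin, show (-(θ : ℂ)) * I = -(I * θ) by ring, mul_comm (θ : ℂ) I]
      linear_combination -(cexp (I * θ) - cexp (-(I * θ))) / 2 * I_sq
    rw [hs]
    generalize cexp (I * θ) = W at *
    generalize cexp (-(I * θ)) = V at *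
    generalize cexp (-(I * n * θ)) = Z at *
    have hden : p - (W - V) / 2 = (1 - -q * V) * (1 - q * W) / (2 * q) := by
      field_simp
      linear_combination hpq + q ^ 2 * hw
    rw [hden]
    simp only [neg_mul, sub_neg_eq_add] at m1 ⊢
    field_simp
    linear_combination -Z * q ^ 2 * hw
  have c1 : Continuous fun θ : ℝ => cexp (-(I * n * θ)) * (1 - -q * cexp (-(I * θ)))⁻¹ :=
    Continuous.mul (by fun_prop) (Continuous.inv₀ (by fun_prop) n1)
  have c2 : Continuous fun θ : ℝ => cexp (-(I * n * θ)) * (1 - q * cexp (I * θ))⁻¹ :=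
    Continuous.mul (by fun_prop) (Continuous.inv₀ (by fun_prop) n2)
  have c12 : Continuous fun θ : ℝ => cexp (-(I * n * θ)) * (1 - -q * cexp (-(I * θ)))⁻¹ +
      cexp (-(I * n * θ)) * (1 - q * cexp (I * θ))⁻¹ := c1.add c2
  have c3 : Continuous fun θ : ℝ => cexp (-(I * n * θ)) := by fun_prop
  simp only [hpt]
  rw [intervalIntegral.integral_const_mul, intervalIntegral.integral_sub
    (c12.intervalIntegrable _ _) (c3.intervalIntegrable _ _),
    intervalIntegral.integral_add (c1.intervalIntegrable _ _) (c2.intervalIntegrable _ _),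
    s1, s2, s3]
  ring

-- Fubini applied to Bessel's integral. Writing the answer through `q`, a root of modulus below 1,
-- postpones the choice of a branch of `√(1 + p²)`.
open Complex in
lemma laplace_besselInt {n : ℕ} (hn : n ≠ 0) {p q : ℂ} (hp : 0 < p.re) (hq : ‖q‖ < 1)
    (hpq : q * (q + 2 * p) = 1) :
    ∫ x in Set.Ioi (0 : ℝ), cexp (-(p * x)) * besselInt n x = 2 * q / (1 + q ^ 2) * q ^ n := by
  have hpi : (Real.pi : ℂ) ≠ 0 := by exact_mod_cast Real.pi_ne_zero
  have hexp : IntegrableOn (fun x : ℝ => Real.exp (-(p.re * x))) (Set.Ioi 0) := by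
    simpa only [neg_mul] using exp_neg_integrableOn_Ioi 0 hp
  have hswap := intervalIntegral_integral_swap (a := -Real.pi) (b := Real.pi)
    (μ := volume.restrict (Set.Ioi (0 : ℝ)))
    (f := fun (θ x : ℝ) => cexp (-(p * x)) * cexp (I * (x * sin θ - n * θ))) (by
      have hc : Integrable (fun _ : ℝ => (1 : ℝ)) (volume.restrict (Set.uIoc (-Real.pi) Real.pi)) :=
        (intervalIntegrable_const (c := (1 : ℝ))).def'
      refine (hc.mul_prod hexp).mono' ?_ (ae_of_all _ fun z => ?_)
      · exact (by fun_prop : Continuous _).aestronglyMeasurable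
      · simp only [Function.uncurry]
        rw [norm_mul, Complex.norm_exp,
          show I * (z.2 * sin z.1 - n * z.1) = ((z.2 * Real.sin z.1 - n * z.1 : ℝ) : ℂ) * I by
            push_cast; ring, Complex.norm_exp_ofReal_mul_I]
        simp)
  have hinner : ∀ θ : ℝ, ∫ x in Set.Ioi (0 : ℝ), cexp (-(p * x)) * cexp (I * (x * sin θ - n * θ)) =
      cexp (-(I * n * θ)) * (p - I * sin θ)⁻¹ := by
    intro θ
    have hre : (-(p - I * sin θ)).re < 0 := by
      rw [← ofReal_sin]
      simp [-ofReal_sin]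
      exact hp
    have h := integral_exp_mul_complex_Ioi hre 0
    have e : ∀ x : ℝ, cexp (-(p * x)) * cexp (I * (x * sin θ - n * θ)) =
        cexp (-(I * n * θ)) * cexp (-(p - I * sin θ) * x) := by
      intro x
      rw [← Complex.exp_add, ← Complex.exp_add]
      congr 1
      ring
    simp only [e]
    rw [integral_const_mul, h]
    simp
    rw [neg_div, ← div_neg, neg_sub, one_div]
  have e2 : ∀ x : ℝ, cexp (-(p * x)) * (besselInt n x : ℂ) = 1 / (2 * Real.pi) *
      ∫ θ in (-Real.pi)..Real.pi, cexp (-(p * x)) * cexp (I * (x * sin θ - n * θ)) := by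
    intro x
    rw [besselInt_eq_cexp, intervalIntegral.integral_const_mul]
    ring
  simp only [e2]
  rw [integral_const_mul, ← hswap]
  simp only [hinner]
  rw [integral_poisson hn hq hpq]
  field_simp

/-- The branch of the square root on the closed upper half plane with values in the closed first
quadrant. -/
def upperSqrt (ζ : ℂ) : ℂ :=
  (√((‖ζ‖ + ζ.re) / 2) : ℝ) + (√((‖ζ‖ - ζ.re) / 2) : ℝ) * Complex.I

/-- For `a > 1` the argument `1 + (ε + ia)²` tends to the negative number `1 - a²` as `ε → 0⁺`, so
continuity at the negative axis is essential. -/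
lemma continuous_upperSqrt : Continuous upperSqrt := by
  unfold upperSqrt
  have := Complex.continuous_re
  fun_prop

lemma sqrt_mul_sqrt_of_im_nonneg {ζ : ℂ} (h : 0 ≤ ζ.im) :
    √((‖ζ‖ + ζ.re) / 2) * √((‖ζ‖ - ζ.re) / 2) = ζ.im / 2 := by
  have h1 : 0 ≤ (‖ζ‖ + ζ.re) / 2 := by
    have := neg_le_of_abs_le (Complex.abs_re_le_norm ζ)
    linarith
  rw [← Real.sqrt_mul h1]
  have h2 : (‖ζ‖ + ζ.re) / 2 * ((‖ζ‖ - ζ.re) / 2) = (ζ.im / 2) ^ 2 := by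
    have h3 := Complex.sq_norm ζ
    rw [Complex.normSq_apply] at h3
    linear_combination 1 / 4 * h3
  rw [h2, Real.sqrt_sq (by linarith)]

lemma upperSqrt_sq {ζ : ℂ} (h : 0 ≤ ζ.im) : upperSqrt ζ ^ 2 = ζ := by
  have hs := sqrt_mul_sqrt_of_im_nonneg h
  have h1 : 0 ≤ (‖ζ‖ + ζ.re) / 2 := by
    have := neg_le_of_abs_le (Complex.abs_re_le_norm ζ)
    linarith
  have h2 : 0 ≤ (‖ζ‖ - ζ.re) / 2 := by
    have := Complex.re_le_norm ζ
    linarith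
  have e1 := Real.mul_self_sqrt h1
  have e2 := Real.mul_self_sqrt h2
  rw [upperSqrt]
  generalize √((‖ζ‖ + ζ.re) / 2) = σ at *
  generalize √((‖ζ‖ - ζ.re) / 2) = τ at *
  apply Complex.ext
  · simp [sq]
    linarith
  · simp [sq]
    linarith

-- For `s = √(1 + p²)` one has `(s - p)(s + p) = 1`. Both `s` and `p` lie in the first quadrant,
-- hence `|s - p| < |s + p|` and the first factor is the smaller one.
open Complex in
lemma norm_upperSqrt_sub_lt_one {ε a : ℝ} (hε : 0 < ε) (ha : 0 < a) :
    ‖upperSqrt (1 + (ε + a * I) ^ 2) - (ε + a * I)‖ < 1 := by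
  set p : ℂ := ε + a * I with hp
  have him : (1 + p ^ 2).im = 2 * (ε * a) := by
    rw [hp]; simp [sq]; ring
  have hpos : 0 < (1 + p ^ 2).im := by rw [him]; positivity
  have hsq := upperSqrt_sq hpos.le
  have hprod := sqrt_mul_sqrt_of_im_nonneg hpos.le
  set s := upperSqrt (1 + p ^ 2) with hs
  have hre : s.re = √((‖1 + p ^ 2‖ + (1 + p ^ 2).re) / 2) := by
    simp [hs, upperSqrt]
  have him' : s.im = √((‖1 + p ^ 2‖ - (1 + p ^ 2).re) / 2) := by
    simp [hs, upperSqrt]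
  rw [← hre, ← him'] at hprod
  have hre0 : 0 ≤ s.re := by rw [hre]; exact Real.sqrt_nonneg _
  have him0 : 0 ≤ s.im := by rw [him']; exact Real.sqrt_nonneg _
  have hp0 : 0 < s.re * s.im := by rw [hprod]; linarith
  have hre1 : 0 < s.re := lt_of_le_of_ne hre0 (by rintro h; rw [← h] at hp0; simp at hp0)
  have hmul : ‖s - p‖ * ‖s + p‖ = 1 := by
    rw [← norm_mul, show (s - p) * (s + p) = 1 by linear_combination hsq, norm_one]
  have hlt : ‖s - p‖ ^ 2 < ‖s + p‖ ^ 2 := by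
    rw [Complex.sq_norm, Complex.sq_norm, Complex.normSq_apply, Complex.normSq_apply]
    have e1 : p.re = ε := by simp [hp]
    have e2 : p.im = a := by simp [hp]
    simp only [sub_re, sub_im, add_re, add_im, e1, e2]
    nlinarith [mul_pos hre1 hε, mul_nonneg him0 ha.le]
  have hlt' : ‖s - p‖ < ‖s + p‖ := lt_of_pow_lt_pow_left₀ 2 (norm_nonneg _) hlt
  by_contra hcon
  rw [not_lt] at hcon
  nlinarith

open Complex in
lemma laplace_cos_besselInt {n : ℕ} (hn : n ≠ 0) {ε a : ℝ} (hε : 0 < ε) (ha : 0 < a) :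
    ∫ x in Set.Ioi (0 : ℝ), Real.exp (-(ε * x)) * (besselInt n x * Real.cos (a * x)) =
      ((upperSqrt (1 + (ε + a * I) ^ 2) - (ε + a * I)) ^ n /
        upperSqrt (1 + (ε + a * I) ^ 2)).re := by
  have hlt := norm_upperSqrt_sub_lt_one hε ha
  have him : 0 ≤ (1 + (ε + a * I : ℂ) ^ 2).im := by
    simp [sq]; positivity
  have hsq := upperSqrt_sq him
  have hre : (ε + a * I : ℂ).re = ε := by simp
  have hl := laplace_besselInt hn (p := ε + a * I) (by rw [hre]; exact hε) hlt
    (by linear_combination hsq)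
  have hexp : IntegrableOn (fun x : ℝ => Real.exp (-(ε * x))) (Set.Ioi 0) := by
    simpa only [neg_mul] using exp_neg_integrableOn_Ioi 0 hε
  have hc := continuous_besselInt n
  have hint : IntegrableOn (fun x : ℝ => cexp (-((ε + a * I) * x)) * besselInt n x) (Set.Ioi 0) := by
    refine hexp.mono' (by fun_prop : Continuous _).aestronglyMeasurable (ae_of_all _ fun x => ?_)
    rw [norm_mul, Complex.norm_exp, norm_real]
    have : (-((ε + a * I) * (x : ℂ))).re = -(ε * x) := by simp
    rw [this]
    exact mul_le_of_le_one_right (Real.exp_pos _).le (abs_besselInt_le_one n x)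
  have h2 : ∫ x in Set.Ioi (0 : ℝ), Real.exp (-(ε * x)) * (besselInt n x * Real.cos (a * x)) =
      (∫ x in Set.Ioi (0 : ℝ), cexp (-((ε + a * I) * x)) * besselInt n x).re := by
    have := Complex.reCLM.integral_comp_comm hint
    simp only [reCLM_apply] at this
    rw [← this]
    congr 1
    ext x
    rw [re_mul_ofReal, Complex.exp_re]
    have e1 : (-((ε + a * I) * (x : ℂ))).re = -(ε * x) := by simp
    have e2 : (-((ε + a * I) * (x : ℂ))).im = -(a * x) := by simp
    rw [e1, e2, Real.cos_neg]
    ring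
  rw [h2, hl]
  congr 1
  set s := upperSqrt (1 + (ε + a * I) ^ 2)
  set p : ℂ := ε + a * I
  have hmul : (s - p) * (s + p) = 1 := by linear_combination hsq
  have hq0 : s - p ≠ 0 := left_ne_zero_of_mul_eq_one hmul
  -- With `q = s - p` this turns `2q/(1 + q²)` into `1/s`.
  have h1q : 1 + (s - p) ^ 2 = 2 * s * (s - p) := by linear_combination -hmul
  rw [h1q]
  rw [show 2 * (s - p) / (2 * s * (s - p)) = 1 / s by
    rw [mul_comm 2 (s - p), show 2 * s * (s - p) = (s - p) * 2 * s by ring]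
    rw [div_mul_eq_div_div, div_self (mul_ne_zero hq0 two_ne_zero)]]
  ring

-- The limit in `R` is already known to exist, so Abel's theorem identifies it with the limit of the
-- Laplace transforms as `ε → 0⁺`.
open Complex in
lemma cosTransform_tendsto_upperSqrt {n : ℕ} (hn : n ≠ 0) {a : ℝ} (ha : 0 < a) (ha1 : a ≠ 1) :
    Tendsto (fun R => cosTransform n R a) atTop
      (𝓝 (((upperSqrt (1 + (a * I) ^ 2) - a * I) ^ n / upperSqrt (1 + (a * I) ^ 2)).re)) := by
  obtain ⟨L, hL⟩ := cosTransform_tendsto n ha.le ha1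
  obtain ⟨C, hC0, hC⟩ := abs_cosTransform_le n
  have hc := continuous_besselInt n
  have h1 := tendsto_laplace_of_tendsto_integral (f := fun x => besselInt n x * Real.cos (a * x))
    (by fun_prop) (fun x => by
      rw [abs_mul]
      exact mul_le_one₀ (abs_besselInt_le_one n x) (abs_nonneg _) (Real.abs_cos_le_one _))
    (fun R hR => hC R a hR ha.le ha1) hL
  have hs0 : upperSqrt (1 + (a * I) ^ 2) ≠ 0 := by
    intro h
    have h2 := upperSqrt_sq (ζ := 1 + (a * I) ^ 2) (by simp [sq])
    rw [h] at h2
    have h3 : ((1 - a ^ 2 : ℝ) : ℂ) = 0 := by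
      push_cast
      linear_combination -h2 - a ^ 2 * I_sq
    have h4 : 1 - a ^ 2 = 0 := by exact_mod_cast h3
    have : (1 - a) * (1 + a) = 0 := by linear_combination h4
    rcases mul_eq_zero.mp this with h | h
    · exact ha1 (by linarith)
    · linarith
  have hcont : ContinuousAt (fun ε : ℝ => ((upperSqrt (1 + (ε + a * I) ^ 2) - (ε + a * I)) ^ n /
        upperSqrt (1 + (ε + a * I) ^ 2)).re) 0 := by
    have h2 : Continuous fun ε : ℝ => upperSqrt (1 + (ε + a * I) ^ 2) :=
      continuous_upperSqrt.comp (by fun_prop)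
    refine Complex.continuous_re.continuousAt.comp ?_
    refine ContinuousAt.div (by fun_prop) h2.continuousAt ?_
    simpa using hs0
  have h2 := hcont.tendsto.mono_left (nhdsWithin_le_nhds (s := Set.Ioi 0))
  have h3 : L = _ := tendsto_nhds_unique h1 (h2.congr' (by
    filter_upwards [self_mem_nhdsWithin] with ε hε
    exact (laplace_cos_besselInt hn hε ha).symm))
  rw [h3] at hL
  simpa using hL

/-- The cosine transform of the Bessel function of order `2 k - 1`. -/
def cosLimit (k : ℕ) (a : ℝ) : ℝ :=
  if a < 1 then Real.cos ((2 * (k : ℝ) - 1) * Real.arcsin a) / √(1 - a ^ 2)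
  else (-1) ^ k * (1 / (√(a ^ 2 - 1) * (a + √(a ^ 2 - 1)) ^ (2 * k - 1)))

-- For `a < 1` the base `√(1 - a²) - ia` is `e^{-i arcsin a}`. For `a > 1`, with `τ = √(a² - 1)`,
-- the base is `-i/(a + τ)` and the denominator `iτ`; the odd power of `-i` divided by `i` produces
-- the sign `(-1)^k`.
open Complex in
lemma cosTransform_tendsto_cosLimit {k : ℕ} (hk : 1 ≤ k) {a : ℝ} (ha : 0 < a) (ha1 : a ≠ 1) :
    Tendsto (fun R => cosTransform (2 * k - 1) R a) atTop (𝓝 (cosLimit k a)) := by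
  have h := cosTransform_tendsto_upperSqrt (n := 2 * k - 1) (by omega) ha ha1
  convert h using 2
  have hζ : (1 + (a * I) ^ 2 : ℂ) = ((1 - a ^ 2 : ℝ) : ℂ) := by
    push_cast
    linear_combination a ^ 2 * I_sq
  rw [hζ, cosLimit, upperSqrt, norm_real, Real.norm_eq_abs, ofReal_re]
  split_ifs with h1
  · have h2 : 0 ≤ 1 - a ^ 2 := by nlinarith
    rw [abs_of_nonneg h2, add_self_div_two, sub_self, zero_div, Real.sqrt_zero, ofReal_zero,
      zero_mul, add_zero]
    have h3 : ((√(1 - a ^ 2) : ℝ) : ℂ) - a * I = cexp (((-Real.arcsin a : ℝ) : ℂ) * I) := by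
      rw [Complex.exp_mul_I, ← ofReal_cos, ← ofReal_sin, Real.cos_neg, Real.sin_neg,
        Real.cos_arcsin, Real.sin_arcsin (by linarith) h1.le]
      push_cast
      ring
    have h4 : ((2 * k - 1 : ℕ) : ℝ) = 2 * (k : ℝ) - 1 := by
      rw [Nat.cast_sub (by omega)]; push_cast; ring
    rw [h3, ← Complex.exp_nat_mul, div_ofReal_re]
    congr 1
    rw [show ((2 * k - 1 : ℕ) : ℂ) * (((-Real.arcsin a : ℝ) : ℂ) * I) =
      ((((2 * k - 1 : ℕ) : ℝ) * -Real.arcsin a : ℝ) : ℂ) * I by push_cast; ring,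
      Complex.exp_ofReal_mul_I_re, h4, mul_neg, Real.cos_neg]
  · have h1' : 1 < a := lt_of_le_of_ne (not_lt.mp h1) (Ne.symm ha1)
    have h2 : 0 < a ^ 2 - 1 := by nlinarith
    rw [abs_of_neg (by linarith), show (-(1 - a ^ 2) + (1 - a ^ 2)) / 2 = 0 by ring,
      show (-(1 - a ^ 2) - (1 - a ^ 2)) / 2 = a ^ 2 - 1 by ring, Real.sqrt_zero, ofReal_zero,
      zero_add]
    have hτ := Real.sqrt_pos.mpr h2
    have hτ2 := Real.sq_sqrt h2.le
    set τ := √(a ^ 2 - 1)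
    obtain ⟨m, rfl⟩ : ∃ m, k = m + 1 := ⟨k - 1, by omega⟩
    rw [show 2 * (m + 1) - 1 = 2 * m + 1 by omega]
    have hu : 0 < a + τ := by linarith
    have hu' : ((a + τ : ℝ) : ℂ) ≠ 0 := by exact_mod_cast hu.ne'
    have hτ' : (τ : ℂ) ≠ 0 := by exact_mod_cast hτ.ne'
    have hq : (τ : ℂ) * I - a * I = -I / ((a + τ : ℝ) : ℂ) := by
      rw [eq_div_iff hu']
      have : (τ : ℂ) ^ 2 = a ^ 2 - 1 := by exact_mod_cast hτ2
      push_cast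
      linear_combination I * this
    have e1 : (-I) ^ (2 * m + 1) = (-1) ^ m * -I := by
      rw [pow_succ, pow_mul, neg_sq, I_sq]
    have e2 : (-I / ((a + τ : ℝ) : ℂ)) ^ (2 * m + 1) / (τ * I) =
        (((-1) ^ (m + 1) * (1 / (τ * (a + τ) ^ (2 * m + 1))) : ℝ) : ℂ) := by
      rw [div_pow, e1, ofReal_mul, ofReal_div, ofReal_mul, ofReal_pow, ofReal_pow, ofReal_one,
        ofReal_neg, ofReal_one, pow_succ (-1 : ℂ) m]
      have := I_ne_zero
      field_simp
    rw [hq, e2, ofReal_re]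

/-! ### Integrable majorants and the substitution `y = cosh ξ` -/

/-- Equivalent to `√(u + v) ≤ √u + √v`; it separates two endpoint singularities whose arguments have
a constant sum. -/
lemma one_div_sqrt_mul_sqrt_le {u v : ℝ} (hu : 0 < u) (hv : 0 < v) :
    1 / (√u * √v) ≤ (1 / √u + 1 / √v) / √(u + v) := by
  have h1 := Real.sqrt_pos.mpr hu
  have h2 := Real.sqrt_pos.mpr hv
  have h3 := Real.sqrt_pos.mpr (add_pos hu hv)
  have h4 : √(u + v) ≤ √u + √v := by
    rw [Real.sqrt_le_left (by positivity)]
    nlinarith [Real.sq_sqrt hu.le, Real.sq_sqrt hv.le]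
  rw [le_div_iff₀ h3, show 1 / √u + 1 / √v = (√u + √v) / (√u * √v) by field_simp; ring,
    one_div_mul_eq_div]
  gcongr

/-- An integrable majorant of `√b / (√(b - y) √(y² - 1))` on `(1, b)`. -/
def leftMajorant (b y : ℝ) : ℝ :=
  √(b / (b - 1)) * ((1 / √(b - y) + 1 / √(y - 1)) / √(b + 1) + (√(y ^ 2 - 1))⁻¹)

lemma le_leftMajorant {b y : ℝ} (hy : 1 < y) (hyb : y < b) :
    √b / (√(b - y) * √(y ^ 2 - 1)) ≤ leftMajorant b y := by
  have hu : 0 < b - y := by linarith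
  have hv : 0 < y - 1 := by linarith
  have hw : 0 < y + 1 := by linarith
  have su := Real.sqrt_pos.mpr hu
  have sv := Real.sqrt_pos.mpr hv
  have sw := Real.sqrt_pos.mpr hw
  have sb1 : 0 < √(b - 1) := Real.sqrt_pos.mpr (by linarith)
  have h1 := one_div_sqrt_mul_sqrt_le hu hv
  have h2 := one_div_sqrt_mul_sqrt_le hu hw
  rw [show b - y + (y - 1) = b - 1 by ring] at h1
  rw [show b - y + (y + 1) = b + 1 by ring] at h2
  have h3 : 1 / √(y + 1) ≤ 1 / √(y - 1) := by
    gcongr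
    linarith
  have hfac : √(y ^ 2 - 1) = √(y - 1) * √(y + 1) := by
    rw [← Real.sqrt_mul hv.le]; congr 1; ring
  have h5 : 1 / (√(b - y) * √(y + 1)) ≤ (1 / √(b - y) + 1 / √(y - 1)) / √(b + 1) :=
    h2.trans (by gcongr)
  rw [leftMajorant, hfac, Real.sqrt_div (by linarith)]
  calc √b / (√(b - y) * (√(y - 1) * √(y + 1)))
      = √b / √(y + 1) * (1 / (√(b - y) * √(y - 1))) := by field_simp
    _ ≤ √b / √(y + 1) * ((1 / √(b - y) + 1 / √(y - 1)) / √(b - 1)) := by gcongr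
    _ = √b / √(b - 1) * (1 / (√(b - y) * √(y + 1)) + (√(y - 1) * √(y + 1))⁻¹) := by
        field_simp
    _ ≤ √b / √(b - 1) * ((1 / √(b - y) + 1 / √(y - 1)) / √(b + 1) +
          (√(y - 1) * √(y + 1))⁻¹) :=
        mul_le_mul_of_nonneg_left (by linarith) (by positivity)

/-- Keeps the bound for `Q₀` uniform as `b → 1`: there `arcosh b ≤ √(b² - 1)` compensates `1/√(b -
1)`, while for `b ≥ 2` the growth is that of `log(2b)`. -/
lemma sqrt_mul_arcosh_le {b : ℝ} (hb : 1 < b) :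
    √(b / (b - 1)) * Real.arcosh b ≤ 3 + 2 * Real.log b := by
  have hlog : 0 < Real.log b := Real.log_pos hb
  have hb1 : 0 < b - 1 := by linarith
  rcases le_total b 2 with h | h
  · have h1 : Real.arcosh b ≤ √(b ^ 2 - 1) := by
      rw [← Real.sinh_arcosh hb.le]
      exact Real.self_le_sinh_iff.mpr (Real.arcosh_nonneg hb.le)
    have h2 : √(b / (b - 1)) * √(b ^ 2 - 1) ≤ 3 := by
      rw [← Real.sqrt_mul (by positivity), Real.sqrt_le_left (by norm_num)]
      have : b / (b - 1) * (b ^ 2 - 1) = b * (b + 1) := by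
        field_simp
        ring
      rw [this]
      nlinarith
    have h3 : √(b / (b - 1)) * Real.arcosh b ≤ √(b / (b - 1)) * √(b ^ 2 - 1) := by gcongr
    linarith
  · have h1 : √(b / (b - 1)) ≤ 2 := by
      rw [Real.sqrt_le_left (by norm_num), div_le_iff₀ hb1]
      linarith
    have h2 : Real.arcosh b ≤ 1 + Real.log b := by
      have h3 : √(b ^ 2 - 1) ≤ b := by
        rw [Real.sqrt_le_left (by linarith)]
        linarith
      have h4 : Real.arcosh b ≤ Real.log (2 * b) := by
        rw [Real.arcosh]
        refine Real.log_le_log (by positivity) ?_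
        linarith
      rw [Real.log_mul (by norm_num) (by linarith)] at h4
      have := Real.log_two_lt_d9
      linarith
    have h0 := Real.arcosh_nonneg hb.le
    nlinarith [Real.sqrt_nonneg (b / (b - 1))]

lemma leftMajorant_integral {b : ℝ} (hb : 1 < b) :
    IntervalIntegrable (leftMajorant b) volume 1 b ∧
      ∫ y in (1 : ℝ)..b, leftMajorant b y ≤ 7 + 2 * Real.log b := by
  have hb1 : 0 < b - 1 := by linarith
  obtain ⟨i0, v0⟩ := integral_inv_sqrt hb1.le
  have i1 : IntervalIntegrable (fun y : ℝ => 1 / √(b - y)) volume 1 b := by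
    have := (i0.comp_sub_left b).symm
    simpa using this
  have i2 : IntervalIntegrable (fun y : ℝ => 1 / √(y - 1)) volume 1 b := by
    have := i0.comp_sub_right 1
    simpa using this
  have v1 : ∫ y in (1 : ℝ)..b, 1 / √(b - y) = 2 * √(b - 1) := by
    rw [intervalIntegral.integral_comp_sub_left (fun x => 1 / √x) b, sub_self, v0]
  have v2 : ∫ y in (1 : ℝ)..b, 1 / √(y - 1) = 2 * √(b - 1) := by
    rw [intervalIntegral.integral_comp_sub_right (fun x => 1 / √x) 1, sub_self, v0]
  have hcont : ContinuousOn Real.arcosh (Set.Icc 1 b) :=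
    Real.continuousOn_arcosh.mono Set.Icc_subset_Ici_self
  have i3 : IntervalIntegrable (fun y : ℝ => (√(y ^ 2 - 1))⁻¹) volume 1 b := by
    rw [intervalIntegrable_iff_integrableOn_Ioc_of_le hb.le]
    exact intervalIntegral.integrableOn_deriv_of_nonneg hcont
      (fun x hx => Real.hasDerivAt_arcosh hx.1) (fun x _ => by positivity)
  have v3 : ∫ y in (1 : ℝ)..b, (√(y ^ 2 - 1))⁻¹ = Real.arcosh b := by
    rw [intervalIntegral.integral_eq_sub_of_hasDerivAt_of_le hb.le hcont
      (fun x hx => Real.hasDerivAt_arcosh hx.1) i3]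
    simp [Real.arcosh_zero]
  have i12 := (i1.add i2).div_const (√(b + 1))
  refine ⟨(i12.add i3).const_mul _, ?_⟩
  have hval : ∫ y in (1 : ℝ)..b, leftMajorant b y =
      √(b / (b - 1)) * ((2 * √(b - 1) + 2 * √(b - 1)) / √(b + 1) + Real.arcosh b) := by
    simp only [leftMajorant]
    rw [intervalIntegral.integral_const_mul, intervalIntegral.integral_add i12 i3,
      intervalIntegral.integral_div, intervalIntegral.integral_add i1 i2, v1, v2, v3]
  rw [hval, mul_add]
  have h1 : √(b / (b - 1)) * ((2 * √(b - 1) + 2 * √(b - 1)) / √(b + 1)) ≤ 4 := by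
    have sb1 := Real.sqrt_pos.mpr hb1
    have sb2 : 0 < √(b + 1) := Real.sqrt_pos.mpr (by linarith)
    have h2 : √b ≤ √(b + 1) := Real.sqrt_le_sqrt (by linarith)
    rw [Real.sqrt_div (by linarith), show √b / √(b - 1) *
      ((2 * √(b - 1) + 2 * √(b - 1)) / √(b + 1)) = 4 * √b / √(b + 1) by field_simp; ring,
      div_le_iff₀ sb2]
    linarith
  have := sqrt_mul_arcosh_le hb
  linarith

/-- Since `√(y² - 1) ≥ y - 1`, it suffices to integrate `1/(√(y - b)(y - 1))`, which has an
arctangent as primitive. -/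
lemma integrableOn_right_singularity {b : ℝ} (hb : 1 < b) :
    IntegrableOn (fun y : ℝ => √b / (√(y - b) * √(y ^ 2 - 1))) (Set.Ioi b) := by
  have hc : 0 < b - 1 := by linarith
  have sc := Real.sqrt_pos.mpr hc
  have sc2 := Real.mul_self_sqrt hc.le
  have hmaj : IntegrableOn (fun y : ℝ => 1 / (√(y - b) * (y - 1))) (Set.Ioi b) := by
    refine integrableOn_Ioi_deriv_of_nonneg
      (g := fun y => 2 / √(b - 1) * Real.arctan (√(y - b) / √(b - 1)))
      (l := 2 / √(b - 1) * (Real.pi / 2)) ?_ ?_ ?_ ?_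
    · exact (by fun_prop : Continuous _).continuousWithinAt
    · intro y hy
      have hy0 : 0 < y - b := sub_pos.mpr hy
      have sy := Real.sqrt_pos.mpr hy0
      have sy2 := Real.mul_self_sqrt hy0.le
      have h1 := ((((hasDerivAt_id y).sub_const b).sqrt hy0.ne').div_const
        (√(b - 1))).arctan.const_mul (2 / √(b - 1))
      refine h1.congr_deriv ?_
      simp only [id]
      have h2 : 1 + (√(y - b) / √(b - 1)) ^ 2 = (y - 1) / (b - 1) := by
        rw [div_pow, Real.sq_sqrt hy0.le, Real.sq_sqrt hc.le]
        field_simp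
        ring
      have hy1 : 0 < y - 1 := by linarith
      rw [h2]
      field_simp
      rw [sq, sc2]
    · intro y hy
      have hy0 : b < y := hy
      have : 0 < y - 1 := by linarith
      positivity
    · refine Tendsto.const_mul _ ?_
      have h1 : Tendsto (fun y : ℝ => √(y - b) / √(b - 1)) atTop atTop :=
        (Real.tendsto_sqrt_atTop.comp (tendsto_atTop_add_const_right atTop (-b) tendsto_id)).atTop_div_const sc
      exact (tendsto_nhds_of_tendsto_nhdsWithin Real.tendsto_arctan_atTop).comp h1
  refine (hmaj.const_mul (√b)).mono' ?_ ?_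
  · exact (Measurable.aestronglyMeasurable (by fun_prop))
  · refine (ae_restrict_mem measurableSet_Ioi).mono fun y hy => ?_
    have hy0 : b < y := hy
    have hy1 : 0 < y - 1 := by linarith
    have sy := Real.sqrt_pos.mpr (sub_pos.mpr hy0)
    have h1 : y - 1 ≤ √(y ^ 2 - 1) := Real.le_sqrt_of_sq_le (by nlinarith)
    rw [Real.norm_of_nonneg (by positivity), mul_one_div]
    gcongr

lemma integrableOn_left_singularity {b : ℝ} (hb : 1 < b) :
    IntegrableOn (fun y : ℝ => √b / (√(b - y) * √(y ^ 2 - 1))) (Set.Ioo 1 b) := by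
  have h := (leftMajorant_integral hb).1
  rw [intervalIntegrable_iff_integrableOn_Ioo_of_le hb.le] at h
  refine h.mono' (Measurable.aestronglyMeasurable (by fun_prop)) ?_
  refine (ae_restrict_mem measurableSet_Ioo).mono fun y hy => ?_
  rw [Real.norm_of_nonneg (by positivity)]
  exact le_leftMajorant hy.1 hy.2

lemma integrableOn_Ioi_of_split {b : ℝ} (hb : 1 < b) {f : ℝ → ℝ}
    (h1 : IntegrableOn f (Set.Ioo 1 b)) (h2 : IntegrableOn f (Set.Ioi b)) :
    IntegrableOn f (Set.Ioi 1) := by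
  rw [← Set.Ioc_union_Ioi_eq_Ioi hb.le]
  exact ((integrableOn_Ioc_iff_integrableOn_Ioo).mpr h1).union h2

lemma cosh_image_Ioi : Real.cosh '' Set.Ioi 0 = Set.Ioi 1 := by
  ext y
  constructor
  · rintro ⟨x, hx, rfl⟩
    exact Real.one_lt_cosh.mpr (ne_of_gt hx)
  · intro hy
    exact ⟨Real.arcosh y, Real.arcosh_pos hy, Real.cosh_arcosh (le_of_lt hy)⟩

lemma integral_cosh_substitution (g : ℝ → ℝ) :
    (IntegrableOn g (Set.Ioi 1) ↔
      IntegrableOn (fun ξ => Real.sinh ξ * g (Real.cosh ξ)) (Set.Ioi 0)) ∧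
    ∫ y in Set.Ioi 1, g y = ∫ ξ in Set.Ioi 0, Real.sinh ξ * g (Real.cosh ξ) := by
  have hd : ∀ x ∈ Set.Ioi (0 : ℝ), HasDerivWithinAt Real.cosh (Real.sinh x) (Set.Ioi 0) x :=
    fun x _ => (Real.hasDerivAt_cosh x).hasDerivWithinAt
  have hinj : Set.InjOn Real.cosh (Set.Ioi 0) := Real.cosh_injOn.mono Set.Ioi_subset_Ici_self
  have habs : ∀ ξ ∈ Set.Ioi (0 : ℝ), |Real.sinh ξ| • g (Real.cosh ξ) =
      Real.sinh ξ * g (Real.cosh ξ) := by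
    intro ξ hξ
    rw [abs_of_pos (Real.sinh_pos_iff.mpr hξ), smul_eq_mul]
  constructor
  · rw [← cosh_image_Ioi,
      integrableOn_image_iff_integrableOn_abs_deriv_smul measurableSet_Ioi hd hinj]
    exact integrableOn_congr_fun habs measurableSet_Ioi
  · rw [← cosh_image_Ioi, integral_image_eq_integral_abs_deriv_smul measurableSet_Ioi hd hinj]
    exact setIntegral_congr_fun measurableSet_Ioi habs

lemma sqrt_cosh_sq_sub_one {ξ : ℝ} (hξ : 0 < ξ) : √(Real.cosh ξ ^ 2 - 1) = Real.sinh ξ := by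
  rw [← Real.sinh_arcosh (Real.one_le_cosh ξ), Real.arcosh_cosh hξ.le]

/-- The majorant for dominated convergence in ξ: its only singularity, at `cosh ξ = b`, becomes the
two one-sided singularities at `y = b`. -/
lemma integrableOn_dominating {b : ℝ} (hb : 1 < b) :
    IntegrableOn (fun ξ : ℝ => 1 / √|1 - b⁻¹ * Real.cosh ξ|) (Set.Ioi 0) := by
  have hb0 : 0 < b := by linarith
  have sb := Real.sqrt_pos.mpr hb0
  have h : IntegrableOn (fun y : ℝ => 1 / (√|1 - b⁻¹ * y| * √(y ^ 2 - 1))) (Set.Ioi 1) := by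
    refine integrableOn_Ioi_of_split hb ?_ ?_
    · refine (integrableOn_left_singularity hb).congr_fun (fun y hy => ?_) measurableSet_Ioo
      have : |1 - b⁻¹ * y| = (b - y) / b := by
        have h1 : 0 < (b - y) / b := div_pos (by linarith [hy.2]) hb0
        rw [← abs_of_pos h1]; congr 1; field_simp
      simp only [this]
      rw [Real.sqrt_div' _ hb0.le]
      have : 0 < √(b - y) := Real.sqrt_pos.mpr (by linarith [hy.2])
      field_simp
    · refine (integrableOn_right_singularity hb).congr_fun (fun y hy => ?_) measurableSet_Ioi
      have hy' : b < y := hy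
      have : |1 - b⁻¹ * y| = (y - b) / b := by
        have h1 : 0 < (y - b) / b := div_pos (by linarith) hb0
        rw [abs_sub_comm, ← abs_of_pos h1]; congr 1; field_simp
      simp only [this]
      rw [Real.sqrt_div' _ hb0.le]
      have : 0 < √(y - b) := Real.sqrt_pos.mpr (by linarith)
      field_simp
  refine ((integral_cosh_substitution _).1.mp h).congr_fun (fun ξ hξ => ?_) measurableSet_Ioi
  have hs : 0 < Real.sinh ξ := Real.sinh_pos_iff.mpr hξ
  simp only [sqrt_cosh_sq_sub_one hξ]
  rw [mul_one_div, mul_comm (√_), div_mul_eq_div_div, div_self hs.ne']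

/-! ### Convergence and size of `Q₀` and `Q₁` -/

lemma sqrt_inv_sq {b : ℝ} (hb : 0 < b) : √((b ^ 2)⁻¹) = b⁻¹ := by
  rw [Real.sqrt_inv, Real.sqrt_sq hb.le]

lemma measurable_integrandQ₀ (k : ℕ) (t z : ℝ) : Measurable (integrandQ₀ k t z) := by
  have := Real.continuous_arcsin.measurable
  unfold integrandQ₀
  fun_prop

lemma measurable_integrandQ₁ (k : ℕ) (t z : ℝ) : Measurable (integrandQ₁ k t z) := by
  unfold integrandQ₁
  fun_prop

lemma abs_integrandQ₀_le {b : ℝ} (k : ℕ) (t : ℝ) {y : ℝ} (hy : 1 < y) (hyb : y ≤ b) :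
    |integrandQ₀ k t (b ^ 2)⁻¹ y| ≤ leftMajorant b y := by
  have hb : 1 < b := by linarith
  have hb0 : 0 < b := by linarith
  rcases hyb.lt_or_eq with h | h
  · have h1 : (b - y) / b ≤ 1 - (b ^ 2)⁻¹ * y ^ 2 := by
      have : 1 - (b ^ 2)⁻¹ * y ^ 2 - (b - y) / b = (b - y) * y / b ^ 2 := by
        field_simp
        ring
      have h2 : 0 ≤ (b - y) * y / b ^ 2 := by
        have : 0 < b - y := by linarith
        positivity
      linarith
    have h0 : 0 < (b - y) / b := div_pos (by linarith) hb0
    have s0 : 0 < √((b - y) / b) := Real.sqrt_pos.mpr h0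
    have s1 : 0 < √(y ^ 2 - 1) := Real.sqrt_pos.mpr (by nlinarith)
    have s2 : √((b - y) / b) ≤ √(1 - (b ^ 2)⁻¹ * y ^ 2) := Real.sqrt_le_sqrt h1
    refine le_trans ?_ (le_leftMajorant hy h)
    rw [integrandQ₀, abs_mul, abs_div, abs_of_nonneg (by positivity :
      0 ≤ √(1 - (b ^ 2)⁻¹ * y ^ 2) * √(y ^ 2 - 1))]
    calc _ ≤ 1 / (√((b - y) / b) * √(y ^ 2 - 1)) * 1 := by
          gcongr
          · exact Real.abs_cos_le_one _
          · exact Real.abs_cos_le_one _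
      _ = _ := by
          rw [Real.sqrt_div' _ hb0.le]
          have := Real.sqrt_pos.mpr hb0
          field_simp
  -- At the endpoint `y = b` the integrand is 0 by the convention for division by zero.
  · subst h
    have : integrandQ₀ k t (y ^ 2)⁻¹ y = 0 := by
      rw [integrandQ₀, inv_mul_cancel₀ (by positivity)]
      simp
    rw [this, abs_zero, leftMajorant]
    positivity

lemma intervalIntegrable_integrandQ₀ {b : ℝ} (hb : 1 < b) (k : ℕ) (t : ℝ) :
    IntervalIntegrable (integrandQ₀ k t (b ^ 2)⁻¹) volume 1 b := by
  have h := (leftMajorant_integral hb).1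
  rw [intervalIntegrable_iff_integrableOn_Ioc_of_le hb.le] at h ⊢
  refine h.mono' (measurable_integrandQ₀ _ _ _).aestronglyMeasurable ?_
  exact (ae_restrict_mem measurableSet_Ioc).mono fun y hy => abs_integrandQ₀_le k t hy.1 hy.2

lemma abs_integral_integrandQ₀_le {b : ℝ} (hb : 1 < b) (k : ℕ) (t : ℝ) :
    |∫ y in (1 : ℝ)..b, integrandQ₀ k t (b ^ 2)⁻¹ y| ≤ 7 + 2 * Real.log b := by
  obtain ⟨h1, h2⟩ := leftMajorant_integral hb
  exact (intervalIntegral.norm_integral_le_of_norm_le (f := integrandQ₀ k t (b ^ 2)⁻¹) hb.le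
    (ae_of_all _ fun y hy => abs_integrandQ₀_le k t hy.1 hy.2) h1).trans h2

/-- The exponentially decaying weight in `Q₁`, an exact derivative. -/
lemma integral_weightQ₁ {b : ℝ} (hb : 1 < b) (m : ℕ) :
    IntegrableOn (fun y : ℝ => 1 / (√(y ^ 2 * (b ^ 2)⁻¹ - 1) *
      (y * b⁻¹ + √(y ^ 2 * (b ^ 2)⁻¹ - 1)) ^ (2 * m + 1))) (Set.Ioi b) ∧
    ∫ y in Set.Ioi b, 1 / (√(y ^ 2 * (b ^ 2)⁻¹ - 1) *
      (y * b⁻¹ + √(y ^ 2 * (b ^ 2)⁻¹ - 1)) ^ (2 * m + 1)) = b / (2 * m + 1) := by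
  have hb0 : 0 < b := by linarith
  -- The point is `u' = u/(b √(y²/b² - 1))`: the weight is then the derivative of a multiple of
  -- `u^{-(2m+1)}`, and `u(b) = 1`.
  set u : ℝ → ℝ := fun y => y * b⁻¹ + √(y ^ 2 * (b ^ 2)⁻¹ - 1) with hu
  set h : ℝ → ℝ := fun y => -(b / (2 * m + 1)) * ((u y) ^ (2 * m + 1))⁻¹ with hh
  have huc : Continuous u := by fun_prop
  have hub : u b = 1 := by
    simp only [hu]
    rw [mul_inv_cancel₀ hb0.ne', mul_inv_cancel₀ (by positivity), sub_self, Real.sqrt_zero, add_zero]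
  have hcont : ContinuousWithinAt h (Set.Ici b) b := by
    refine ContinuousAt.continuousWithinAt ?_
    refine continuousAt_const.mul (ContinuousAt.inv₀ (by fun_prop) ?_)
    rw [hub]; simp
  have hd : ∀ y ∈ Set.Ioi b, HasDerivAt h
      (1 / (√(y ^ 2 * (b ^ 2)⁻¹ - 1) * (u y) ^ (2 * m + 1))) y := by
    intro y hy
    have hy' : b < y := hy
    have hy0 : 0 < y := by linarith
    have hpos : 0 < y ^ 2 * (b ^ 2)⁻¹ - 1 := by
      rw [sub_pos, ← div_eq_mul_inv, lt_div_iff₀ (by positivity)]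
      nlinarith
    have hs := Real.sqrt_pos.mpr hpos
    have hupos : 0 < u y := by
      simp only [hu]; positivity
    have e1 : HasDerivAt u (b⁻¹ * u y / √(y ^ 2 * (b ^ 2)⁻¹ - 1)) y := by
      have := ((hasDerivAt_id y).mul_const b⁻¹).add
        (((((hasDerivAt_id y).pow 2).mul_const (b ^ 2)⁻¹).sub_const 1).sqrt hpos.ne')
      refine this.congr_deriv ?_
      simp only [hu, id, Pi.pow_apply]
      generalize √(y ^ 2 * (b ^ 2)⁻¹ - 1) = S at *
      field_simp
      norm_num
      ring
    refine (((e1.pow (2 * m + 1)).inv (pow_ne_zero _ hupos.ne')).const_mul _).congr_deriv ?_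
    have : (2 * (m : ℝ) + 1) ≠ 0 := by positivity
    simp only [Nat.cast_add, Nat.cast_mul, Nat.cast_ofNat, Nat.cast_one, Nat.add_sub_cancel,
      Pi.pow_apply]
    field_simp
    ring
  have hnn : ∀ y ∈ Set.Ioi b, 0 ≤ 1 / (√(y ^ 2 * (b ^ 2)⁻¹ - 1) * (u y) ^ (2 * m + 1)) := by
    intro y hy
    have hy' : b < y := hy
    have hy0 : 0 < y := by linarith
    have hupos : 0 ≤ u y := by
      simp only [hu]; positivity
    positivity
  have hlim : Tendsto h atTop (𝓝 0) := by
    have hut : Tendsto u atTop atTop :=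
      tendsto_atTop_mono (fun y => le_add_of_nonneg_right (Real.sqrt_nonneg _))
        (tendsto_id.atTop_mul_const (inv_pos.mpr hb0))
    have := (tendsto_inv_atTop_zero.comp
      ((tendsto_pow_atTop (n := 2 * m + 1) (by omega)).comp hut)).const_mul (-(b / (2 * m + 1)))
    simpa [hh] using this
  have hi := integrableOn_Ioi_deriv_of_nonneg hcont hd hnn hlim
  refine ⟨hi, ?_⟩
  rw [integral_Ioi_of_hasDerivAt_of_tendsto hcont hd hi hlim]
  simp only [hh, hub]
  simp

lemma abs_integrandQ₁_le {b : ℝ} (hb : 1 < b) (m : ℕ) (t : ℝ) {y : ℝ} (hy : b < y) :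
    |integrandQ₁ (m + 1) t (b ^ 2)⁻¹ y| ≤ 1 / √(b ^ 2 - 1) * (1 / (√(y ^ 2 * (b ^ 2)⁻¹ - 1) *
      (y * b⁻¹ + √(y ^ 2 * (b ^ 2)⁻¹ - 1)) ^ (2 * m + 1))) := by
  have hb0 : 0 < b := by linarith
  have hy0 : 0 < y := by linarith
  have s1 : 0 < √(b ^ 2 - 1) := Real.sqrt_pos.mpr (by nlinarith)
  have s2 : √(b ^ 2 - 1) ≤ √(y ^ 2 - 1) := Real.sqrt_le_sqrt (by nlinarith)
  have hpos : 0 < y ^ 2 * (b ^ 2)⁻¹ - 1 := by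
    rw [sub_pos, ← div_eq_mul_inv, lt_div_iff₀ (by positivity)]
    nlinarith
  have hs := Real.sqrt_pos.mpr hpos
  rw [integrandQ₁, sqrt_inv_sq hb0, show 2 * (m + 1) - 1 = 2 * m + 1 by omega, abs_mul, abs_div,
    abs_of_nonneg (by positivity : 0 ≤ √(y ^ 2 * (b ^ 2)⁻¹ - 1) * √(y ^ 2 - 1)),
    abs_of_nonneg (by positivity : 0 ≤ 1 / (y * b⁻¹ + √(y ^ 2 * (b ^ 2)⁻¹ - 1)) ^ (2 * m + 1))]
  calc _ ≤ 1 / (√(y ^ 2 * (b ^ 2)⁻¹ - 1) * √(b ^ 2 - 1)) *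
        (1 / (y * b⁻¹ + √(y ^ 2 * (b ^ 2)⁻¹ - 1)) ^ (2 * m + 1)) := by
        gcongr
        exact Real.abs_cos_le_one _
    _ = _ := by field_simp

lemma integrableOn_integrandQ₁ {b : ℝ} (hb : 1 < b) (m : ℕ) (t : ℝ) :
    IntegrableOn (integrandQ₁ (m + 1) t (b ^ 2)⁻¹) (Set.Ioi b) := by
  refine ((integral_weightQ₁ hb m).1.const_mul (1 / √(b ^ 2 - 1))).mono'
    (measurable_integrandQ₁ _ _ _).aestronglyMeasurable ?_
  exact (ae_restrict_mem measurableSet_Ioi).mono fun y hy => abs_integrandQ₁_le hb m t hy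

lemma abs_integral_integrandQ₁_le {b : ℝ} (hb : 1 < b) (m : ℕ) (t : ℝ) :
    |∫ y in Set.Ioi b, integrandQ₁ (m + 1) t (b ^ 2)⁻¹ y| ≤
      1 / √(b ^ 2 - 1) * (b / (2 * m + 1)) := by
  obtain ⟨h1, h2⟩ := integral_weightQ₁ hb m
  rw [← h2, ← integral_const_mul]
  refine norm_integral_le_of_norm_le (f := integrandQ₁ (m + 1) t (b ^ 2)⁻¹) (h1.const_mul _) ?_
  exact (ae_restrict_mem measurableSet_Ioi).mono fun y hy => abs_integrandQ₁_le hb m t hy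

/-- Under `y = cosh ξ` one has `ξ = log(y + √(y² - 1))`, and `b⁻¹ y < 1` means `y < b`, so the two
branches of `cosLimit` become the two integrands. -/
lemma integral_cosLimit {b : ℝ} (hb : 1 < b) (m : ℕ) (t : ℝ) :
    ∫ ξ in Set.Ioi (0 : ℝ), Real.cos (2 * t * ξ) * cosLimit (m + 1) (b⁻¹ * Real.cosh ξ) =
      (∫ y in (1 : ℝ)..b, integrandQ₀ (m + 1) t (b ^ 2)⁻¹ y) +
        (-1) ^ (m + 1) * ∫ y in Set.Ioi b, integrandQ₁ (m + 1) t (b ^ 2)⁻¹ y := by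
  have hb0 : 0 < b := by linarith
  set g : ℝ → ℝ := fun y => Real.cos (2 * t * Real.log (y + √(y ^ 2 - 1))) *
    cosLimit (m + 1) (b⁻¹ * y) / √(y ^ 2 - 1) with hg
  have hsq : ∀ y : ℝ, (b⁻¹ * y) ^ 2 = (b ^ 2)⁻¹ * y ^ 2 := fun y => by
    rw [mul_pow, inv_pow]
  have h0 : Set.EqOn g (integrandQ₀ (m + 1) t (b ^ 2)⁻¹) (Set.Ioo 1 b) := by
    intro y hy
    have hlt : b⁻¹ * y < 1 := by
      rw [inv_mul_lt_iff₀ hb0, mul_one]; exact hy.2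
    simp only [hg, integrandQ₀, cosLimit, if_pos hlt, hsq, sqrt_inv_sq hb0]
    rw [mul_comm y b⁻¹]
    ring
  have h1 : Set.EqOn g (fun y => (-1) ^ (m + 1) * integrandQ₁ (m + 1) t (b ^ 2)⁻¹ y)
      (Set.Ioi b) := by
    intro y hy
    have hlt : ¬ b⁻¹ * y < 1 := by
      rw [inv_mul_lt_iff₀ hb0, mul_one]; exact not_lt.mpr (le_of_lt hy)
    simp only [hg, integrandQ₁, cosLimit, if_neg hlt, hsq, sqrt_inv_sq hb0]
    rw [mul_comm y b⁻¹, mul_comm (y ^ 2) (b ^ 2)⁻¹]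
    ring
  have i0 : IntegrableOn g (Set.Ioo 1 b) := by
    have := intervalIntegrable_integrandQ₀ hb (m + 1) t
    rw [intervalIntegrable_iff_integrableOn_Ioo_of_le hb.le] at this
    exact this.congr_fun h0.symm measurableSet_Ioo
  have i1 : IntegrableOn g (Set.Ioi b) := by
    have : IntegrableOn (fun y => (-1) ^ (m + 1) * integrandQ₁ (m + 1) t (b ^ 2)⁻¹ y)
      (Set.Ioi b) := (integrableOn_integrandQ₁ hb m t).const_mul _
    exact this.congr_fun h1.symm measurableSet_Ioi
  have hsub := (integral_cosh_substitution g).2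
  have hleft : ∫ ξ in Set.Ioi (0 : ℝ), Real.cos (2 * t * ξ) * cosLimit (m + 1) (b⁻¹ * Real.cosh ξ) =
      ∫ ξ in Set.Ioi 0, Real.sinh ξ * g (Real.cosh ξ) := by
    refine setIntegral_congr_fun measurableSet_Ioi fun ξ hξ => ?_
    have hs : Real.sinh ξ ≠ 0 := (Real.sinh_pos_iff.mpr hξ).ne'
    simp only [hg]
    have : Real.log (Real.cosh ξ + √(Real.cosh ξ ^ 2 - 1)) = ξ := Real.arcosh_cosh (le_of_lt hξ)
    rw [this, sqrt_cosh_sq_sub_one hξ]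
    field_simp
  rw [hleft, ← hsub, ← Set.Ioc_union_Ioi_eq_Ioi hb.le, setIntegral_union
    (Set.Ioc_disjoint_Ioi le_rfl) measurableSet_Ioi
    ((integrableOn_Ioc_iff_integrableOn_Ioo).mpr i0) i1, integral_Ioc_eq_integral_Ioo,
    setIntegral_congr_fun measurableSet_Ioo h0, setIntegral_congr_fun measurableSet_Ioi h1,
    integral_const_mul, intervalIntegral.integral_of_le hb.le, integral_Ioc_eq_integral_Ioo]

/-! ### Exchange of integrations and passage to the limit -/

lemma continuous_kernelTrunc (t T : ℝ) : Continuous (kernelTrunc t T) := by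
  unfold kernelTrunc
  refine continuous_const.mul ?_
  refine intervalIntegral.continuous_parametric_intervalIntegral_of_continuous' ?_ _ _
  fun_prop

lemma continuous_cosTransform (n : ℕ) (R : ℝ) : Continuous (cosTransform n R) := by
  have := continuous_besselInt n
  unfold cosTransform
  refine intervalIntegral.continuous_parametric_intervalIntegral_of_continuous' ?_ _ _
  fun_prop

lemma abs_kernelTrunc_le (t x : ℝ) {T : ℝ} (hT : 0 ≤ T) : |kernelTrunc t T x| ≤ 2 / Real.pi * T := by
  have h := intervalIntegral.norm_integral_le_of_norm_le_const (a := 0) (b := T) (C := 1)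
    (f := fun ξ => Real.cos (x * Real.cosh ξ) * Real.cos (2 * t * ξ)) (fun ξ _ => by
      rw [norm_mul]
      exact mul_le_one₀ (Real.abs_cos_le_one _) (norm_nonneg _) (Real.abs_cos_le_one _))
  rw [one_mul, sub_zero, abs_of_nonneg hT, Real.norm_eq_abs] at h
  rw [kernelTrunc, abs_mul, abs_of_pos (by positivity)]
  gcongr

lemma tendsto_inv_sinh_atTop (c : ℝ) : Tendsto (fun T => c / Real.sinh T) atTop (𝓝 0) := by
  refine Tendsto.div_atTop tendsto_const_nhds ?_
  refine tendsto_atTop_mono' atTop ?_ tendsto_id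
  filter_upwards [eventually_ge_atTop 0] with T hT
  exact Real.self_le_sinh_iff.mpr hT

lemma tendsto_kernelTrunc (t : ℝ) {x : ℝ} (hx : 0 < x) :
    Tendsto (fun T => kernelTrunc t T x) atTop (𝓝 (kernelReal t x)) := by
  obtain ⟨C, hC0, hC⟩ := abs_kernelReal_sub_kernelTrunc_le t
  rw [tendsto_iff_norm_sub_tendsto_zero]
  refine squeeze_zero' (Eventually.of_forall fun _ => norm_nonneg _) ?_
    (tendsto_inv_sinh_atTop (C / x))
  filter_upwards [eventually_gt_atTop 0] with T hT
  rw [norm_sub_rev, div_div]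
  exact hC x T hx hT

/-- Measurability comes from the continuous truncations. Cutting at `T = 1` bounds the kernel by a
constant plus a multiple of `1/y`, so the product with the Bessel function is bounded. -/
lemma intervalIntegrable_besselInt_mul_kernelReal {n : ℕ} (hn : n ≠ 0) {w R : ℝ} (hw : 0 < w)
    (hR : 0 < R) (t : ℝ) :
    IntervalIntegrable (fun y => besselInt n y * kernelReal t (y * w)) volume 0 R := by
  obtain ⟨C, hC0, hC⟩ := abs_kernelReal_sub_kernelTrunc_le t
  have hc := continuous_besselInt n
  rw [intervalIntegrable_iff_integrableOn_Ioc_of_le hR.le]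
  have hmeas : AEStronglyMeasurable (fun y => besselInt n y * kernelReal t (y * w))
      (volume.restrict (Set.Ioc 0 R)) := by
    refine hc.aestronglyMeasurable.mul ?_
    refine aestronglyMeasurable_of_tendsto_ae (u := atTop)
      (f := fun (T : ℝ) y => kernelTrunc t T (y * w)) (fun T => ?_) ?_
    · have := continuous_kernelTrunc t T
      exact (by fun_prop : Continuous _).aestronglyMeasurable
    · exact (ae_restrict_mem measurableSet_Ioc).mono fun y hy =>
        tendsto_kernelTrunc t (mul_pos hy.1 hw)
  have hs1 : 0 < Real.sinh 1 := Real.sinh_pos_iff.mpr one_pos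
  have hconst : IntegrableOn (fun _ : ℝ => 2 / Real.pi + C / (w * Real.sinh 1)) (Set.Ioc 0 R) :=
    integrableOn_const (by simp)
  refine hconst.mono' hmeas ((ae_restrict_mem measurableSet_Ioc).mono fun y hy => ?_)
  have hy0 : 0 < y := hy.1
  have h1 := hC (y * w) 1 (mul_pos hy0 hw) one_pos
  have h2 := abs_kernelTrunc_le t (y * w) zero_le_one
  rw [mul_one] at h2
  have h3 : |kernelReal t (y * w)| ≤ 2 / Real.pi + C / (y * w * Real.sinh 1) := by
    have := abs_add_le (kernelTrunc t 1 (y * w)) (kernelReal t (y * w) - kernelTrunc t 1 (y * w))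
    rw [add_sub_cancel] at this
    linarith
  rw [norm_mul, Real.norm_eq_abs, Real.norm_eq_abs]
  have hj1 := abs_besselInt_le_one n y
  have hj2 := abs_besselInt_le hn hy0.le
  have hpi := Real.pi_pos
  calc |besselInt n y| * |kernelReal t (y * w)|
      ≤ |besselInt n y| * (2 / Real.pi + C / (y * w * Real.sinh 1)) := by gcongr
    _ = |besselInt n y| * (2 / Real.pi) + |besselInt n y| * (C / (y * w * Real.sinh 1)) := by ring
    _ ≤ 1 * (2 / Real.pi) + y * (C / (y * w * Real.sinh 1)) := by gcongr
    _ = _ := by field_simp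

lemma integral_besselInt_mul_kernelTrunc (n : ℕ) {w R T : ℝ} (hT : 0 ≤ T) (t : ℝ) :
    ∫ y in (0 : ℝ)..R, besselInt n y * kernelTrunc t T (y * w) =
      2 / Real.pi * ∫ ξ in (0 : ℝ)..T, Real.cos (2 * t * ξ) * cosTransform n R (w * Real.cosh ξ) := by
  have hc := continuous_besselInt n
  have hswap := intervalIntegral_integral_swap (a := 0) (b := R)
    (μ := volume.restrict (Set.Ioc 0 T))
    (f := fun y ξ => besselInt n y * (Real.cos (y * w * Real.cosh ξ) * Real.cos (2 * t * ξ))) (by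
      have hcont : Continuous (Function.uncurry fun y ξ : ℝ =>
          besselInt n y * (Real.cos (y * w * Real.cosh ξ) * Real.cos (2 * t * ξ))) := by
        unfold Function.uncurry
        fun_prop
      have h1 : IntegrableOn (fun _ : ℝ => (1 : ℝ)) (Set.uIoc 0 R) :=
        (intervalIntegrable_const (c := (1 : ℝ))).def'
      have h2 : IntegrableOn (fun _ : ℝ => (1 : ℝ)) (Set.Ioc 0 T) := integrableOn_const (by simp)
      refine (h1.mul_prod h2).mono' hcont.aestronglyMeasurable (ae_of_all _ fun p => ?_)
      simp only [Function.uncurry, norm_mul, mul_one]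
      refine mul_le_one₀ (abs_besselInt_le_one n _) (by positivity) ?_
      exact mul_le_one₀ (Real.abs_cos_le_one _) (norm_nonneg _) (Real.abs_cos_le_one _))
  have hl : ∀ y : ℝ, besselInt n y * kernelTrunc t T (y * w) = 2 / Real.pi *
      ∫ ξ in Set.Ioc 0 T,
        besselInt n y * (Real.cos (y * w * Real.cosh ξ) * Real.cos (2 * t * ξ)) := by
    intro y
    rw [integral_const_mul, kernelTrunc, intervalIntegral.integral_of_le hT]
    ring
  simp only [hl]
  rw [intervalIntegral.integral_const_mul, hswap, intervalIntegral.integral_of_le hT]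
  congr 2
  ext ξ
  rw [cosTransform, ← intervalIntegral.integral_const_mul]
  congr 1
  ext y
  rw [show w * Real.cosh ξ * y = y * w * Real.cosh ξ by ring]
  ring

lemma cosh_ne_ae {b : ℝ} (hb : 1 < b) :
    ∀ᵐ ξ ∂(volume.restrict (Set.Ioi (0 : ℝ))), b⁻¹ * Real.cosh ξ ≠ 1 := by
  have h1 : ∀ᵐ ξ : ℝ ∂(volume.restrict (Set.Ioi (0 : ℝ))), ξ ≠ Real.arcosh b :=
    ae_restrict_of_ae (Measure.ae_ne volume _)
  filter_upwards [h1, ae_restrict_mem measurableSet_Ioi] with ξ hξ hξ0 h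
  apply hξ
  have : Real.cosh ξ = b := by
    have hb0 : b ≠ 0 := by linarith
    field_simp at h
    exact h
  rw [← this, Real.arcosh_cosh (le_of_lt hξ0)]

lemma integrableOn_cos_mul_cosTransform {b : ℝ} (hb : 1 < b) (n : ℕ) {R : ℝ} (hR : 0 ≤ R) (t : ℝ) :
    IntegrableOn (fun ξ => Real.cos (2 * t * ξ) * cosTransform n R (b⁻¹ * Real.cosh ξ))
      (Set.Ioi 0) := by
  obtain ⟨C, hC0, hC⟩ := abs_cosTransform_le n
  have hc := continuous_cosTransform n R
  have hb0 : 0 < b := by linarith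
  refine ((integrableOn_dominating hb).const_mul C).mono'
    (by fun_prop : Continuous _).aestronglyMeasurable ?_
  filter_upwards [cosh_ne_ae hb] with ξ hξ
  rw [norm_mul, mul_one_div]
  have h1 := hC R (b⁻¹ * Real.cosh ξ) hR (by positivity) hξ
  exact (mul_le_of_le_one_left (norm_nonneg _) (Real.abs_cos_le_one _)).trans h1

/-- Fubini holds for the truncated kernel. Truncation changes the integral over `(0, R)` by at most
a multiple of `R/sinh T`, so `T → ∞` for fixed `R`. -/
lemma integral_besselInt_mul_kernelReal {b : ℝ} (hb : 1 < b) {n : ℕ} (hn : n ≠ 0) {R : ℝ}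
    (hR : 0 < R) (t : ℝ) :
    ∫ y in (0 : ℝ)..R, besselInt n y * kernelReal t (y * b⁻¹) =
      2 / Real.pi *
        ∫ ξ in Set.Ioi (0 : ℝ), Real.cos (2 * t * ξ) * cosTransform n R (b⁻¹ * Real.cosh ξ) := by
  obtain ⟨C, hC0, hC⟩ := abs_kernelReal_sub_kernelTrunc_le t
  have hb0 : 0 < b := by linarith
  have hw : 0 < b⁻¹ := inv_pos.mpr hb0
  have hc := continuous_besselInt n
  have hlim1 : Tendsto (fun T => ∫ y in (0 : ℝ)..R, besselInt n y * kernelTrunc t T (y * b⁻¹)) atTop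
      (𝓝 (2 / Real.pi *
        ∫ ξ in Set.Ioi (0 : ℝ), Real.cos (2 * t * ξ) * cosTransform n R (b⁻¹ * Real.cosh ξ))) := by
    have := (intervalIntegral_tendsto_integral_Ioi 0
      (integrableOn_cos_mul_cosTransform hb n hR.le t) tendsto_id).const_mul (2 / Real.pi)
    refine this.congr' ?_
    filter_upwards [eventually_ge_atTop 0] with T hT
    exact (integral_besselInt_mul_kernelTrunc n hT t).symm
  refine tendsto_nhds_unique ?_ hlim1
  rw [tendsto_iff_norm_sub_tendsto_zero]
  refine squeeze_zero' (Eventually.of_forall fun _ => norm_nonneg _) ?_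
    (tendsto_inv_sinh_atTop (C / b⁻¹ * R))
  filter_upwards [eventually_gt_atTop 0] with T hT
  have hs : 0 < Real.sinh T := Real.sinh_pos_iff.mpr hT
  have hct := continuous_kernelTrunc t T
  rw [← intervalIntegral.integral_sub ((by fun_prop : Continuous _).intervalIntegrable _ _)
    (intervalIntegrable_besselInt_mul_kernelReal hn hw hR t)]
  have hbd := intervalIntegral.norm_integral_le_of_norm_le_const (a := 0) (b := R)
    (C := C / (b⁻¹ * Real.sinh T))
    (f := fun y => besselInt n y * kernelTrunc t T (y * b⁻¹) -
      besselInt n y * kernelReal t (y * b⁻¹)) (fun y hy => by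
        rw [Set.uIoc_of_le hR.le] at hy
        have hy0 : 0 < y := hy.1
        rw [← mul_sub, norm_mul, norm_sub_rev]
        have h1 := hC (y * b⁻¹) T (by positivity) hT
        calc _ ≤ y * (C / (y * b⁻¹ * Real.sinh T)) := by
              gcongr
              · exact abs_besselInt_le hn hy0.le
              · exact h1
          _ = _ := by field_simp)
  refine hbd.trans (le_of_eq ?_)
  rw [sub_zero, abs_of_pos hR]
  field_simp

/-- Dominated convergence as `R → ∞` in the ξ-integral, valid off the null set `cosh ξ = b`, where
the transform has no bound. -/
lemma tendsto_integral_besselInt_mul_kernelReal {b : ℝ} (hb : 1 < b) (m : ℕ) (t : ℝ) :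
    Tendsto (fun R => ∫ y in (0 : ℝ)..R, besselInt (2 * m + 1) y * kernelReal t (y * b⁻¹)) atTop
      (𝓝 (2 / Real.pi * ((∫ y in (1 : ℝ)..b, integrandQ₀ (m + 1) t (b ^ 2)⁻¹ y) +
        (-1) ^ (m + 1) * ∫ y in Set.Ioi b, integrandQ₁ (m + 1) t (b ^ 2)⁻¹ y))) := by
  have hb0 : 0 < b := by linarith
  obtain ⟨C, hC0, hC⟩ := abs_cosTransform_le (2 * m + 1)
  have hdct : Tendsto (fun R => ∫ ξ in Set.Ioi (0 : ℝ),
      Real.cos (2 * t * ξ) * cosTransform (2 * m + 1) R (b⁻¹ * Real.cosh ξ)) atTop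
      (𝓝 (∫ ξ in Set.Ioi (0 : ℝ),
        Real.cos (2 * t * ξ) * cosLimit (m + 1) (b⁻¹ * Real.cosh ξ))) := by
    refine tendsto_integral_filter_of_dominated_convergence
      (fun ξ => C * (1 / √|1 - b⁻¹ * Real.cosh ξ|)) ?_ ?_ ?_ ?_
    · refine Eventually.of_forall fun R => ?_
      have hc := continuous_cosTransform (2 * m + 1) R
      exact (by fun_prop : Continuous _).aestronglyMeasurable
    · filter_upwards [eventually_ge_atTop 0] with R hR
      filter_upwards [cosh_ne_ae hb] with ξ hξ
      rw [norm_mul, mul_one_div]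
      have h1 := hC R (b⁻¹ * Real.cosh ξ) hR (by positivity) hξ
      exact (mul_le_of_le_one_left (norm_nonneg _) (Real.abs_cos_le_one _)).trans h1
    · exact (integrableOn_dominating hb).const_mul C
    · filter_upwards [cosh_ne_ae hb] with ξ hξ
      refine Tendsto.const_mul _ ?_
      have := cosTransform_tendsto_cosLimit (k := m + 1) (by omega)
        (a := b⁻¹ * Real.cosh ξ) (by positivity) hξ
      rwa [show 2 * (m + 1) - 1 = 2 * m + 1 by omega] at this
  rw [integral_cosLimit hb] at hdct
  refine (hdct.const_mul (2 / Real.pi)).congr' ?_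
  filter_upwards [eventually_gt_atTop 0] with R hR
  exact (integral_besselInt_mul_kernelReal hb (by omega) hR t).symm

/-! ### The improper integral and its bound, with `b = 1/√z` -/

lemma integrandI_eq {b : ℝ} (hb : 0 < b) (m : ℕ) (t : ℝ) {y : ℝ} (hy : 0 < y) :
    integrandI (m + 1) t (b ^ 2)⁻¹ y =
      ((besselInt (2 * m + 1) y * kernelReal t (y * b⁻¹) : ℝ) : ℂ) := by
  rw [integrandI, sqrt_inv_sq hb, kPlus_eq_kernelReal (by positivity), Complex.ofReal_mul,
    ← besselJ_natCast hy]
  congr 2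
  push_cast
  ring

theorem hasImproperIntegral_integrandI {b : ℝ} (hb : 1 < b) (m : ℕ) (t : ℝ) :
    HasImproperIntegral (integrandI (m + 1) t (b ^ 2)⁻¹)
      ((2 / Real.pi * ((∫ y in (1 : ℝ)..b, integrandQ₀ (m + 1) t (b ^ 2)⁻¹ y) +
        (-1) ^ (m + 1) * ∫ y in Set.Ioi b, integrandQ₁ (m + 1) t (b ^ 2)⁻¹ y) : ℝ) : ℂ) := by
  have hb0 : 0 < b := by linarith
  have heq : ∀ R : ℝ, 0 < R → Set.EqOn (integrandI (m + 1) t (b ^ 2)⁻¹)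
      (fun y => ((besselInt (2 * m + 1) y * kernelReal t (y * b⁻¹) : ℝ) : ℂ)) (Set.uIoc 0 R) := by
    intro R hR y hy
    rw [Set.uIoc_of_le hR.le] at hy
    exact integrandI_eq hb0 m t hy.1
  constructor
  · intro R hR
    refine IntervalIntegrable.congr (heq R hR).symm ?_
    have h := intervalIntegrable_besselInt_mul_kernelReal (n := 2 * m + 1) (by omega)
      (inv_pos.mpr hb0) hR t
    exact ⟨h.1.ofReal, h.2.ofReal⟩
  · have h := (Complex.continuous_ofReal.tendsto _).comp
      (tendsto_integral_besselInt_mul_kernelReal hb m t)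
    refine h.congr' ?_
    filter_upwards [eventually_gt_atTop 0] with R hR
    simp only [Function.comp_apply]
    rw [← intervalIntegral.integral_ofReal]
    refine intervalIntegral.integral_congr_ae (ae_of_all _ fun y hy => ?_)
    exact (heq R hR hy).symm

lemma HasImproperIntegral.integralI_eq {k : ℕ} {t z : ℝ} {L : ℂ}
    (h : HasImproperIntegral (integrandI k t z) L) : integralI k t z = L :=
  h.2.limUnder_eq

lemma exists_eq_inv_sq {z : ℝ} (hz : 0 < z) (hz1 : z < 1) : ∃ b : ℝ, 1 < b ∧ z = (b ^ 2)⁻¹ := by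
  have hs := Real.sqrt_pos.mpr hz
  refine ⟨(√z)⁻¹, ?_, ?_⟩
  · exact (one_lt_inv₀ hs).mpr (by rw [Real.sqrt_lt' one_pos]; simpa using hz1)
  · rw [inv_pow, inv_inv, Real.sq_sqrt hz.le]

lemma two_div_pi_mul_abs_le {A B a b s : ℝ} (hs : |s| ≤ 1) (hA : |A| ≤ a) (hB : |B| ≤ b) :
    |2 / Real.pi * (A + s * B)| ≤ a + b := by
  have hpi : 2 / Real.pi ≤ 1 := by
    rw [div_le_one Real.pi_pos]
    linarith [Real.pi_gt_three]
  have h1 : |A + s * B| ≤ a + b := by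
    refine (abs_add_le _ _).trans (add_le_add hA ?_)
    rw [abs_mul]
    exact (mul_le_of_le_one_left (abs_nonneg _) hs).trans hB
  rw [abs_mul, abs_of_pos (div_pos two_pos Real.pi_pos)]
  exact (mul_le_of_le_one_left (abs_nonneg _) hpi).trans h1

lemma abs_limit_le {b : ℝ} (hb : 1 < b) (m : ℕ) (t : ℝ) :
    |2 / Real.pi * ((∫ y in (1 : ℝ)..b, integrandQ₀ (m + 1) t (b ^ 2)⁻¹ y) +
        (-1) ^ (m + 1) * ∫ y in Set.Ioi b, integrandQ₁ (m + 1) t (b ^ 2)⁻¹ y)| ≤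
      7 * (1 + |Real.log (b ^ 2)⁻¹| +
        1 / ((2 * ((m + 1 : ℕ) : ℝ) - 1) * √(1 - (b ^ 2)⁻¹))) := by
  have hb0 : 0 < b := by linarith
  -- In terms of `z`, `2 log b = |log z|` and `b/√(b² - 1) = 1/√(1 - z)`; the constant 7 is the
  -- additive constant in the bound for `Q₀`.
  have h := two_div_pi_mul_abs_le (s := (-1) ^ (m + 1)) (by simp)
    (abs_integral_integrandQ₀_le hb (m + 1) t) (abs_integral_integrandQ₁_le hb m t)
  refine h.trans ?_
  have hlog : |Real.log (b ^ 2)⁻¹| = 2 * Real.log b := by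
    rw [Real.log_inv, Real.log_pow, abs_neg, abs_of_nonneg]
    · norm_num
    · have := Real.log_pos hb
      positivity
  have hb2 : 0 < b ^ 2 - 1 := by nlinarith
  have hs : √(1 - (b ^ 2)⁻¹) = √(b ^ 2 - 1) / b := by
    rw [show 1 - (b ^ 2)⁻¹ = (b ^ 2 - 1) / b ^ 2 by field_simp, Real.sqrt_div' _ (by positivity),
      Real.sqrt_sq hb0.le]
  have sp := Real.sqrt_pos.mpr hb2
  have hterm : 1 / ((2 * ((m + 1 : ℕ) : ℝ) - 1) * √(1 - (b ^ 2)⁻¹)) =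
      1 / √(b ^ 2 - 1) * (b / (2 * m + 1)) := by
    rw [hs]
    push_cast
    rw [show 2 * ((m : ℝ) + 1) - 1 = 2 * m + 1 by ring]
    field_simp
  rw [hlog, hterm]
  have h1 := Real.log_pos hb
  have h2 : 0 ≤ 1 / √(b ^ 2 - 1) * (b / (2 * m + 1)) := by positivity
  linarith

end BesselDecomp

end

theorem mainTheorem4 :
    (∀ (k : ℕ) (t z : ℝ), 1 ≤ k → 0 < z → z < 1 →
      BesselDecomp.HasImproperIntegral (BesselDecomp.integrandI k t z)
          (BesselDecomp.integralI k t z) ∧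
        IntervalIntegrable (BesselDecomp.integrandQ₀ k t z) MeasureTheory.volume 1 (1 / √z) ∧
        MeasureTheory.IntegrableOn (BesselDecomp.integrandQ₁ k t z) (Set.Ioi (1 / √z)) ∧
        BesselDecomp.integralI k t z =
          2 / (Real.pi : ℂ) *
            ((BesselDecomp.Q₀ k t z : ℂ) + (-1) ^ k * (BesselDecomp.Q₁ k t z : ℂ))) ∧
    (∃ C : ℝ, 0 < C ∧ ∀ (k : ℕ) (t z : ℝ), 1 ≤ k → 0 < z → z < 1 →
      ‖BesselDecomp.integralI k t z‖ ≤
        C * (1 + |Real.log z| + 1 / ((2 * (k : ℝ) - 1) * √(1 - z)))) := by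
  open BesselDecomp in
  refine ⟨fun k t z hk hz hz1 => ?_, 7, by norm_num, fun k t z hk hz hz1 => ?_⟩
  · obtain ⟨b, hb, rfl⟩ := exists_eq_inv_sq hz hz1
    obtain ⟨m, rfl⟩ : ∃ m, k = m + 1 := ⟨k - 1, by omega⟩
    have h := hasImproperIntegral_integrandI hb m t
    have hb' : 1 / √((b ^ 2)⁻¹) = b := by
      rw [sqrt_inv_sq (by linarith), one_div, inv_inv]
    rw [Q₀, Q₁, h.integralI_eq, hb']
    refine ⟨h, intervalIntegrable_integrandQ₀ hb _ t, integrableOn_integrandQ₁ hb m t, ?_⟩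
    push_cast
    rfl
  · obtain ⟨b, hb, rfl⟩ := exists_eq_inv_sq hz hz1
    obtain ⟨m, rfl⟩ : ∃ m, k = m + 1 := ⟨k - 1, by omega⟩
    rw [(hasImproperIntegral_integrandI hb m t).integralI_eq, Complex.norm_real]
    exact abs_limit_le hb m t
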